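/- **Setting.** Let $N=2$, $\omega=-1$, $n\ge 1$, and let $a_k,b_k,c_k,d_k,\varkappa_k\in\mathbb C$ ($1\le k\le n$) be parameters. On $(\mathbb C^2)^{\otimes n}$, with basis $|\gamma_1,\dots,\gamma_n\rangle$, $\gamma_k\in\mathbb Z_2$, let $u_k|\gamma\rangle=(-1)^{\gamma_k}|\gamma\rangle$, $v_k|\gamma\rangle=|\gamma+e_k\rangle$, $V_n=v_1\cdots v_n$, and $$L_k(\lambda)=\begin{pmatrix}1+\lambda\varkappa_kv_k&\lambda u_k^{-1}(a_k-b_kv_k)\\ u_k(c_k-d_kv_k)&\lambda a_kc_k+v_kb_kd_k/\varkappa_k\end{pmatrix},\quad L_1(\lambda)\cdots L_n(\lambda)=\begin{pmatrix}A_n&B_n\\C_n&D_n\end{pmatrix},\quad \mathbf t_n(\lambda)=A_n(\lambda)+D_n(\lambda).$$ Left vectors are paired with right vectors by $\langle\gamma'|\gamma\rangle=\delta_{\gamma',\gamma}$. *Roots and Fermat points.* Let $\mathcal L_k(z)=\begin{pmatrix}1-\varkappa_k^2z&-z(a_k^2-b_k^2)\\c_k^2-d_k^2&b_k^2d_k^2/\varkappa_k^2-za_k^2c_k^2\end{pmatrix}$.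 Choose $r_k$ with $r_k^2=a_k^2-b_k^2$ and $r_{m,0},\dots,r_{m,m-1}$ ($1\le m\le n$) with $(\mathcal L_1\cdots\mathcal L_m)_{12}(z)=-z\,r_{m,0}^2\prod_{k=1}^{m-1}(r_{m,k}^2-z)$ and $r_{1,0}=r_1$; put $\tilde r_m=\prod_{k=0}^{m-1}r_{m,k}$ and $\tilde r_n'=\prod_{k=1}^{n-1}r_{n,k}$. For a point $p=(x,y)$ with $x^2+y^2=1$ let $w_p(0)=1$, $w_p(1)=y/(1+x)$. Put $$p_{m,0}=\Big(\tfrac{r_{m-1,0}a_mc_m}{r_{m,0}},\tfrac{\varkappa_1\cdots\varkappa_{m-1}r_m}{r_{m,0}}\Big),\qquad \tilde p_m=\Big(\tfrac{r_m}{\tilde r_m},\tfrac{b_md_m\tilde r_{m-1}}{\varkappa_m\tilde r_m}\Big)\qquad(m\ge2),$$ and choose $y_{m,l},\tilde y_{m,l}$ ($1\le l<m<n$) and $y_{m,l}^{m',k}$ ($1\le l<m$, $1\le k<m'\le n$, with $m'=m$, $k\neq l$, or $m'=m+1$) so that the points $p_{m,l}=(a_m\varkappa_mr_{m,l}/b_m,\,y_{m,l})$,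 $\tilde p_{m,l}=(d_m/(\varkappa_mc_mr_{m,l}),\,\tilde y_{m,l})$, $p_{m,l}^{m',k}=(r_{m',k}/r_{m,l},\,y_{m,l}^{m',k})$ lie on $x^2+y^2=1$, the sign of $y_{m,l}$ being fixed, for $1\le l<m<n$, by $$\tilde r_{m-1}r_{m+1}b_mc_m\,y_{m,l}\tilde y_{m,l}\prod_{s=1}^{m-2}y_{m-1,s}^{m,l}\prod_{j\ne l}y_{m,l}^{m,j}=r_m\,r_{m+1,0}\prod_{s=1}^{m-1}r_{m,s}\prod_{k=1}^{m}y_{m,l}^{m+1,k}\prod_{j\ne l}y_{m,j}^{m,l}.$$ (The products over $j\neq l$ run over $1\le j\le m-1$.) *Genericity.* All $a_k,b_k,c_k,d_k,\varkappa_k,r_k,r_{m,k}$ are non-zero; for $1\le l<m\le n$ the squares $r_{m,l}^2$ are distinct for distinct $l$, they differ from $r_{m+1,k}^2$ ($1\le k\le m<n$), and $(a_m\varkappa_mr_{m,l}/b_m)^2\ne1\ne(d_m/(\varkappa_mc_mr_{m,l}))^2$. *Eigenvectors of $B_n$.* One site: $|\psi_\sigma\rangle_k=\sum_\gamma w_{(r_k/a_k,\,b_k/a_k)}(\gamma-\sigma)|\gamma\rangle_k$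 and ${}_k\langle\psi_\sigma|=\sum_\gamma w_{(r_k/a_k,\,-b_k/a_k)}(\gamma-\sigma-1)^{-1}\,{}_k\langle\gamma|$. For $\boldsymbol\rho_n=(\rho_{n,0},\dots,\rho_{n,n-1})\in\mathbb Z_2^n$ let $\tilde\rho_n=\sum_k\rho_{n,k}$, $\boldsymbol\rho_n'=(\rho_{n,1},\dots,\rho_{n,n-1})$, and define recursively $|\Psi_{\boldsymbol\rho_1}\rangle=|\psi_{\rho_{1,0}}\rangle_1$, $\langle\Psi_{\boldsymbol\rho_1}|={}_1\langle\psi_{\rho_{1,0}}|$, $$|\Psi_{\boldsymbol\rho_n}\rangle=\sum_{\boldsymbol\rho_{n-1},\sigma}Q^R\,|\Psi_{\boldsymbol\rho_{n-1}}\rangle\otimes|\psi_\sigma\rangle_n,\qquad \langle\Psi_{\boldsymbol\rho_n}|=\sum_{\boldsymbol\rho_{n-1},\sigma}Q^L\,\langle\Psi_{\boldsymbol\rho_{n-1}}|\otimes{}_n\langle\psi_\sigma|,$$ $$Q^R=\frac{(-1)^{(\tilde\rho_n-\tilde\rho_{n-1})(\sigma-\rho_{n,0})}}{w_{p_{n,0}}(\rho_{n,0}-\rho_{n-1,0}-1)\,w_{\tilde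 p_n}(\tilde\rho_n-\sigma-1)}\cdot\frac{\prod_{l=1}^{n-2}\prod_{k=1}^{n-1}w_{p_{n-1,l}^{n,k}}(\rho_{n-1,l}-\rho_{n,k})}{\prod_{j\ne l}w_{p_{n-1,j}^{n-1,l}}(\rho_{n-1,j}-\rho_{n-1,l})}\prod_{l=1}^{n-2}\frac{w_{p_{n-1,l}}(-\rho_{n-1,l})}{w_{\tilde p_{n-1,l}}(\rho_{n-1,l})},$$ $$Q^L=(-1)^{(\tilde\rho_n-\tilde\rho_{n-1})(\sigma-\rho_{n,0})+\tilde\rho_{n-1}-\rho_{n-1,0}}\prod_{j\ne l}w_{p_{n-1,j}^{n-1,l}}(\rho_{n-1,j}-\rho_{n-1,l}-1)\cdot\frac{w_{p_{n,0}}(\rho_{n,0}-\rho_{n-1,0})\,w_{\tilde p_n}(\tilde\rho_n-\sigma)}{\prod_{l=1}^{n-2}\prod_{k=1}^{n-1}w_{p_{n-1,l}^{n,k}}(\rho_{n-1,l}-\rho_{n,k}-1)}\prod_{l=1}^{n-2}\frac{w_{\tilde p_{n-1,l}}(\rho_{n-1,l})}{w_{p_{n-1,l}}(-\rho_{n-1,l})}$$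 ($1\le j,l\le n-2$ in $\prod_{j\neq l}$). For $\rho\in\mathbb Z_2$ put $|\tilde\Psi_{\rho,\boldsymbol\rho_n'}\rangle=\sum_{\rho_{n,0}}(-1)^{\rho\rho_{n,0}}|\Psi_{\boldsymbol\rho_n}\rangle$, $\langle\tilde\Psi_{\rho,\boldsymbol\rho_n'}|=\sum_{\rho_{n,0}}(-1)^{\rho\rho_{n,0}}\langle\Psi_{\boldsymbol\rho_n}|$. *Eigenvalue and Baxter equations.* Let $t(\lambda)=\Lambda\prod_{k=1}^n(\lambda+\mu_k)$ be the eigenvalue of $\mathbf t_n(\lambda)$ (for all $\lambda$) on some right eigenvector with $V_n=(-1)^\rho$, and assume $t(r_{n,k})\neq0$ for $1\le k\le n-1$. Thus the zeros of $t$ are the numbers $-\mu_k$. With $F_m(\lambda)=(b_m-a_m\varkappa_m\lambda)(\lambda c_m+d_m/\varkappa_m)$ and $$\chi_k=\frac{r_{n,0}\tilde r_{n-1}}{r_n\tilde r_n}\prod_{s\ne k}\frac{y_{n,k}^{n,s}}{y_{n,s}^{n,k}}\prod_{s=1}^{n-2}y_{n-1,s}^{n,k},\quad \Delta_k^+(\lambda)=\frac{(-1)^\rho}{\chi_k}(-\lambda)^{1-n}\prod_{m=1}^{n-1}F_m(-\lambda),\quad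 \Delta_k^-(\lambda)=\chi_k(-\lambda)^{n-1}F_n(-\lambda),$$ let $q_k^R,q_k^L:\mathbb Z_2\to\mathbb C$ ($1\le k\le n-1$) satisfy $q_k^R(0)=q_k^L(0)=1$ and, for $\gamma\in\mathbb Z_2$ and $\lambda=-r_{n,k}(-1)^{\gamma}$, $$t(\lambda)q_k^R(\gamma)=\Delta_k^+(\lambda)q_k^R(\gamma+1)+\Delta_k^-(-\lambda)q_k^R(\gamma-1),$$ $$t(\lambda)q_k^L(\gamma)=(-1)^{n-1}\Delta_k^-(\lambda)q_k^L(\gamma+1)+(-1)^{1-n}\Delta_k^+(-\lambda)q_k^L(\gamma-1).$$ Put $$|\Phi\rangle=\sum_{\boldsymbol\rho_n'}\frac{\prod_kq_k^R(\rho_{n,k})}{\prod_{s\ne s'}w_{p_{n,s}^{n,s'}}(\rho_{n,s}-\rho_{n,s'})}|\tilde\Psi_{\rho,\boldsymbol\rho_n'}\rangle,\qquad\langle\Phi|=\sum_{\boldsymbol\rho_n'}\frac{\prod_kq_k^L(\rho_{n,k})}{\prod_{s\ne s'}w_{p_{n,s}^{n,s'}}(\rho_{n,s}-\rho_{n,s'})}\langle\tilde\Psi_{\rho,\boldsymbol\rho_n'}|.$$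 **Theorem.** $|\Phi\rangle$ and $\langle\Phi|$ are (non-zero) right and left eigenvectors of $\mathbf t_n(\lambda)$ with eigenvalue $t(\lambda)$ and of $V_n$ with eigenvalue $(-1)^\rho$; moreover $\langle\tilde\Psi_{0,\mathbf 0}|\tilde\Psi_{0,\mathbf 0}\rangle\ne0$ and $$\frac{\langle\Phi|\Phi\rangle}{\langle\tilde\Psi_{0,\mathbf 0}|\tilde\Psi_{0,\mathbf 0}\rangle}=2^{n-1}\,\tilde r_n'\,\frac{\prod_{1\le l<m\le n-1}(r_{n,m}+r_{n,l})}{\prod_{k=1}^n\prod_{l=1}^{n-1}(r_{n,l}+\mu_k)}\prod_{1\le i<j\le n}(\mu_i+\mu_j).$$ -/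

import Mathlib

open Matrix Finset

noncomputable section

namespace BBS

/-! ## Signs and the cyclic function at the root of unity `ω = -1` (that is, `N = 2`) -/

/-- `ω ^ γ = (-1) ^ γ` for `γ ∈ ℤ/2`. -/
def sgn (γ : ZMod 2) : ℂ := if γ = 0 then 1 else -1

/-- The cyclic function `w_p` of a point `p = (x, y)` of the Fermat curve `x² + y² = 1`,
normalised by `w_p(0) = 1`; see `w_div_w` for its difference equation. -/
def w (p : ℂ × ℂ) (γ : ZMod 2) : ℂ := if γ = 0 then 1 else p.2 / (1 + p.1)

/-- The defining difference equation `w_p(γ) / w_p(γ - 1) = y / (1 - ω^γ x)`. -/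
theorem w_div_w (p : ℂ × ℂ) (hp : p.1 ^ 2 + p.2 ^ 2 = 1) (hy : p.2 ≠ 0) (γ : ZMod 2) :
    w p γ / w p (γ - 1) = p.2 / (1 - sgn γ * p.1) := by
  have h : (1 + p.1) * (1 - p.1) = p.2 ^ 2 := by linear_combination -hp
  have h0 : (1 + p.1) * (1 - p.1) ≠ 0 := by rw [h]; exact pow_ne_zero 2 hy
  have h1 : 1 + p.1 ≠ 0 := left_ne_zero_of_mul h0
  have h2 : 1 - p.1 ≠ 0 := right_ne_zero_of_mul h0
  obtain rfl | rfl : γ = 0 ∨ γ = 1 := by revert γ; decide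
  · have e : ((0 : ZMod 2) - 1) ≠ 0 := by decide
    simp only [w, sgn, if_true, if_neg e]
    field_simp
    linear_combination h
  · simp [w, sgn]

/-! ## The model: `L`-operators, monodromy matrix, transfer matrix -/

/-- The parameters of the model; sites are numbered `1, 2, 3, …`. -/
structure Params where
  a : ℕ → ℂ
  b : ℕ → ℂ
  c : ℕ → ℂ
  d : ℕ → ℂ
  κ : ℕ → ℂ

/-- Labels `(γ_1, …, γ_n)` of the basis `|γ_1⟩ ⊗ ⋯ ⊗ |γ_n⟩` of the quantum space. -/
abbrev Spins (n : ℕ) := Fin n → ZMod 2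

/-- Operators on the quantum space: they act on right vectors by `*ᵥ` and on left (dual)
vectors by `ᵥ*`, and the pairing of left and right vectors is `⬝ᵥ`. -/
abbrev Op (n : ℕ) := Matrix (Spins n) (Spins n) ℂ

/-- `u_i |γ⟩ = ω^{γ_i} |γ⟩`. -/
def uOp {n : ℕ} (i : Fin n) : Op n := Matrix.diagonal fun s => sgn (s i)

/-- `u_i⁻¹ |γ⟩ = ω^{-γ_i} |γ⟩`. -/
def uInvOp {n : ℕ} (i : Fin n) : Op n := Matrix.diagonal fun s => sgn (-s i)

/-- `v_i |γ⟩ = |γ + e_i⟩`. -/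
def vOp {n : ℕ} (i : Fin n) : Op n :=
  Matrix.of fun s s' => if s = s' + Pi.single i 1 then 1 else 0

/-- `V_n = v_1 v_2 ⋯ v_n`, the spin flip. -/
def VOp (n : ℕ) : Op n := (List.ofFn fun i : Fin n => vOp i).prod

/-- The `L`-operator of the site with index `i` (site number `i + 1`). -/
def LOp (P : Params) {n : ℕ} (i : Fin n) (lam : ℂ) : Matrix (Fin 2) (Fin 2) (Op n) :=
  !![1 + (lam * P.κ (i + 1)) • vOp i,
      lam • (uInvOp i * (P.a (i + 1) • 1 - P.b (i + 1) • vOp i));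
     uOp i * (P.c (i + 1) • 1 - P.d (i + 1) • vOp i),
      (lam * P.a (i + 1) * P.c (i + 1)) • 1
        + (P.b (i + 1) * P.d (i + 1) / P.κ (i + 1)) • vOp i]

/-- `T_n(λ) = L_1(λ) ⋯ L_n(λ)`. -/
def monodromy (P : Params) (n : ℕ) (lam : ℂ) : Matrix (Fin 2) (Fin 2) (Op n) :=
  (List.ofFn fun i : Fin n => LOp P i lam).prod

/-- `t_n(λ) = A_n(λ) + D_n(λ)`. -/
def transfer (P : Params) (n : ℕ) (lam : ℂ) : Op n := (monodromy P n lam).trace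

/-- `v` is a right eigenvector, in the sector `V_n = (-1)^ρ`, of all `t_n(λ)`, with
eigenvalue `t(λ)`. -/
def IsRightEigenvector (P : Params) (n : ℕ) (ρ : ZMod 2) (t : ℂ → ℂ)
    (v : Spins n → ℂ) : Prop :=
  v ≠ 0 ∧ VOp n *ᵥ v = sgn ρ • v ∧ ∀ lam, transfer P n lam *ᵥ v = t lam • v

/-- `v` is a left eigenvector, in the sector `V_n = (-1)^ρ`, of all `t_n(λ)`, with
eigenvalue `t(λ)`. -/
def IsLeftEigenvector (P : Params) (n : ℕ) (ρ : ZMod 2) (t : ℂ → ℂ)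
    (v : Spins n → ℂ) : Prop :=
  v ≠ 0 ∧ v ᵥ* VOp n = sgn ρ • v ∧ ∀ lam, v ᵥ* transfer P n lam = t lam • v

/-! ## The amplitudes `r_{m,k}` and the Fermat curve points -/

/-- The averaged `L`-operator of site `k`, as a function of `z = λ²`: each entry is the
product over the orbit `{λ, -λ}` of the corresponding entry of `L_k`. -/
def classicalL (P : Params) (k : ℕ) (z : ℂ) : Matrix (Fin 2) (Fin 2) ℂ :=
  !![1 - P.κ k ^ 2 * z, -z * (P.a k ^ 2 - P.b k ^ 2);
     P.c k ^ 2 - P.d k ^ 2, P.b k ^ 2 * P.d k ^ 2 / P.κ k ^ 2 - z * P.a k ^ 2 * P.c k ^ 2]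

/-- The averaged monodromy matrix of the first `m` sites. -/
def classicalT (P : Params) (m : ℕ) (z : ℂ) : Matrix (Fin 2) (Fin 2) ℂ :=
  (List.ofFn fun i : Fin m => classicalL P (i + 1) z).prod

/-- The square roots that have to be chosen in the construction: `rs k` is `r_k`, `r m k` is
`r_{m,k}`, `y₂ m l m' k` is the coordinate `y` of the point `p_{m,l}^{m',k}`, `y₁ m l` that of
`p_{m,l}` and `yt m l` that of `p̃_{m,l}`. Levels `m` start from `1`. -/
structure Roots where
  rs : ℕ → ℂ
  r : ℕ → ℕ → ℂ
  y₂ : ℕ → ℕ → ℕ → ℕ → ℂ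
  y₁ : ℕ → ℕ → ℂ
  yt : ℕ → ℕ → ℂ

/-- `r̃_m = r_{m,0} r_{m,1} ⋯ r_{m,m-1}`. -/
def Roots.rt (R : Roots) (m : ℕ) : ℂ := ∏ k ∈ range m, R.r m k

/-- `p_{m,0}`. -/
def pt0 (P : Params) (R : Roots) (m : ℕ) : ℂ × ℂ :=
  (R.r (m - 1) 0 * P.a m * P.c m / R.r m 0, (∏ k ∈ Ico 1 m, P.κ k) * R.rs m / R.r m 0)

/-- `p̃_m`. -/
def ptTilde (P : Params) (R : Roots) (m : ℕ) : ℂ × ℂ :=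
  (R.rs m / R.rt m, P.b m * P.d m * R.rt (m - 1) / (P.κ m * R.rt m))

/-- `p_{m,l}`, `l ≥ 1`. -/
def pt1 (P : Params) (R : Roots) (m l : ℕ) : ℂ × ℂ :=
  (P.a m * P.κ m * R.r m l / P.b m, R.y₁ m l)

/-- `p̃_{m,l}`, `l ≥ 1`. -/
def pt1Tilde (P : Params) (R : Roots) (m l : ℕ) : ℂ × ℂ :=
  (P.d m / (P.κ m * P.c m * R.r m l), R.yt m l)

/-- `p_{m,l}^{m',k}`. -/
def pt2 (R : Roots) (m l m' k : ℕ) : ℂ × ℂ := (R.r m' k / R.r m l, R.y₂ m l m' k)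

/-- The choice of roots belongs to the parameters of the chain of length `n`. -/
structure IsAdmissible (P : Params) (R : Roots) (n : ℕ) : Prop where
  rs_sq : ∀ k ∈ Icc 1 n, R.rs k ^ 2 = P.a k ^ 2 - P.b k ^ 2
  r_one : R.r 1 0 = R.rs 1
  /-- The `r_{m,k}²` are the leading coefficient and the non-zero roots, up to sign, of the
  upper right entry of the averaged monodromy matrix. -/
  r_sq : ∀ m ∈ Icc 1 n, ∀ z : ℂ,
    classicalT P m z 0 1 = -z * R.r m 0 ^ 2 * ∏ k ∈ Ico 1 m, (R.r m k ^ 2 - z)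
  fermat_same : ∀ m ∈ Icc 1 n, ∀ l ∈ Ico 1 m, ∀ j ∈ Ico 1 m, l ≠ j →
    (pt2 R m l m j).1 ^ 2 + (pt2 R m l m j).2 ^ 2 = 1
  fermat_next : ∀ m ∈ Ico 1 n, ∀ l ∈ Ico 1 m, ∀ k ∈ Ico 1 (m + 1),
    (pt2 R m l (m + 1) k).1 ^ 2 + (pt2 R m l (m + 1) k).2 ^ 2 = 1
  fermat_one : ∀ m ∈ Ico 1 n, ∀ l ∈ Ico 1 m, (pt1 P R m l).1 ^ 2 + (pt1 P R m l).2 ^ 2 = 1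
  fermat_tilde : ∀ m ∈ Ico 1 n, ∀ l ∈ Ico 1 m,
    (pt1Tilde P R m l).1 ^ 2 + (pt1Tilde P R m l).2 ^ 2 = 1
  /-- The relation between the coordinates `y` that fixes the branch (the sign) of `y_{m,l}`
  in terms of the other roots; the squares of its two sides always agree. -/
  branch : ∀ m ∈ Ico 1 n, ∀ l ∈ Ico 1 m,
    R.rt (m - 1) * R.rs (m + 1) * P.b m * P.c m * R.y₁ m l * R.yt m l
        * (∏ s ∈ Ico 1 (m - 1), R.y₂ (m - 1) s m l) * ∏ j ∈ (Ico 1 m).erase l, R.y₂ m l m j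
      = R.rs m * R.r (m + 1) 0 * (∏ s ∈ Ico 1 m, R.r m s)
        * (∏ k ∈ Ico 1 (m + 1), R.y₂ m l (m + 1) k) * ∏ j ∈ (Ico 1 m).erase l, R.y₂ m j m l

/-- Generic parameters: nothing vanishes, the spectra of `B_1(λ), …, B_n(λ)` are simple, and
the Fermat curve points have non-zero coordinates `y`. -/
structure IsGeneric (P : Params) (R : Roots) (n : ℕ) : Prop where
  a_ne : ∀ k ∈ Icc 1 n, P.a k ≠ 0
  b_ne : ∀ k ∈ Icc 1 n, P.b k ≠ 0
  c_ne : ∀ k ∈ Icc 1 n, P.c k ≠ 0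
  d_ne : ∀ k ∈ Icc 1 n, P.d k ≠ 0
  κ_ne : ∀ k ∈ Icc 1 n, P.κ k ≠ 0
  rs_ne : ∀ k ∈ Icc 1 n, R.rs k ≠ 0
  r_ne : ∀ m ∈ Icc 1 n, ∀ k ∈ range m, R.r m k ≠ 0
  r_same : ∀ m ∈ Icc 1 n, ∀ l ∈ Ico 1 m, ∀ j ∈ Ico 1 m, l ≠ j → R.r m l ^ 2 ≠ R.r m j ^ 2
  r_next : ∀ m ∈ Ico 1 n, ∀ l ∈ Ico 1 m, ∀ k ∈ Ico 1 (m + 1),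
    R.r m l ^ 2 ≠ R.r (m + 1) k ^ 2
  one_ne : ∀ m ∈ Icc 1 n, ∀ l ∈ Ico 1 m, (pt1 P R m l).1 ^ 2 ≠ 1
  tilde_ne : ∀ m ∈ Icc 1 n, ∀ l ∈ Ico 1 m, (pt1Tilde P R m l).1 ^ 2 ≠ 1

/-! ## The eigenvectors of `B_n(λ)` -/

/-- `|ψ_σ⟩_k = ∑_γ w_{p^R_k}(γ - σ) |γ⟩_k`, with `p^R_k = (r_k / a_k, b_k / a_k)`. -/
def psiR (P : Params) (R : Roots) (k : ℕ) (σ γ : ZMod 2) : ℂ :=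
  w (R.rs k / P.a k, P.b k / P.a k) (γ - σ)

/-- `⟨ψ_σ|_k = ∑_γ w_{p^L_k}(γ - σ - 1)⁻¹ ⟨γ|_k`, with `p^L_k = (r_k / a_k, b_k / (ω a_k))`. -/
def psiL (P : Params) (R : Roots) (k : ℕ) (σ γ : ZMod 2) : ℂ :=
  (w (R.rs k / P.a k, P.b k / (-1 * P.a k)) (γ - σ - 1))⁻¹

/-- The kernel `Q^R(ρ_{n-1}, σ | ρ_n)` for `n = i + 2`. -/
def kernelR (P : Params) (R : Roots) (i : ℕ) (ρ' : Spins (i + 1)) (σ : ZMod 2)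
    (ρ : Spins (i + 2)) : ℂ :=
  sgn (((∑ k, ρ k) - ∑ k, ρ' k) * (σ - ρ 0))
      / (w (pt0 P R (i + 2)) (ρ 0 - ρ' 0 - 1) * w (ptTilde P R (i + 2)) ((∑ k, ρ k) - σ - 1))
    * ((∏ l : Fin i, ∏ k : Fin (i + 1),
          w (pt2 R (i + 1) (l + 1) (i + 2) (k + 1)) (ρ' l.succ - ρ k.succ))
      / ∏ j : Fin i, ∏ l ∈ univ.erase j,
          w (pt2 R (i + 1) (j + 1) (i + 1) (l + 1)) (ρ' j.succ - ρ' l.succ))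
    * ∏ l : Fin i, w (pt1 P R (i + 1) (l + 1)) (-ρ' l.succ)
        / w (pt1Tilde P R (i + 1) (l + 1)) (ρ' l.succ)

/-- The kernel `Q^L(ρ_{n-1}, σ | ρ_n)` for `n = i + 2`. -/
def kernelL (P : Params) (R : Roots) (i : ℕ) (ρ' : Spins (i + 1)) (σ : ZMod 2)
    (ρ : Spins (i + 2)) : ℂ :=
  sgn (-(((∑ k, ρ k) - ∑ k, ρ' k) * (σ - ρ 0)) + (∑ k, ρ' k) - ρ' 0)
    * (∏ j : Fin i, ∏ l ∈ univ.erase j,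
          w (pt2 R (i + 1) (j + 1) (i + 1) (l + 1)) (ρ' j.succ - ρ' l.succ - 1))
    * (w (pt0 P R (i + 2)) (ρ 0 - ρ' 0) * w (ptTilde P R (i + 2)) ((∑ k, ρ k) - σ)
      / ∏ l : Fin i, ∏ k : Fin (i + 1),
          w (pt2 R (i + 1) (l + 1) (i + 2) (k + 1)) (ρ' l.succ - ρ k.succ - 1))
    * ∏ l : Fin i, w (pt1Tilde P R (i + 1) (l + 1)) (ρ' l.succ)
        / w (pt1 P R (i + 1) (l + 1)) (-ρ' l.succ)

/-- The right eigenvectors `|Ψ_ρ⟩` of `B_n(λ)`, `n = i + 1`, as functions of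
`γ = (γ_1, …, γ_n)`. -/
def PsiR (P : Params) (R : Roots) : (i : ℕ) → Spins (i + 1) → Spins (i + 1) → ℂ
  | 0, ρ, γ => psiR P R 1 (ρ 0) (γ 0)
  | i + 1, ρ, γ => ∑ ρ' : Spins (i + 1), ∑ σ : ZMod 2,
      kernelR P R i ρ' σ ρ
        * (PsiR P R i ρ' (fun j => γ j.castSucc) * psiR P R (i + 2) σ (γ (Fin.last (i + 1))))

/-- The left eigenvectors `⟨Ψ_ρ|` of `B_n(λ)`, `n = i + 1`. -/
def PsiL (P : Params) (R : Roots) : (i : ℕ) → Spins (i + 1) → Spins (i + 1) → ℂ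
  | 0, ρ, γ => psiL P R 1 (ρ 0) (γ 0)
  | i + 1, ρ, γ => ∑ ρ' : Spins (i + 1), ∑ σ : ZMod 2,
      kernelL P R i ρ' σ ρ
        * (PsiL P R i ρ' (fun j => γ j.castSucc) * psiL P R (i + 2) σ (γ (Fin.last (i + 1))))

/-- `|Ψ̃_{ρ,ρ'}⟩`, the Fourier transform over `ρ_{n,0}`, for `n = i + 1`. -/
def PsiTildeR (P : Params) (R : Roots) (i : ℕ) (ρ : ZMod 2) (ρ' : Spins i) :
    Spins (i + 1) → ℂ :=
  ∑ z : ZMod 2, sgn (-(ρ * z)) • PsiR P R i (Fin.cons z ρ')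

/-- `⟨Ψ̃_{ρ,ρ'}|`, for `n = i + 1`. -/
def PsiTildeL (P : Params) (R : Roots) (i : ℕ) (ρ : ZMod 2) (ρ' : Spins i) :
    Spins (i + 1) → ℂ :=
  ∑ z : ZMod 2, sgn (ρ * z) • PsiL P R i (Fin.cons z ρ')

/-! ## Baxter equations and the eigenvectors of the periodic model -/

/-- `F_m(λ) = (b_m + ω a_m κ_m λ) (λ c_m + d_m / κ_m)`. -/
def F (P : Params) (m : ℕ) (lam : ℂ) : ℂ :=
  (P.b m + -1 * P.a m * P.κ m * lam) * (lam * P.c m + P.d m / P.κ m)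

/-- `χ_k` for the chain of length `n`. -/
def chi (R : Roots) (n k : ℕ) : ℂ :=
  R.r n 0 * R.rt (n - 1) / (R.rs n * R.rt n)
    * (∏ s ∈ (Ico 1 n).erase k, R.y₂ n k n s / R.y₂ n s n k)
    * ∏ s ∈ Ico 1 (n - 1), R.y₂ (n - 1) s n k

/-- `Δ_k⁺(λ) = (ω^ρ / χ_k) (λ/ω)^{1-n} ∏_{m=1}^{n-1} F_m(λ/ω)`. -/
def deltaP (P : Params) (R : Roots) (n : ℕ) (ρ : ZMod 2) (k : ℕ) (lam : ℂ) : ℂ :=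
  sgn ρ / chi R n k * (lam / -1) ^ (1 - (n : ℤ)) * ∏ m ∈ Ico 1 n, F P m (lam / -1)

/-- `Δ_k⁻(λ) = χ_k (λ/ω)^{n-1} F_n(λ/ω)`. -/
def deltaM (P : Params) (R : Roots) (n : ℕ) (k : ℕ) (lam : ℂ) : ℂ :=
  chi R n k * (lam / -1) ^ (n - 1) * F P n (lam / -1)

/-- `λ_{n,k} = -r_{n,k} ω^{-γ}`. -/
def lamZero (R : Roots) (n k : ℕ) (γ : ZMod 2) : ℂ := -(R.r n k * sgn (-γ))

/-- The right Baxter equations for the chain of length `n = i + 1`; the entry `k` of `q` is the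
function with number `k + 1`. -/
def BaxterR (P : Params) (R : Roots) (i : ℕ) (ρ : ZMod 2) (t : ℂ → ℂ)
    (q : Fin i → ZMod 2 → ℂ) : Prop :=
  ∀ (k : Fin i) (γ : ZMod 2),
    t (lamZero R (i + 1) (k + 1) γ) * q k γ
      = deltaP P R (i + 1) ρ (k + 1) (lamZero R (i + 1) (k + 1) γ) * q k (γ + 1)
        + deltaM P R (i + 1) (k + 1) (-1 * lamZero R (i + 1) (k + 1) γ) * q k (γ - 1)

/-- The left Baxter equations for the chain of length `n = i + 1`. -/
def BaxterL (P : Params) (R : Roots) (i : ℕ) (ρ : ZMod 2) (t : ℂ → ℂ)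
    (q : Fin i → ZMod 2 → ℂ) : Prop :=
  ∀ (k : Fin i) (γ : ZMod 2),
    t (lamZero R (i + 1) (k + 1) γ) * q k γ
      = (-1) ^ i * deltaM P R (i + 1) (k + 1) (lamZero R (i + 1) (k + 1) γ) * q k (γ + 1)
        + (-1) ^ (-(i : ℤ)) * deltaP P R (i + 1) ρ (k + 1) (-1 * lamZero R (i + 1) (k + 1) γ)
          * q k (γ - 1)

/-- The separated kernel `∏_k q_k(ρ_k) / ∏_{s ≠ s'} w_{p_{n,s}^{n,s'}}(ρ_s - ρ_{s'})`,
`n = i + 1`; at `N = 2` it is used for the left as well as for the right eigenvectors. -/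
def sovKernel (R : Roots) (i : ℕ) (q : Fin i → ZMod 2 → ℂ) (ρ' : Spins i) : ℂ :=
  (∏ k, q k (ρ' k))
    / ∏ s : Fin i, ∏ s' ∈ univ.erase s,
        w (pt2 R (i + 1) (s + 1) (i + 1) (s' + 1)) (ρ' s - ρ' s')

/-- The right vector `|Φ⟩` built from solutions `q` of the right Baxter equations. -/
def PhiR (P : Params) (R : Roots) (i : ℕ) (ρ : ZMod 2) (q : Fin i → ZMod 2 → ℂ) :
    Spins (i + 1) → ℂ :=
  ∑ ρ' : Spins i, sovKernel R i q ρ' • PsiTildeR P R i ρ ρ'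

/-- The left vector `⟨Φ|` built from solutions `q` of the left Baxter equations. -/
def PhiL (P : Params) (R : Roots) (i : ℕ) (ρ : ZMod 2) (q : Fin i → ZMod 2 → ℂ) :
    Spins (i + 1) → ℂ :=
  ∑ ρ' : Spins i, sovKernel R i q ρ' • PsiTildeL P R i ρ ρ'

end BBS

end

noncomputable section

namespace BBS

/-! The proof is separation of variables. In the basis `PsiR` the operator B(λ) is diagonal with
simple spectrum. At each zero λ = ℓ_k of its eigenvalue, A(λ) merely flips the label ρ_k, and D(λ)
does the same up to a flip of the zero mode. An operator polynomial of degree n is determined by its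
constant term, its leading term and its values at n - 1 further points. The end coefficients of A
and D are multiples of 1 and V_n, so the action at the zeros determines `transfer` completely, and
the eigenvalue problem becomes one two-term equation per variable.

The basis is constructed by induction on the chain (`IsSystem`). Expanding B_{n+1} over the last
site and interpolating A_n at the zeros belonging to ρ' turns the eigenvalue equation into three
difference equations for the kernel: at λ = 0 (`kernelR_const`), at λ = ∞ (`kernelR_leading`) and at
the zeros (`kernelR_node_left`). All three are consequences of the difference equation of the cyclic
function, and the last one also needs the branch relation. The action of A at the new zeros follows
from an elimination identity expressing A_{n+1} through B_{n+1} and B_n (`monodromy_elimination`).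
The action of D follows from the quantum determinant.

Left vectors need no separate theory. Transposing the model amounts to b → -b, d → -d, y_{m,l} →
-y_{m,l} (`Params.conj`, `Roots.conj`), and at N = 2 the left vectors are constant multiples of the
right vectors of the transposed model (`PsiL_eq`, `BaxterL.conj`). Distinct eigenvalues of B then
give biorthogonality. A dimension count shows that the diagonal pairings are non-zero, and
evaluating a matrix element of A in two ways gives their behaviour under flips
(`pairing_flip_succ`).

In ⟨Φ|Φ⟩ the weights and the pairings combine into `reducedNorm`, which is known up to a sign. The
right and left Baxter equations together give q^L(1) q^R(1) = (-1)^{n-1} t(-r)/t(r) (`baxter_mul`).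
What remains is a sum over the signs of the r_{n,k}, a rational expression in r and μ, which is
evaluated in closed form by `signSum_eq`. -/

/-! ### Arithmetic of the signs on ℤ/2 -/

theorem sum_zmod_two {M : Type*} [AddCommMonoid M] (f : ZMod 2 → M) :
    ∑ x : ZMod 2, f x = f 0 + f 1 := Fin.sum_univ_two f

theorem zmod_two_cases (x : ZMod 2) : x = 0 ∨ x = 1 := by revert x; decide

theorem sgn_zero : sgn 0 = 1 := rfl

theorem sgn_one : sgn 1 = -1 := rfl

theorem sgn_add (x y : ZMod 2) : sgn (x + y) = sgn x * sgn y := by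
  obtain rfl | rfl := zmod_two_cases x <;> obtain rfl | rfl := zmod_two_cases y <;>
    simp [sgn, show (1 : ZMod 2) + 1 = 0 from rfl]

theorem sgn_neg (x : ZMod 2) : sgn (-x) = sgn x := by
  rw [ZMod.neg_eq_self_mod_two]

theorem sgn_sub (x y : ZMod 2) : sgn (x - y) = sgn x * sgn y := by
  rw [sub_eq_add_neg, sgn_add, sgn_neg]

theorem sgn_mul_self (x : ZMod 2) : sgn x * sgn x = 1 := by
  obtain rfl | rfl := zmod_two_cases x <;> simp [sgn]

theorem sgn_sq (x : ZMod 2) : sgn x ^ 2 = 1 := by rw [sq, sgn_mul_self]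

theorem sgn_ne_zero (x : ZMod 2) : sgn x ≠ 0 := fun h => by simpa [h] using sgn_mul_self x

theorem sgn_sum {ι : Type*} (s : Finset ι) (f : ι → ZMod 2) :
    sgn (∑ k ∈ s, f k) = ∏ k ∈ s, sgn (f k) := by
  classical
  induction s using Finset.induction_on with
  | empty => simp [sgn]
  | insert a s ha ih => rw [sum_insert ha, prod_insert ha, sgn_add, ih]

theorem sgn_add_one (x : ZMod 2) : sgn (x + 1) = -sgn x := by rw [sgn_add, sgn_one]; ring

theorem sgn_injective : Function.Injective sgn := by
  intro x y h
  obtain rfl | rfl := zmod_two_cases x <;> obtain rfl | rfl := zmod_two_cases y <;>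
    first | rfl | (exfalso; norm_num [sgn] at h)

/-! ### The cyclic function -/

/-- A point of the Fermat curve off the axis `y = 0`. -/
def OnCurve (p : ℂ × ℂ) : Prop := p.1 ^ 2 + p.2 ^ 2 = 1 ∧ p.2 ≠ 0

theorem OnCurve.one_add_ne {p : ℂ × ℂ} (h : OnCurve p) : 1 + p.1 ≠ 0 := by
  intro h0
  apply h.2
  have : p.2 ^ 2 = 0 := by linear_combination h.1 + (1 - p.1) * h0
  simpa using this

theorem OnCurve.one_sub_ne {p : ℂ × ℂ} (h : OnCurve p) : 1 - p.1 ≠ 0 := by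
  intro h0
  apply h.2
  have : p.2 ^ 2 = 0 := by linear_combination h.1 + (1 + p.1) * h0
  simpa using this

theorem w_zero (p : ℂ × ℂ) : w p 0 = 1 := rfl

theorem w_one (p : ℂ × ℂ) : w p 1 = p.2 / (1 + p.1) := rfl

theorem OnCurve.w_ne {p : ℂ × ℂ} (h : OnCurve p) (γ : ZMod 2) : w p γ ≠ 0 := by
  obtain rfl | rfl := zmod_two_cases γ
  · simp [w_zero]
  · rw [w_one]; exact div_ne_zero h.2 h.one_add_ne

theorem OnCurve.w_add_one {p : ℂ × ℂ} (h : OnCurve p) (γ : ZMod 2) :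
    w p (γ + 1) * (1 + sgn γ * p.1) = p.2 * w p γ := by
  have h1 := h.one_add_ne
  obtain rfl | rfl := zmod_two_cases γ
  · simp only [zero_add, w_one, w_zero, sgn_zero]; field_simp
  · simp only [show (1 : ZMod 2) + 1 = 0 from rfl, w_one, w_zero, sgn_one]
    field_simp
    linear_combination -h.1

theorem w_mul_w_add_one (p : ℂ × ℂ) (γ : ZMod 2) : w p γ * w p (γ + 1) = w p 1 := by
  obtain rfl | rfl := zmod_two_cases γ
  · simp [w_zero]
  · simp [show (1 : ZMod 2) + 1 = 0 from rfl, w_zero]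

/-- With `OnCurve.w_neg_left` this gives the effect of transposition on the one-point weights: it
moves p_{m,l} to (-x, -y) and p̃_{m,l} to (-x, y). Both facts are (1 + x)(1 - x) = y². -/
theorem OnCurve.w_neg_neg {p : ℂ × ℂ} (h : OnCurve p) (γ : ZMod 2) :
    w (-p.1, -p.2) γ * w p γ = sgn γ := by
  have h1 := h.one_add_ne
  have h2 := h.one_sub_ne
  have h2' : 1 + -p.1 ≠ 0 := by rwa [← sub_eq_add_neg]
  obtain rfl | rfl := zmod_two_cases γ
  · simp [w_zero, sgn_zero]
  · simp only [w_one, sgn_one]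
    field_simp
    linear_combination -h.1

theorem OnCurve.w_neg_left {p : ℂ × ℂ} (h : OnCurve p) (γ : ZMod 2) :
    w (-p.1, p.2) γ * w p γ = 1 := by
  have h1 := h.one_add_ne
  have h2 := h.one_sub_ne
  have h2' : 1 + -p.1 ≠ 0 := by rwa [← sub_eq_add_neg]
  obtain rfl | rfl := zmod_two_cases γ
  · simp [w_zero]
  · simp only [w_one]
    field_simp
    linear_combination h.1

/-! ### Tensor products with the last site -/

/-- Operators on one site. -/
abbrev Op1 := Matrix (ZMod 2) (ZMod 2) ℂ

/-- The tensor product of a vector of the first `n` sites and one of the last site. -/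
def tens {n : ℕ} (f : Spins n → ℂ) (g : ZMod 2 → ℂ) : Spins (n + 1) → ℂ :=
  fun s => f (fun j => s j.castSucc) * g (s (Fin.last n))

/-- The tensor product of an operator on the first `n` sites and one on the last site. -/
def kr {n : ℕ} (M : Op n) (g : Op1) : Op (n + 1) :=
  Matrix.of fun s s' => M (fun j => s j.castSucc) (fun j => s' j.castSucc)
    * g (s (Fin.last n)) (s' (Fin.last n))

theorem sum_spins_succ {n : ℕ} (F : Spins n → ZMod 2 → ℂ) :
    ∑ s : Spins (n + 1), F (fun j => s j.castSucc) (s (Fin.last n)) = ∑ f, ∑ x, F f x := by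
  rw [← (Fin.snocEquiv (fun _ => ZMod 2)).sum_comp, Fintype.sum_prod_type_right]
  simp [Fin.snocEquiv]

theorem kr_mul {n : ℕ} (M M' : Op n) (g g' : Op1) : kr M g * kr M' g' = kr (M * M') (g * g') := by
  ext s s'
  simp only [kr, mul_apply, of_apply]
  rw [sum_spins_succ (fun f x => M (fun j => s j.castSucc) f * g (s (Fin.last n)) x *
    (M' f (fun j => s' j.castSucc) * g' x (s' (Fin.last n)))), sum_mul_sum]
  refine sum_congr rfl fun f _ => sum_congr rfl fun x _ => by ring

theorem kr_mulVec {n : ℕ} (M : Op n) (g : Op1) (f : Spins n → ℂ) (h : ZMod 2 → ℂ) :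
    kr M g *ᵥ tens f h = tens (M *ᵥ f) (g *ᵥ h) := by
  ext s
  simp only [kr, tens, mulVec, dotProduct, of_apply]
  rw [sum_spins_succ (fun e x => M (fun j => s j.castSucc) e * g (s (Fin.last n)) x *
    (f e * h x)), sum_mul_sum]
  refine sum_congr rfl fun f _ => sum_congr rfl fun x _ => by ring

theorem tens_dotProduct {n : ℕ} (f f' : Spins n → ℂ) (h h' : ZMod 2 → ℂ) :
    tens f h ⬝ᵥ tens f' h' = (f ⬝ᵥ f') * (h ⬝ᵥ h') := by
  simp only [tens, dotProduct]
  rw [sum_spins_succ (fun e x => f e * h x * (f' e * h' x)), sum_mul_sum]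
  refine sum_congr rfl fun f _ => sum_congr rfl fun x _ => by ring

theorem kr_transpose {n : ℕ} (M : Op n) (g : Op1) : (kr M g)ᵀ = kr Mᵀ gᵀ := rfl

theorem kr_add_left {n : ℕ} (M M' : Op n) (g : Op1) : kr (M + M') g = kr M g + kr M' g := by
  ext s s'; simp [kr, add_mul]

theorem kr_add_right {n : ℕ} (M : Op n) (g g' : Op1) : kr M (g + g') = kr M g + kr M g' := by
  ext s s'; simp [kr, mul_add]

theorem kr_smul_left {n : ℕ} (c : ℂ) (M : Op n) (g : Op1) : kr (c • M) g = c • kr M g := by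
  ext s s'; simp [kr, mul_assoc]

theorem kr_smul_right {n : ℕ} (c : ℂ) (M : Op n) (g : Op1) : kr M (c • g) = c • kr M g := by
  ext s s'; simp [kr, mul_left_comm]

theorem kr_zero_left {n : ℕ} (g : Op1) : kr (0 : Op n) g = 0 := by ext s s'; simp [kr]

theorem kr_sub_right {n : ℕ} (M : Op n) (g g' : Op1) : kr M (g - g') = kr M g - kr M g' := by
  ext s s'; simp [kr, mul_sub]

theorem spins_ext_iff {n : ℕ} (s s' : Spins (n + 1)) :
    s = s' ↔ (fun j : Fin n => s j.castSucc) = (fun j : Fin n => s' j.castSucc) ∧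
      s (Fin.last n) = s' (Fin.last n) := by
  constructor
  · rintro rfl; simp
  · rintro ⟨h1, h2⟩
    funext j
    exact Fin.lastCases h2 (fun j => congrFun h1 j) j

theorem kr_one_one {n : ℕ} : kr (1 : Op n) 1 = 1 := by
  ext s s'
  simp only [kr, of_apply, one_apply, spins_ext_iff s s']
  split_ifs <;> simp_all

/-- The shift of one site. -/
def v1 : Op1 := Matrix.of fun x y => if x = y + 1 then 1 else 0

/-- The clock of one site. -/
def u1 : Op1 := Matrix.diagonal sgn

theorem vOp_castSucc {n : ℕ} (i : Fin n) : vOp i.castSucc = kr (vOp i) 1 := by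
  ext s s'
  simp only [kr, of_apply, one_apply, vOp, spins_ext_iff s]
  have h : (fun j : Fin n => (s' + Pi.single i.castSucc 1 : Spins (n + 1)) j.castSucc)
      = (fun j : Fin n => s' j.castSucc) + Pi.single i 1 := by
    funext j
    simp [Pi.single_apply, Fin.castSucc_inj]
  have h' : (s' + Pi.single i.castSucc 1 : Spins (n + 1)) (Fin.last n) = s' (Fin.last n) := by
    simp [(Fin.castSucc_lt_last i).ne']
  rw [h, h']
  split_ifs <;> simp_all

theorem vOp_last {n : ℕ} : vOp (Fin.last n) = kr 1 v1 := by
  ext s s'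
  simp only [kr, of_apply, one_apply, vOp, v1, spins_ext_iff s]
  have h : (fun j : Fin n => (s' + Pi.single (Fin.last n) 1 : Spins (n + 1)) j.castSucc)
      = (fun j : Fin n => s' j.castSucc) := by
    funext j
    simp [(Fin.castSucc_lt_last j).ne]
  have h' : (s' + Pi.single (Fin.last n) 1 : Spins (n + 1)) (Fin.last n)
      = s' (Fin.last n) + 1 := by simp
  rw [h, h']
  split_ifs <;> simp_all

theorem uOp_castSucc {n : ℕ} (i : Fin n) : uOp i.castSucc = kr (uOp i) 1 := by
  ext s s'
  simp only [kr, of_apply, one_apply, uOp, diagonal_apply, spins_ext_iff s]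
  split_ifs <;> simp_all

theorem uOp_last {n : ℕ} : uOp (Fin.last n) = kr 1 u1 := by
  ext s s'
  simp only [kr, of_apply, one_apply, uOp, u1, diagonal_apply, spins_ext_iff s]
  split_ifs <;> simp_all

theorem uInvOp_eq {n : ℕ} (i : Fin n) : uInvOp i = uOp i := by
  simp only [uInvOp, uOp, sgn_neg]

/-! ### The recursion for the monodromy matrix -/

/-- The `L`-operator of site `k` as a matrix of one-site operators. -/
def ell (P : Params) (k : ℕ) (lam : ℂ) : Matrix (Fin 2) (Fin 2) Op1 :=
  !![1 + (lam * P.κ k) • v1, lam • (u1 * (P.a k • 1 - P.b k • v1));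
     u1 * (P.c k • 1 - P.d k • v1), (lam * P.a k * P.c k) • 1 + (P.b k * P.d k / P.κ k) • v1]

theorem LOp_last (P : Params) {n : ℕ} (lam : ℂ) (x y : Fin 2) :
    LOp P (Fin.last n) lam x y = kr 1 (ell P (n + 1) lam x y) := by
  have e : (1 : Op (n + 1)) = kr 1 1 := kr_one_one.symm
  fin_cases x <;> fin_cases y <;>
    simp [LOp, ell, uInvOp_eq, uOp_last, vOp_last, e, kr_add_right, kr_smul_right]
  · rw [← kr_smul_right, ← kr_smul_right, ← kr_sub_right, kr_mul, one_mul]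
  · rw [← kr_smul_right, ← kr_smul_right, ← kr_sub_right, kr_mul, one_mul]

theorem LOp_castSucc (P : Params) {n : ℕ} (i : Fin n) (lam : ℂ) :
    LOp P i.castSucc lam = (LOp P i lam).map (fun M => kr M 1) := by
  have e : (1 : Op (n + 1)) = kr 1 1 := kr_one_one.symm
  have es : ∀ (M M' : Op n) (g : Op1), kr M g - kr M' g = kr (M - M') g := by
    intro M M' g; ext s s'; simp [kr, sub_mul]
  ext1 x y
  fin_cases x <;> fin_cases y <;>
    simp [LOp, uInvOp_eq, uOp_castSucc, vOp_castSucc, e, kr_add_left, kr_smul_left]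
  · rw [← kr_smul_left, ← kr_smul_left, es, kr_mul, one_mul]
  · rw [← kr_smul_left, ← kr_smul_left, es, kr_mul, one_mul]

/-- Tensoring with the identity of the last site. -/
def krHom (n : ℕ) : Op n →+* Op (n + 1) where
  toFun M := kr M 1
  map_one' := kr_one_one
  map_mul' M M' := by rw [kr_mul, one_mul]
  map_zero' := kr_zero_left 1
  map_add' M M' := kr_add_left M M' 1

theorem monodromy_succ (P : Params) (n : ℕ) (lam : ℂ) (x y : Fin 2) :
    monodromy P (n + 1) lam x y = kr (monodromy P n lam x 0) (ell P (n + 1) lam 0 y)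
      + kr (monodromy P n lam x 1) (ell P (n + 1) lam 1 y) := by
  have h : monodromy P (n + 1) lam
      = (krHom n).mapMatrix (monodromy P n lam) * LOp P (Fin.last n) lam := by
    rw [monodromy, List.ofFn_succ', List.prod_concat, monodromy, map_list_prod, List.map_ofFn]
    congr 3
    funext i
    exact LOp_castSucc P i lam
  rw [h, mul_apply, Fin.sum_univ_two, LOp_last, LOp_last]
  simp [krHom, kr_mul]

theorem VOp_succ (n : ℕ) : VOp (n + 1) = kr (VOp n) v1 := by
  have h : VOp (n + 1) = krHom n (VOp n) * vOp (Fin.last n) := by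
    rw [VOp, List.ofFn_succ', List.prod_concat, VOp, map_list_prod, List.map_ofFn]
    congr 3
    funext i
    exact vOp_castSucc i
  rw [h, vOp_last]
  simp [krHom, kr_mul]

/-! ### The quantum determinant -/

/-- This relation and the next three are exactly the combinations of last-site entries that appear
when the quantum determinant of a chain is expanded over its last site. Two of them give the same
multiple of `v1` and two vanish, so the induction in `quantum_determinant` closes. -/
theorem ell_qdet (P : Params) (k : ℕ) (hκ : P.κ k ≠ 0) (lam : ℂ) :
    ell P k lam 1 1 * ell P k (-lam) 0 0 + ell P k lam 1 0 * ell P k (-lam) 0 1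
      = F P k lam • v1 := by
  ext x y
  obtain rfl | rfl := zmod_two_cases x <;> obtain rfl | rfl := zmod_two_cases y <;>
    simp [ell, F, mul_apply, sum_zmod_two, v1, u1, diagonal_apply, one_apply, sgn,
      show (1 : ZMod 2) + 1 = 0 from rfl] <;> field_simp <;> ring

theorem ell_qdet' (P : Params) (k : ℕ) (hκ : P.κ k ≠ 0) (lam : ℂ) :
    ell P k lam 0 1 * ell P k (-lam) 1 0 + ell P k lam 0 0 * ell P k (-lam) 1 1
      = F P k lam • v1 := by
  ext x y
  obtain rfl | rfl := zmod_two_cases x <;> obtain rfl | rfl := zmod_two_cases y <;>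
    simp [ell, F, mul_apply, sum_zmod_two, v1, u1, diagonal_apply, one_apply, sgn,
      show (1 : ZMod 2) + 1 = 0 from rfl] <;> field_simp <;> ring

theorem ell_row_zero (P : Params) (k : ℕ) (lam : ℂ) :
    ell P k lam 0 1 * ell P k (-lam) 0 0 + ell P k lam 0 0 * ell P k (-lam) 0 1 = 0 := by
  ext x y
  obtain rfl | rfl := zmod_two_cases x <;> obtain rfl | rfl := zmod_two_cases y <;>
    simp [ell, mul_apply, sum_zmod_two, v1, u1, diagonal_apply, one_apply, sgn,
      show (1 : ZMod 2) + 1 = 0 from rfl] <;> ring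

theorem ell_row_one (P : Params) (k : ℕ) (lam : ℂ) :
    ell P k lam 1 1 * ell P k (-lam) 1 0 + ell P k lam 1 0 * ell P k (-lam) 1 1 = 0 := by
  ext x y
  obtain rfl | rfl := zmod_two_cases x <;> obtain rfl | rfl := zmod_two_cases y <;>
    simp [ell, mul_apply, sum_zmod_two, v1, u1, diagonal_apply, one_apply, sgn,
      show (1 : ZMod 2) + 1 = 0 from rfl] <;> ring

theorem VOp_zero : VOp 0 = 1 := by simp [VOp]

theorem monodromy_zero (P : Params) (lam : ℂ) : monodromy P 0 lam = 1 := by simp [monodromy]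

theorem kr_zero_right {n : ℕ} (M : Op n) : kr M (0 : Op1) = 0 := by ext s s'; simp [kr]

/-- On a vector annihilated by B(-λ) only the product D(λ) A(-λ) survives, so the action of D can be
read off from that of A. -/
theorem quantum_determinant (P : Params) (n : ℕ) (hκ : ∀ k ∈ Icc 1 n, P.κ k ≠ 0) (lam : ℂ) :
    monodromy P n lam 1 1 * monodromy P n (-lam) 0 0
        + monodromy P n lam 1 0 * monodromy P n (-lam) 0 1
      = (∏ k ∈ Ico 1 (n + 1), F P k lam) • VOp n := by
  induction n with
  | zero => simp [monodromy_zero, VOp_zero]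
  | succ n ih =>
    have ih := ih fun k hk => hκ k (by simp only [mem_Icc] at hk ⊢; omega)
    have hk := hκ (n + 1) (by simp)
    -- The eight products are grouped by their factor on the first `n` sites, so that each last-site
    -- factor becomes one of the four one-site relations.
    have key : ∀ A' B' C D : Op n, ∀ a b c d a' b' c' d' : Op1,
        (kr C b + kr D d) * (kr A' a' + kr B' c') + (kr C a + kr D c) * (kr A' b' + kr B' d')
          = kr (C * A') (b * a' + a * b') + kr (D * B') (d * c' + c * d')
            + kr (C * B') (b * c' + a * d') + kr (D * A') (d * a' + c * b') := by
      intros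
      simp only [mul_add, add_mul, kr_mul, kr_add_right]
      abel
    simp only [monodromy_succ]
    rw [key, ell_row_zero, ell_row_one, ell_qdet P _ hk, ell_qdet' P _ hk, kr_zero_right,
      kr_zero_right, zero_add, zero_add, ← kr_add_left, add_comm (monodromy P n lam 1 0 * _), ih,
      VOp_succ, prod_Ico_succ_top (show 1 ≤ n + 1 by omega), kr_smul_right, kr_smul_left, smul_smul,
      mul_comm]

/-! ### Transposition -/

/-- The parameters of the transposed model. -/
def Params.conj (P : Params) : Params := { P with b := fun k => -P.b k, d := fun k => -P.d k }

/-- The matrices `u1` and `v1` are symmetric and anticommute, so transposition changes the sign of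
`v1` in the off-diagonal entries only. The diagonal entries contain `b` and `d` only through their
product. -/
theorem ell_conj (P : Params) (k : ℕ) (lam : ℂ) (x y : Fin 2) :
    ell P.conj k lam x y = (ell P k lam x y)ᵀ := by
  ext s s'
  fin_cases x <;> fin_cases y <;>
  obtain rfl | rfl := zmod_two_cases s <;> obtain rfl | rfl := zmod_two_cases s' <;>
    simp [ell, Params.conj, mul_apply, v1, u1, diagonal_apply, one_apply, sgn,
      show (1 : ZMod 2) + 1 = 0 from rfl]

theorem monodromy_conj (P : Params) (n : ℕ) (lam : ℂ) (x y : Fin 2) :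
    monodromy P.conj n lam x y = (monodromy P n lam x y)ᵀ := by
  induction n generalizing x y with
  | zero =>
    rw [monodromy_zero, monodromy_zero]
    fin_cases x <;> fin_cases y <;> simp
  | succ n ih => simp only [monodromy_succ, ih, ell_conj, transpose_add, kr_transpose]

theorem transfer_conj (P : Params) (n : ℕ) (lam : ℂ) :
    transfer P.conj n lam = (transfer P n lam)ᵀ := by
  simp only [transfer, trace_fin_two, monodromy_conj, transpose_add]

theorem v1_transpose : v1ᵀ = v1 := by
  ext s s'
  obtain rfl | rfl := zmod_two_cases s <;> obtain rfl | rfl := zmod_two_cases s' <;>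
    simp [v1, show (1 : ZMod 2) + 1 = 0 from rfl]

theorem v1_mul_self : v1 * v1 = 1 := by
  ext s s'
  obtain rfl | rfl := zmod_two_cases s <;> obtain rfl | rfl := zmod_two_cases s' <;>
    simp [v1, mul_apply, show (1 : ZMod 2) + 1 = 0 from rfl]

theorem VOp_transpose (n : ℕ) : (VOp n)ᵀ = VOp n := by
  induction n with
  | zero => simp [VOp_zero]
  | succ n ih => rw [VOp_succ, kr_transpose, ih, v1_transpose]

theorem VOp_mul_self (n : ℕ) : VOp n * VOp n = 1 := by
  induction n with
  | zero => simp [VOp_zero]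
  | succ n ih => rw [VOp_succ, kr_mul, ih, v1_mul_self, kr_one_one]

/-! ### Polynomial dependence on the spectral parameter -/

/-- `f` is a polynomial of degree at most `n` with given constant and leading coefficients. -/
def IsPoly {E : Type*} [AddCommGroup E] [Module ℂ E] (n : ℕ) (f : ℂ → E) (c₀ cₙ : E) : Prop :=
  ∃ c : ℕ → E, c 0 = c₀ ∧ c n = cₙ ∧ ∀ lam, f lam = ∑ j ∈ range (n + 1), lam ^ j • c j

section IsPoly

variable {E E' : Type*} [AddCommGroup E] [Module ℂ E] [AddCommGroup E'] [Module ℂ E']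

theorem IsPoly.map {n : ℕ} {f : ℂ → E} {c₀ cₙ : E} (h : IsPoly n f c₀ cₙ) (L : E →ₗ[ℂ] E') :
    IsPoly n (fun lam => L (f lam)) (L c₀) (L cₙ) := by
  obtain ⟨c, rfl, rfl, hc⟩ := h
  exact ⟨fun j => L (c j), rfl, rfl, fun lam => by simp [hc lam, map_sum]⟩

theorem IsPoly.add {n : ℕ} {f g : ℂ → E} {c₀ cₙ d₀ dₙ : E} (h : IsPoly n f c₀ cₙ)
    (h' : IsPoly n g d₀ dₙ) : IsPoly n (fun lam => f lam + g lam) (c₀ + d₀) (cₙ + dₙ) := by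
  obtain ⟨c, rfl, rfl, hc⟩ := h
  obtain ⟨d, rfl, rfl, hd⟩ := h'
  exact ⟨fun j => c j + d j, rfl, rfl, fun lam => by
    simp [hc lam, hd lam, smul_add, sum_add_distrib]⟩

theorem IsPoly.raise {n : ℕ} {f : ℂ → E} {c₀ cₙ : E} (h : IsPoly n f c₀ cₙ) :
    IsPoly (n + 1) f c₀ 0 := by
  obtain ⟨c, rfl, rfl, hc⟩ := h
  refine ⟨fun j => if j = n + 1 then 0 else c j, by simp, by simp, fun lam => ?_⟩
  rw [hc lam, sum_range_succ _ (n + 1)]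
  simp only [if_true, smul_zero, add_zero]
  refine sum_congr rfl fun j hj => ?_
  rw [if_neg (by simp at hj; omega)]

theorem IsPoly.shift {n : ℕ} {f : ℂ → E} {c₀ cₙ : E} (h : IsPoly n f c₀ cₙ) :
    IsPoly (n + 1) (fun lam => lam • f lam) 0 cₙ := by
  obtain ⟨c, rfl, rfl, hc⟩ := h
  refine ⟨fun j => if j = 0 then 0 else c (j - 1), by simp, by simp, fun lam => ?_⟩
  simp only [hc lam]
  rw [sum_range_succ' _ (n + 1), smul_sum]
  simp [smul_smul, pow_succ']

end IsPoly

/-- `kr` as a linear map in its first argument. -/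
def krLin (n : ℕ) (g : Op1) : Op n →ₗ[ℂ] Op (n + 1) where
  toFun M := kr M g
  map_add' M M' := kr_add_left M M' g
  map_smul' c M := kr_smul_left c M g

/-- The coefficients at both ends of A and D involve only 1 and V, whose action is known in advance.
For the off-diagonal entries it suffices to know that B has no constant term and C no leading term,
which keeps them out of the end coefficients of A and D in the induction. -/
theorem isPoly_monodromy (P : Params) (n : ℕ) :
    IsPoly n (fun lam => monodromy P n lam 0 0) 1 ((∏ k ∈ Ico 1 (n + 1), P.κ k) • VOp n)
    ∧ (∃ e, IsPoly n (fun lam => monodromy P n lam 0 1) 0 e)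
    ∧ (∃ e, IsPoly n (fun lam => monodromy P n lam 1 0) e 0)
    ∧ IsPoly n (fun lam => monodromy P n lam 1 1)
        ((∏ k ∈ Ico 1 (n + 1), (P.b k * P.d k / P.κ k)) • VOp n)
        ((∏ k ∈ Ico 1 (n + 1), (P.a k * P.c k)) • 1) := by
  induction n with
  | zero =>
    simp only [monodromy_zero, VOp_zero]
    refine ⟨⟨fun _ => 1, by simp⟩, ⟨0, fun _ => 0, by simp⟩, ⟨0, fun _ => 0, by simp⟩,
      ⟨fun _ => 1, by simp⟩⟩
  | succ n ih =>
    obtain ⟨hA, ⟨eB, hB⟩, ⟨eC, hC⟩, hD⟩ := ih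
    have e00 : ∀ lam, ell P (n + 1) lam 0 0 = 1 + lam • (P.κ (n + 1) • v1) := fun lam => by
      simp [ell, smul_smul]
    have e01 : ∀ lam, ell P (n + 1) lam 0 1 = lam • (u1 * (P.a (n + 1) • 1 - P.b (n + 1) • v1)) := fun lam => rfl
    have e10 : ∀ lam, ell P (n + 1) lam 1 0 = u1 * (P.c (n + 1) • 1 - P.d (n + 1) • v1) := fun lam => rfl
    have e11 : ∀ lam, ell P (n + 1) lam 1 1
        = lam • ((P.a (n + 1) * P.c (n + 1)) • 1) + (P.b (n + 1) * P.d (n + 1) / P.κ (n + 1)) • v1 := fun lam => by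
      simp [ell, smul_smul, mul_assoc]
    simp only [monodromy_succ]
    simp only [e00, e01, e10, e11, kr_add_right, kr_smul_right _ _ (_ • _),
      kr_smul_right _ _ (u1 * _)]
    refine ⟨?_, ⟨krLin n (u1 * (P.a (n + 1) • 1 - P.b (n + 1) • v1))
        ((∏ k ∈ Ico 1 (n + 1), P.κ k) • VOp n)
        + (krLin n ((P.a (n + 1) * P.c (n + 1)) • 1) eB + 0), ?_⟩,
      ⟨krLin n 1 eC + 0 + krLin n (u1 * (P.c (n + 1) • 1 - P.d (n + 1) • v1))
        ((∏ k ∈ Ico 1 (n + 1), (P.b k * P.d k / P.κ k)) • VOp n), ?_⟩, ?_⟩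
    · convert ((hA.map (krLin n 1)).raise.add (hA.map (krLin n (P.κ (n + 1) • v1))).shift).add
        (hB.map (krLin n (u1 * (P.c (n + 1) • 1 - P.d (n + 1) • v1)))).raise using 1
      · simp only [krLin, LinearMap.coe_mk, AddHom.coe_mk]
      · simp only [krLin, LinearMap.coe_mk, AddHom.coe_mk, kr_zero_left, kr_one_one, add_zero]
      · simp only [krLin, LinearMap.coe_mk, AddHom.coe_mk, add_zero, zero_add, VOp_succ,
          kr_smul_left, kr_smul_right, smul_smul]
        rw [prod_Ico_succ_top (show 1 ≤ n + 1 by omega), mul_comm]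
    · convert (hA.map (krLin n (u1 * (P.a (n + 1) • 1 - P.b (n + 1) • v1)))).shift.add
        ((hB.map (krLin n ((P.a (n + 1) * P.c (n + 1)) • 1))).shift.add
        (hB.map (krLin n ((P.b (n + 1) * P.d (n + 1) / P.κ (n + 1)) • v1))).raise) using 1
      · simp only [krLin, LinearMap.coe_mk, AddHom.coe_mk]
      · simp only [krLin, LinearMap.coe_mk, AddHom.coe_mk, kr_zero_left, add_zero]
    · convert ((hC.map (krLin n 1)).raise.add (hC.map (krLin n (P.κ (n + 1) • v1))).shift).add
        (hD.map (krLin n (u1 * (P.c (n + 1) • 1 - P.d (n + 1) • v1)))).raise using 1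
      · simp only [krLin, LinearMap.coe_mk, AddHom.coe_mk]
      · simp only [krLin, LinearMap.coe_mk, AddHom.coe_mk, kr_zero_left, add_zero]
    · convert (hC.map (krLin n (u1 * (P.a (n + 1) • 1 - P.b (n + 1) • v1)))).shift.add
        ((hD.map (krLin n ((P.a (n + 1) * P.c (n + 1)) • 1))).shift.add
        (hD.map (krLin n ((P.b (n + 1) * P.d (n + 1) / P.κ (n + 1)) • v1))).raise) using 1
      · simp only [krLin, LinearMap.coe_mk, AddHom.coe_mk]
      · simp only [krLin, LinearMap.coe_mk, AddHom.coe_mk, zero_add, VOp_succ,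
          kr_smul_left, kr_smul_right, smul_smul]
        rw [prod_Ico_succ_top (show 1 ≤ n + 1 by omega), mul_comm]
      · simp only [krLin, LinearMap.coe_mk, AddHom.coe_mk, kr_zero_left, add_zero, zero_add,
          kr_smul_left, kr_smul_right, smul_smul, kr_one_one]
        rw [prod_Ico_succ_top (show 1 ≤ n + 1 by omega), mul_comm]

/-! ### Interpolation -/

/-- The interpolation function of the node `k`, for the nodes `ℓ` and `0`. -/
def nodeFn {i : ℕ} (ℓ : Fin i → ℂ) (k : Fin i) (lam : ℂ) : ℂ :=
  lam / ℓ k * ∏ s ∈ univ.erase k, (lam - ℓ s) / (ℓ k - ℓ s)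

theorem prod_erase_zero {i : ℕ} (f : Fin (i + 1) → ℂ) :
    ∏ k ∈ univ.erase 0, f k = ∏ k : Fin i, f k.succ := by
  have : (univ.erase 0 : Finset (Fin (i + 1))) = univ.map (Fin.succEmb i) := by
    ext k
    refine Fin.cases ?_ (fun k => ?_) k <;> simp [Fin.succ_ne_zero]
  rw [this, prod_map]; rfl

theorem prod_erase_succ {i : ℕ} (f : Fin (i + 1) → ℂ) (k : Fin i) :
    ∏ j ∈ univ.erase k.succ, f j = f 0 * ∏ j ∈ univ.erase k, f j.succ := by
  have : (univ.erase k.succ : Finset (Fin (i + 1)))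
      = insert 0 ((univ.erase k).map (Fin.succEmb i)) := by
    ext j
    refine Fin.cases ?_ (fun j => ?_) j <;> simp [Fin.succ_ne_zero, (Fin.succ_ne_zero _).symm]
  rw [this, prod_insert (by simp [Fin.succ_ne_zero]), prod_map]; rfl

theorem interpolation_eval {i : ℕ} (ℓ : Fin i → ℂ) (hℓ : Function.Injective ℓ) (h0 : ∀ k, ℓ k ≠ 0)
    (p : Polynomial ℂ) (hp : p.degree < (i + 1 : ℕ)) (lam : ℂ) :
    p.eval lam = p.eval 0 * ∏ s, (1 - lam / ℓ s) + ∑ k, nodeFn ℓ k lam * p.eval (ℓ k) := by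
  have hv : Function.Injective (Fin.cons 0 ℓ : Fin (i + 1) → ℂ) := by
    rw [Fin.cons_injective_iff]
    exact ⟨by rintro ⟨k, hk⟩; exact h0 k hk, hℓ⟩
  have h := Lagrange.eq_interpolate_of_eval_eq (s := univ) (v := (Fin.cons 0 ℓ : Fin (i + 1) → ℂ))
    (f := p) (fun k => p.eval ((Fin.cons 0 ℓ : Fin (i + 1) → ℂ) k)) hv.injOn (by simpa using hp)
    (fun _ _ => rfl)
  conv_lhs => rw [h]
  rw [Lagrange.interpolate_apply, Polynomial.eval_finsetSum, Fin.sum_univ_succ]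
  simp only [Polynomial.eval_mul, Polynomial.eval_C, Lagrange.basis, Polynomial.eval_prod,
    Lagrange.basisDivisor, Polynomial.eval_sub, Polynomial.eval_X, prod_erase_zero,
    prod_erase_succ, Fin.cons_zero, Fin.cons_succ, nodeFn]
  congr 1
  · congr 1
    refine prod_congr rfl fun s _ => ?_
    have := h0 s
    field_simp
    ring
  · refine sum_congr rfl fun k _ => ?_
    rw [mul_comm]
    congr 1
    simp only [sub_zero]
    rw [div_eq_inv_mul]
    congr 1
    exact prod_congr rfl fun s _ => by rw [div_eq_inv_mul]

/-- The nodes are `0` and the `ℓ k`, one too few for degree `i + 1`. Subtracting X ∏ (X - ℓ_s),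
which vanishes at all of them, lowers the degree of X^(i+1) and produces the extra leading term. -/
theorem interpolation_pow {i : ℕ} (ℓ : Fin i → ℂ) (hℓ : Function.Injective ℓ) (h0 : ∀ k, ℓ k ≠ 0)
    (j : ℕ) (hj : j ≤ i + 1) (lam : ℂ) :
    lam ^ j = (if j = 0 then ∏ s, (1 - lam / ℓ s) else 0)
      + (if j = i + 1 then lam * ∏ s, (lam - ℓ s) else 0)
      + ∑ k, nodeFn ℓ k lam * ℓ k ^ j := by
  by_cases hj' : j = i + 1
  · subst hj'
    set Q : Polynomial ℂ := Polynomial.X * ∏ s, (Polynomial.X - Polynomial.C (ℓ s)) with hQ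
    have hQm : Q.Monic := Polynomial.monic_X.mul (Polynomial.monic_prod_of_monic _ _
      fun s _ => Polynomial.monic_X_sub_C _)
    have hQd : Q.degree = (i + 1 : ℕ) := by
      rw [Polynomial.degree_eq_natDegree hQm.ne_zero, hQ,
        Polynomial.Monic.natDegree_mul Polynomial.monic_X (Polynomial.monic_prod_of_monic _ _
          fun s _ => Polynomial.monic_X_sub_C _), Polynomial.natDegree_prod_of_monic _ _
          fun s _ => Polynomial.monic_X_sub_C _]
      simp [add_comm]
    have hd : (Polynomial.X ^ (i + 1) - Q).degree < ((i + 1 : ℕ) : WithBot ℕ) := by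
      have := Polynomial.degree_sub_lt_left (p := (Polynomial.X ^ (i + 1) : Polynomial ℂ)) (q := Q)
        (by rw [hQd, Polynomial.degree_X_pow]) (by simp)
        (by rw [hQm.leadingCoeff, (Polynomial.monic_X_pow _).leadingCoeff])
      rwa [Polynomial.degree_X_pow] at this
    have h := interpolation_eval ℓ hℓ h0 _ hd lam
    have hz : ∀ k, ∏ s, (ℓ k - ℓ s) = 0 := fun k => prod_eq_zero (mem_univ k) (sub_self _)
    simp only [hQ, Polynomial.eval_sub, Polynomial.eval_pow, Polynomial.eval_X,
      Polynomial.eval_mul, Polynomial.eval_prod, Polynomial.eval_C, hz, mul_zero, sub_zero] at h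
    rw [if_neg (by omega), if_pos rfl]
    simp only [ne_eq, Nat.add_eq_zero_iff, one_ne_zero, and_false, not_false_eq_true, zero_pow,
      zero_mul, sub_zero, zero_add] at h ⊢
    linear_combination h
  · have hd : (Polynomial.X ^ j : Polynomial ℂ).degree < ((i + 1 : ℕ) : WithBot ℕ) := by
      rw [Polynomial.degree_X_pow]; exact_mod_cast (by omega : j < i + 1)
    have h := interpolation_eval ℓ hℓ h0 _ hd lam
    simp only [Polynomial.eval_pow, Polynomial.eval_X] at h
    rw [h, if_neg hj', add_zero]
    congr 1
    by_cases h : j = 0 <;> simp [h]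

/-- By linearity it is enough to know the monomials, so the formula holds for operator-valued and
vector-valued polynomials alike. The values at `0` and at infinity replace two interpolation nodes.
-/
theorem IsPoly.interpolation {E : Type*} [AddCommGroup E] [Module ℂ E] {i : ℕ} {f : ℂ → E}
    {c₀ cₙ : E} (h : IsPoly (i + 1) f c₀ cₙ) (ℓ : Fin i → ℂ) (hℓ : Function.Injective ℓ)
    (h0 : ∀ k, ℓ k ≠ 0) (lam : ℂ) :
    f lam = (∏ s, (1 - lam / ℓ s)) • c₀ + (lam * ∏ s, (lam - ℓ s)) • cₙ
      + ∑ k, nodeFn ℓ k lam • f (ℓ k) := by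
  obtain ⟨c, rfl, rfl, hc⟩ := h
  have e : ∀ j ∈ range (i + 1 + 1), lam ^ j • c j
      = (if j = 0 then (∏ s, (1 - lam / ℓ s)) • c j else 0)
        + (if j = i + 1 then (lam * ∏ s, (lam - ℓ s)) • c j else 0)
        + ∑ k, nodeFn ℓ k lam • (ℓ k ^ j • c j) := by
    intro j hj
    rw [interpolation_pow ℓ hℓ h0 j (by simp at hj; omega) lam, add_smul, add_smul, sum_smul]
    simp only [ite_smul, zero_smul, smul_smul]
  rw [hc lam, sum_congr rfl e, sum_add_distrib, sum_add_distrib, sum_comm]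
  simp only [hc, smul_sum]
  congr 1
  simp

/-! ### The points of the Fermat curve -/

theorem classicalT_succ (P : Params) (m : ℕ) (z : ℂ) :
    classicalT P (m + 1) z = classicalT P m z * classicalL P (m + 1) z := by
  rw [classicalT, List.ofFn_succ', List.prod_concat, classicalT]
  simp

/-- The condition on the r_{m,k} is an identity of functions of z. Polynomial representatives make
it possible to compare its lowest and highest coefficients. -/
theorem exists_polynomial_classicalT (P : Params) (m : ℕ) : ∃ p q : Polynomial ℂ,
    (∀ z, p.eval z = classicalT P m z 0 0) ∧ (∀ z, q.eval z = classicalT P m z 0 1)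
    ∧ p.natDegree ≤ m ∧ q.natDegree ≤ m ∧ p.coeff 0 = 1 ∧ q.coeff 0 = 0
    ∧ p.coeff m = ∏ k ∈ Ico 1 (m + 1), (-P.κ k ^ 2) := by
  open Polynomial in
  induction m with
  | zero => exact ⟨1, 0, by simp [classicalT], by simp [classicalT], by simp, by simp, by simp,
      by simp, by simp⟩
  | succ m ih =>
    obtain ⟨p, q, hp, hq, dp, dq, p0, q0, pm⟩ := ih
    have dX : ∀ (a : ℂ) (r : Polynomial ℂ), r.natDegree ≤ m →
        (C a * (X * r)).natDegree ≤ m + 1 := fun a r hr =>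
      (natDegree_C_mul_le _ _).trans ((natDegree_mul_le).trans (by rw [natDegree_X]; omega))
    have dC : ∀ (a : ℂ) (r : Polynomial ℂ), r.natDegree ≤ m →
        (C a * r).natDegree ≤ m + 1 := fun a r hr =>
      (natDegree_C_mul_le _ _).trans (hr.trans (Nat.le_succ m))
    have cp : p.coeff (m + 1) = 0 := coeff_eq_zero_of_natDegree_lt (by omega)
    have cq : q.coeff (m + 1) = 0 := coeff_eq_zero_of_natDegree_lt (by omega)
    refine ⟨p - C (P.κ (m + 1) ^ 2) * (X * p) + C (P.c (m + 1) ^ 2 - P.d (m + 1) ^ 2) * q,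
      C (-(P.a (m + 1) ^ 2 - P.b (m + 1) ^ 2)) * (X * p)
        + (C (P.b (m + 1) ^ 2 * P.d (m + 1) ^ 2 / P.κ (m + 1) ^ 2) * q
          - C (P.a (m + 1) ^ 2 * P.c (m + 1) ^ 2) * (X * q)), ?_, ?_, ?_, ?_, ?_, ?_, ?_⟩
    · intro z
      rw [classicalT_succ, mul_apply, Fin.sum_univ_two, ← hp, ← hq]
      simp [classicalL]; ring
    · intro z
      rw [classicalT_succ, mul_apply, Fin.sum_univ_two, ← hp, ← hq]
      simp [classicalL]; ring
    · exact natDegree_add_le_of_degree_le ((natDegree_sub_le_of_le (dp.trans (Nat.le_succ m))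
        (dX _ p dp)).trans (max_self _).le) (dC _ q dq)
    · exact natDegree_add_le_of_degree_le (dX _ p dp)
        ((natDegree_sub_le_of_le (dC _ q dq) (dX _ q dq)).trans (max_self _).le)
    · simp [p0, q0]
    · simp [q0]
    · rw [prod_Ico_succ_top (show 1 ≤ m + 1 by omega), ← pm]
      simp only [coeff_add, coeff_sub, coeff_C_mul, coeff_X_mul, cp, cq]
      ring

variable {P : Params} {R : Roots} {n i : ℕ}

/-- In the upper right entry of T_{m+1} = T_m L_{m+1}, divided by -z, the constant term gives the
first relation and the coefficient of z^m the second. They are the Fermat equations of the points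
p̃_{m+1} and p_{m+1,0}. -/
theorem IsAdmissible.recursion (hadm : IsAdmissible P R n) {m : ℕ} (hm : m ∈ Ico 1 n) :
    (R.rt (m + 1) ^ 2 = R.rs (m + 1) ^ 2
      + R.rt m ^ 2 * (P.b (m + 1) ^ 2 * P.d (m + 1) ^ 2 / P.κ (m + 1) ^ 2)) ∧
    (R.r (m + 1) 0 ^ 2 = (∏ k ∈ Ico 1 (m + 1), P.κ k) ^ 2 * R.rs (m + 1) ^ 2
      + R.r m 0 ^ 2 * (P.a (m + 1) ^ 2 * P.c (m + 1) ^ 2)) := by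
  open Polynomial in
  rw [mem_Ico] at hm
  obtain ⟨p, q, hp, -, dp, -, p0, -, pm⟩ := exists_polynomial_classicalT P m
  have h1 := hadm.r_sq (m + 1) (by rw [mem_Icc]; omega)
  have h2 := hadm.r_sq m (by rw [mem_Icc]; omega)
  have hrs := hadm.rs_sq (m + 1) (by rw [mem_Icc]; omega)
  set G : ℕ → Polynomial ℂ := fun m => ∏ k ∈ Ico 1 m, (C (R.r m k ^ 2) - X) with hG
  have hGe : ∀ m z, (G m).eval z = ∏ k ∈ Ico 1 m, (R.r m k ^ 2 - z) := fun m z => by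
    simp [hG, eval_prod]
  have hGc : ∀ m, (G (m + 1)).coeff m = (-1) ^ m := fun m => by
    have : G (m + 1) = (-1) ^ m * ∏ k ∈ Ico 1 (m + 1), (X - C (R.r (m + 1) k ^ 2)) := by
      simp only [hG]
      rw [show ((-1 : Polynomial ℂ) ^ m) = ∏ k ∈ Ico 1 (m + 1), (-1) by simp, ← prod_mul_distrib]
      exact prod_congr rfl fun k _ => by ring
    have hmon : (∏ k ∈ Ico 1 (m + 1), (X - C (R.r (m + 1) k ^ 2))).Monic :=
      monic_prod_of_monic _ _ fun k _ => monic_X_sub_C _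
    have hdeg : (∏ k ∈ Ico 1 (m + 1), (X - C (R.r (m + 1) k ^ 2))).natDegree = m := by
      rw [natDegree_prod_of_monic _ _ fun k _ => monic_X_sub_C _]
      simp only [natDegree_X_sub_C, sum_const, Nat.card_Ico, smul_eq_mul]; omega
    have hc := hmon.coeff_natDegree
    rw [hdeg] at hc
    rw [this, show ((-1 : Polynomial ℂ) ^ m) = C ((-1) ^ m) by simp, coeff_C_mul, hc, mul_one]
  have hGd : (G m).natDegree ≤ m - 1 := by
    refine (natDegree_prod_le _ _).trans ?_
    refine (sum_le_card_nsmul _ _ 1 fun k _ => ?_).trans (by simp)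
    exact natDegree_sub_le_of_le ((natDegree_C _).le.trans zero_le_one) natDegree_X_le
  have key : C (R.r (m + 1) 0 ^ 2) * G (m + 1) = C (R.rs (m + 1) ^ 2) * p
      + (C (R.r m 0 ^ 2 * (P.b (m + 1) ^ 2 * P.d (m + 1) ^ 2 / P.κ (m + 1) ^ 2)) * G m
        - C (R.r m 0 ^ 2 * (P.a (m + 1) ^ 2 * P.c (m + 1) ^ 2)) * (X * G m)) := by
    apply mul_left_cancel₀ (X_ne_zero (R := ℂ))
    apply Polynomial.funext
    intro z
    have h := h1 z
    rw [classicalT_succ, mul_apply, Fin.sum_univ_two, ← hp, h2] at h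
    simp only [eval_mul, eval_X, eval_add, eval_sub, eval_C, hGe, hrs]
    simp [classicalL] at h
    linear_combination h
  have hrt : ∀ m, R.rt (m + 1) = R.r (m + 1) 0 * ∏ k ∈ Ico 1 (m + 1), R.r (m + 1) k := fun m => by
    rw [Roots.rt, range_eq_Ico, prod_eq_prod_Ico_succ_bot (by omega)]
  have hG0 : ∀ m, (G (m + 1)).eval 0 = (∏ k ∈ Ico 1 (m + 1), R.r (m + 1) k) ^ 2 := fun m => by
    simp [hGe, prod_pow]
  obtain ⟨m, rfl⟩ : ∃ j, m = j + 1 := ⟨m - 1, by omega⟩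
  constructor
  · have h := congrArg (fun f => f.eval 0) key
    simp only [eval_mul, eval_X, eval_add, eval_sub, eval_C, hG0, zero_mul, mul_zero, sub_zero,
      ← coeff_zero_eq_eval_zero p, p0, mul_one] at h
    rw [hrt, hrt]
    linear_combination h
  · have h := congrArg (fun f => f.coeff (m + 1)) key
    simp only [coeff_C_mul, coeff_add, coeff_sub, coeff_X_mul, hGc, pm,
      coeff_eq_zero_of_natDegree_lt (show (G (m + 1)).natDegree < m + 1 by omega)] at h
    have e : ∏ k ∈ Ico 1 (m + 1 + 1), (-P.κ k ^ 2)
        = (-1) ^ (m + 1) * (∏ k ∈ Ico 1 (m + 1 + 1), P.κ k) ^ 2 := by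
      rw [← prod_pow, show ((-1 : ℂ) ^ (m + 1)) = ∏ k ∈ Ico 1 (m + 1 + 1), (-1) by simp,
        ← prod_mul_distrib]
      exact prod_congr rfl fun k _ => by ring
    rw [e] at h
    have hs : ((-1 : ℂ) ^ m) ≠ 0 := pow_ne_zero _ (by norm_num)
    apply mul_left_cancel₀ hs
    rw [pow_succ] at h
    linear_combination -h

theorem IsGeneric.rt_ne (hgen : IsGeneric P R n) {m : ℕ} (hm : m ≤ n) : R.rt m ≠ 0 := by
  refine prod_ne_zero_iff.2 fun k hk => hgen.r_ne m ?_ k hk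
  simp only [mem_range, mem_Icc] at hk ⊢
  omega

theorem onCurve_pt0 (hadm : IsAdmissible P R n) (hgen : IsGeneric P R n) {m : ℕ}
    (hm : m + 2 ≤ n) : OnCurve (pt0 P R (m + 2)) := by
  have h := (hadm.recursion (m := m + 1) (by rw [mem_Ico]; omega)).2
  have h0 := hgen.r_ne (m + 2) (by rw [mem_Icc]; omega) 0 (by simp)
  have hs := hgen.rs_ne (m + 2) (by rw [mem_Icc]; omega)
  have hk : (∏ k ∈ Ico 1 (m + 2), P.κ k) ≠ 0 := prod_ne_zero_iff.2 fun k hk => hgen.κ_ne k (by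
    simp only [mem_Ico, mem_Icc] at hk ⊢; omega)
  refine ⟨?_, by simp only [pt0]; positivity⟩
  simp only [pt0, show m + 2 - 1 = m + 1 by omega, show m + 1 + 1 = m + 2 by omega] at h ⊢
  field_simp
  linear_combination -h

theorem onCurve_ptTilde (hadm : IsAdmissible P R n) (hgen : IsGeneric P R n) {m : ℕ}
    (hm : m + 2 ≤ n) : OnCurve (ptTilde P R (m + 2)) := by
  have h := (hadm.recursion (m := m + 1) (by rw [mem_Ico]; omega)).1
  have hI : m + 2 ∈ Icc 1 n := by rw [mem_Icc]; omega
  have h0 := hgen.rt_ne (m := m + 2) hm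
  have h1 := hgen.rt_ne (m := m + 1) (by omega)
  have hb := hgen.b_ne _ hI
  have hd := hgen.d_ne _ hI
  have hk := hgen.κ_ne _ hI
  simp only [ptTilde, show m + 2 - 1 = m + 1 by omega, show m + 1 + 1 = m + 2 by omega] at h ⊢
  refine ⟨?_, by simp only []; positivity⟩
  field_simp at h ⊢
  linear_combination -h

theorem ne_zero_of_sq_ne_one {x y : ℂ} (h : x ^ 2 + y ^ 2 = 1) (hx : x ^ 2 ≠ 1) : y ≠ 0 := by
  rintro rfl
  exact hx (by linear_combination h)

theorem onCurve_pt1 (hadm : IsAdmissible P R n) (hgen : IsGeneric P R n) {m l : ℕ}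
    (hm : m ∈ Ico 1 n) (hl : l ∈ Ico 1 m) : OnCurve (pt1 P R m l) :=
  ⟨hadm.fermat_one m hm l hl, ne_zero_of_sq_ne_one (hadm.fermat_one m hm l hl)
    (hgen.one_ne m (by simp only [mem_Ico, mem_Icc] at hm ⊢; omega) l hl)⟩

theorem onCurve_pt1Tilde (hadm : IsAdmissible P R n) (hgen : IsGeneric P R n) {m l : ℕ}
    (hm : m ∈ Ico 1 n) (hl : l ∈ Ico 1 m) : OnCurve (pt1Tilde P R m l) :=
  ⟨hadm.fermat_tilde m hm l hl, ne_zero_of_sq_ne_one (hadm.fermat_tilde m hm l hl)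
    (hgen.tilde_ne m (by simp only [mem_Ico, mem_Icc] at hm ⊢; omega) l hl)⟩

theorem onCurve_pt2_same (hadm : IsAdmissible P R n) (hgen : IsGeneric P R n) {m l j : ℕ}
    (hm : m ∈ Icc 1 n) (hl : l ∈ Ico 1 m) (hj : j ∈ Ico 1 m) (hlj : l ≠ j) :
    OnCurve (pt2 R m l m j) := by
  have h := hadm.fermat_same m hm l hl j hj hlj
  refine ⟨h, ne_zero_of_sq_ne_one h ?_⟩
  have h1 := hgen.r_ne m hm l (by simp only [mem_Ico, mem_range] at hl ⊢; omega)
  simp only [pt2, div_pow]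
  rw [Ne, div_eq_one_iff_eq (pow_ne_zero _ h1)]
  exact hgen.r_same m hm j hj l hl hlj.symm

theorem onCurve_pt2_next (hadm : IsAdmissible P R n) (hgen : IsGeneric P R n) {m l k : ℕ}
    (hm : m ∈ Ico 1 n) (hl : l ∈ Ico 1 m) (hk : k ∈ Ico 1 (m + 1)) :
    OnCurve (pt2 R m l (m + 1) k) := by
  have h := hadm.fermat_next m hm l hl k hk
  refine ⟨h, ne_zero_of_sq_ne_one h ?_⟩
  have h1 := hgen.r_ne m (by simp only [mem_Ico, mem_Icc] at hm ⊢; omega) l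
    (by simp only [mem_Ico, mem_range] at hl ⊢; omega)
  simp only [pt2, div_pow]
  rw [Ne, div_eq_one_iff_eq (pow_ne_zero _ h1)]
  exact (hgen.r_next m hm l hl k hk).symm

/-- The roots of the transposed model. -/
def Roots.conj (R : Roots) : Roots := { R with y₁ := fun m l => -R.y₁ m l }

theorem classicalT_conj (P : Params) (m : ℕ) (z : ℂ) : classicalT P.conj m z = classicalT P m z := by
  simp [classicalT, classicalL, Params.conj]

/-- The branch relation contains the product of `b` and `y₁`, so changing both signs preserves it.
This is the reason for the sign in `Roots.conj`. -/
theorem IsAdmissible.conj (hadm : IsAdmissible P R n) : IsAdmissible P.conj R.conj n where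
  rs_sq k hk := by simpa [Params.conj, Roots.conj] using hadm.rs_sq k hk
  r_one := hadm.r_one
  r_sq k hk z := by rw [classicalT_conj]; exact hadm.r_sq k hk z
  fermat_same := hadm.fermat_same
  fermat_next := hadm.fermat_next
  fermat_one m hm l hl := by
    have := hadm.fermat_one m hm l hl
    simp only [pt1, Params.conj, Roots.conj, neg_sq, div_neg] at this ⊢
    exact this
  fermat_tilde m hm l hl := by
    have := hadm.fermat_tilde m hm l hl
    simp only [pt1Tilde, Params.conj, Roots.conj, neg_sq, neg_div] at this ⊢
    exact this
  branch m hm l hl := by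
    have := hadm.branch m hm l hl
    simp only [Params.conj, Roots.conj, Roots.rt] at this ⊢
    rw [← this]
    ring

theorem IsGeneric.conj (hgen : IsGeneric P R n) : IsGeneric P.conj R.conj n where
  a_ne := hgen.a_ne
  b_ne k hk := neg_ne_zero.2 (hgen.b_ne k hk)
  c_ne := hgen.c_ne
  d_ne k hk := neg_ne_zero.2 (hgen.d_ne k hk)
  κ_ne := hgen.κ_ne
  rs_ne := hgen.rs_ne
  r_ne := hgen.r_ne
  r_same := hgen.r_same
  r_next := hgen.r_next
  one_ne m hm l hl := by
    have := hgen.one_ne m hm l hl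
    simp only [pt1, Params.conj, Roots.conj, neg_sq, div_neg] at this ⊢
    exact this
  tilde_ne m hm l hl := by
    have := hgen.tilde_ne m hm l hl
    simp only [pt1Tilde, Params.conj, Roots.conj, neg_sq, neg_div] at this ⊢
    exact this

/-! ### Flips -/

/-- Flip the spin `k`. -/
def flip {n : ℕ} (ρ : Spins n) (k : Fin n) : Spins n := ρ + Pi.single k 1

theorem flip_same {n : ℕ} (ρ : Spins n) (k : Fin n) : flip ρ k k = ρ k + 1 := by simp [flip]

theorem flip_of_ne {n : ℕ} (ρ : Spins n) {k j : Fin n} (h : j ≠ k) : flip ρ k j = ρ j := by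
  simp [flip, h]

theorem flip_flip {n : ℕ} (ρ : Spins n) (k : Fin n) : flip (flip ρ k) k = ρ := by
  have : (1 : ZMod 2) + 1 = 0 := rfl
  rw [flip, flip, add_assoc, ← Pi.single_add, this, Pi.single_zero, add_zero]

theorem sum_flip {n : ℕ} (ρ : Spins n) (k : Fin n) : ∑ j, flip ρ k j = (∑ j, ρ j) + 1 := by
  simp [flip, sum_add_distrib]

theorem sum_flip_equiv {n : ℕ} {M : Type*} [AddCommMonoid M] (k : Fin n) (f : Spins n → M) :
    ∑ ρ, f (flip ρ k) = ∑ ρ, f ρ :=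
  Equiv.sum_comp (Equiv.addRight (Pi.single k 1 : Spins n)) f

theorem tail_flip_succ {n : ℕ} (ρ : Spins (n + 1)) (k : Fin n) :
    Fin.tail (flip ρ k.succ) = flip (Fin.tail ρ) k := by
  funext j
  simp [Fin.tail, flip, Pi.single_apply]

theorem tail_flip_zero {n : ℕ} (ρ : Spins (n + 1)) : Fin.tail (flip ρ 0) = Fin.tail ρ := by
  funext j
  simp [Fin.tail, flip]

theorem prod_sgn_flip {n : ℕ} (ρ : Spins n) (k : Fin n) :
    ∏ j, sgn (flip ρ k j) = -∏ j, sgn (ρ j) := by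
  rw [← sgn_sum, sum_flip, sgn_add_one, sgn_sum]

theorem prod_Ico_one {M : Type*} [CommMonoid M] (i : ℕ) (f : ℕ → M) :
    ∏ k ∈ Ico 1 (i + 1), f k = ∏ k : Fin i, f (k + 1) := by
  rw [prod_Ico_eq_prod_range, Nat.add_sub_cancel, ← Fin.prod_univ_eq_prod_range (fun k => f (1 + k)) i]
  simp [add_comm]

theorem prod_Ico_one_erase {M : Type*} [CommMonoid M] {i : ℕ} (f : ℕ → M) (s : Fin i) :
    ∏ k ∈ (Ico 1 (i + 1)).erase (s + 1), f k = ∏ k ∈ univ.erase s, f (k + 1) := by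
  refine (prod_bij (fun (k : Fin i) _ => (k : ℕ) + 1) ?_ ?_ ?_ ?_).symm
  · intro k hk
    simp only [mem_erase, mem_univ, and_true, ne_eq, Fin.ext_iff, mem_Ico] at hk ⊢
    omega
  · intro a _ b _ h
    exact Fin.ext (by omega)
  · intro b hb
    simp only [mem_erase, mem_Ico] at hb
    refine ⟨⟨b - 1, by omega⟩, ?_, by simp only []; omega⟩
    simp only [mem_erase, mem_univ, and_true, ne_eq, Fin.ext_iff]
    omega
  · intro _ _; rfl

theorem prod_offDiag_split {M : Type*} [CommMonoid M] {i : ℕ} (g : Fin i → Fin i → M) (s : Fin i) :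
    ∏ j, ∏ l ∈ univ.erase j, g j l = (∏ l ∈ univ.erase s, g s l * g l s)
      * ∏ j ∈ univ.erase s, ∏ l ∈ (univ.erase j).erase s, g j l := by
  rw [← mul_prod_erase univ _ (mem_univ s), prod_mul_distrib, mul_assoc]
  congr 1
  rw [← prod_mul_distrib]
  refine prod_congr rfl fun j hj => ?_
  have hs : s ∈ univ.erase j := by
    simp only [mem_erase, mem_univ, and_true, ne_eq] at hj ⊢
    exact fun h => hj h.symm
  exact (mul_prod_erase _ (g j) hs).symm

/-! ### Zeros of the eigenvalues of `B` -/

/-- The zeros of the eigenvalue of `B_{i+1}(λ)` other than `0`. -/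
def node (R : Roots) (i : ℕ) (ρ : Fin i → ZMod 2) (k : Fin i) : ℂ :=
  -(sgn (ρ k) * R.r (i + 1) (k + 1))

theorem node_flip_same (R : Roots) (i : ℕ) (ρ : Fin i → ZMod 2) (k : Fin i) :
    node R i (flip ρ k) k = -node R i ρ k := by
  simp only [node, flip_same, sgn_add_one]; ring

theorem node_flip_of_ne (R : Roots) (i : ℕ) (ρ : Fin i → ZMod 2) {k j : Fin i} (h : j ≠ k) :
    node R i (flip ρ k) j = node R i ρ j := by
  simp only [node, flip_of_ne ρ h]

theorem node_sq (R : Roots) (i : ℕ) (ρ : Fin i → ZMod 2) (k : Fin i) :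
    node R i ρ k ^ 2 = R.r (i + 1) (k + 1) ^ 2 := by
  rw [node, neg_sq, mul_pow, sgn_sq, one_mul]

/-- A flip of `k` replaces only ℓ_k by its negative. The factor compares the interpolation
coefficients of a summand before and after the labels are reindexed by the flip. -/
theorem nodeFn_flip (R : Roots) (i : ℕ) (ρ : Fin i → ZMod 2) (k : Fin i) (lam : ℂ)
    (hne : ∀ s ∈ univ.erase k, node R i ρ k ≠ node R i ρ s) :
    nodeFn (node R i (flip ρ k)) k lam
      = -(∏ s ∈ univ.erase k, (node R i ρ k - node R i ρ s) / (-node R i ρ k - node R i ρ s))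
        * nodeFn (node R i ρ) k lam := by
  simp only [nodeFn, node_flip_same]
  rw [show ∀ a b c d : ℂ, -a * (b / c * d) = b / -c * (a * d) by
    intros; rw [div_neg]; ring, ← prod_mul_distrib]
  congr 1
  refine prod_congr rfl fun s hs => ?_
  rw [node_flip_of_ne R i ρ (by simpa using hs)]
  have := sub_ne_zero.2 (hne s hs)
  field_simp

/-- The double product of the weights of a level. -/
def offWeight (R : Roots) (i : ℕ) (ρ : Fin i → ZMod 2) : ℂ :=
  ∏ s : Fin i, ∏ s' ∈ univ.erase s, w (pt2 R (i + 1) (s + 1) (i + 1) (s' + 1)) (ρ s - ρ s')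

/-- The Fermat equations say (y r)² = r² - r'² and (y' r')² = r'² - r², so y' r' / (y r) is a square
root of -1. With this, the four values of the two spins are checked directly. -/
theorem pair_weight_flip {r r' y y' : ℂ} (hr : r ≠ 0) (hr' : r' ≠ 0)
    (h : OnCurve (r' / r, y)) (h' : OnCurve (r / r', y')) (ε ε' : ZMod 2) :
    (-(sgn ε * r) - -(sgn ε' * r')) / (- -(sgn ε * r) - -(sgn ε' * r'))
        * (w (r' / r, y) (ε - ε') * w (r / r', y') (ε' - ε))
      = w (r' / r, y) (ε + 1 - ε') * w (r / r', y') (ε' - (ε + 1))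
        * (sgn ε * sgn ε' * (y' * r' / (y * r))) := by
  have a1 := h.one_add_ne
  have a2 := h.one_sub_ne
  have b1 := h'.one_add_ne
  have b2 := h'.one_sub_ne
  have y1 := h.2
  have y2 := h'.2
  have c1 := h.1
  have c2 := h'.1
  simp only [] at a1 a2 b1 b2 y1 y2 c1 c2
  have s1 : r + r' ≠ 0 := by
    intro h0; apply a1; field_simp; rw [h0, mul_zero]
  have s2 : r - r' ≠ 0 := by
    intro h0; apply a2; field_simp; rw [h0, mul_zero]
  have s3 : r' + r ≠ 0 := by rwa [add_comm]
  have s4 : r' - r ≠ 0 := by rwa [← neg_sub, neg_ne_zero]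
  have s5 : -r + r' ≠ 0 := by rwa [neg_add_eq_sub]
  have s6 : -r - r' ≠ 0 := by rwa [← neg_add', neg_ne_zero]
  field_simp at c1 c2
  have e : (1 : ZMod 2) + 1 = 0 := rfl
  have e' : (-1 : ZMod 2) = 1 := rfl
  obtain rfl | rfl := zmod_two_cases ε <;> obtain rfl | rfl := zmod_two_cases ε' <;>
    simp only [w_zero, w_one, sgn_zero, sgn_one, zero_add, e, zero_sub, sub_zero, sub_self, e',
      one_mul, mul_one, neg_neg, neg_mul, mul_neg, sub_neg_eq_add] <;> field_simp
  · linear_combination -c2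
  · linear_combination (-r - r') * c1
  · linear_combination c1
  · linear_combination (r + r') * c2

/-- The level `i + 1` of a choice of roots is generic and consistent. -/
structure SameLevel (R : Roots) (i : ℕ) : Prop where
  r_ne : ∀ k : Fin i, R.r (i + 1) (k + 1) ≠ 0
  curve : ∀ k j : Fin i, k ≠ j → OnCurve (pt2 R (i + 1) (k + 1) (i + 1) (j + 1))
  sq_ne : ∀ k j : Fin i, k ≠ j → R.r (i + 1) (k + 1) ^ 2 ≠ R.r (i + 1) (j + 1) ^ 2

theorem sameLevel {n i : ℕ} (hadm : IsAdmissible P R n) (hgen : IsGeneric P R n) (hi : i + 1 ≤ n) :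
    SameLevel R i where
  r_ne k := hgen.r_ne _ (by rw [mem_Icc]; omega) _ (by rw [mem_range]; omega)
  curve k j h := onCurve_pt2_same hadm hgen (by rw [mem_Icc]; omega) (by rw [mem_Ico]; omega)
    (by rw [mem_Ico]; omega) (by rw [Ne, Fin.ext_iff] at h; omega)
  sq_ne k j h := hgen.r_same _ (by rw [mem_Icc]; omega) _ (by rw [mem_Ico]; omega) _
    (by rw [mem_Ico]; omega) (by rw [Ne, Fin.ext_iff] at h; omega)

theorem SameLevel.node_ne_zero {i : ℕ} (h : SameLevel R i) (ρ : Fin i → ZMod 2) (k : Fin i) :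
    node R i ρ k ≠ 0 :=
  neg_ne_zero.2 (mul_ne_zero (sgn_ne_zero _) (h.r_ne k))

theorem SameLevel.node_sq_ne {i : ℕ} (h : SameLevel R i) (ρ ρ' : Fin i → ZMod 2) {k j : Fin i}
    (hkj : k ≠ j) : node R i ρ k ^ 2 ≠ node R i ρ' j ^ 2 := by
  rw [node_sq, node_sq]; exact h.sq_ne k j hkj

theorem SameLevel.node_injective {i : ℕ} (h : SameLevel R i) (ρ : Fin i → ZMod 2) :
    Function.Injective (node R i ρ) := by
  intro k j hkj
  by_contra hne
  exact h.node_sq_ne ρ ρ hne (by rw [hkj])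

theorem SameLevel.node_ne {i : ℕ} (h : SameLevel R i) (ρ : Fin i → ZMod 2) (k : Fin i) :
    ∀ s ∈ univ.erase k, node R i ρ k ≠ node R i ρ s := by
  intro s hs e
  simp only [mem_erase, mem_univ, and_true] at hs
  exact hs (h.node_injective ρ e).symm

theorem SameLevel.offWeight_ne_zero {i : ℕ} (h : SameLevel R i) (ρ : Fin i → ZMod 2) :
    offWeight R i ρ ≠ 0 :=
  prod_ne_zero_iff.2 fun k _ => prod_ne_zero_iff.2 fun j hj =>
    (h.curve k j (by simp only [mem_erase] at hj; exact fun e => hj.1 e.symm)).w_ne _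

/-- Only the weights of pairs containing `k` change, and each such pair is treated by
`pair_weight_flip`. The same ratio of node differences recurs in `nodeFn_flip`, `pairing_flip_succ`
and `pairProd_node_flip`, which is why all of it cancels in the end. -/
theorem SameLevel.offWeight_flip {i : ℕ} (h : SameLevel R i) (ρ : Fin i → ZMod 2) (k : Fin i) :
    (∏ s ∈ univ.erase k, (node R i ρ k - node R i ρ s) / (-node R i ρ k - node R i ρ s))
        * offWeight R i ρ
      = offWeight R i (flip ρ k) * ∏ s ∈ univ.erase k, (sgn (ρ k) * sgn (ρ s)
          * (R.y₂ (i + 1) (s + 1) (i + 1) (k + 1) * R.r (i + 1) (s + 1)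
            / (R.y₂ (i + 1) (k + 1) (i + 1) (s + 1) * R.r (i + 1) (k + 1)))) := by
  rw [offWeight, offWeight, prod_offDiag_split _ k, prod_offDiag_split _ k]
  refine (mul_assoc _ _ _).symm.trans (Eq.trans ?_ (mul_right_comm _ _ _))
  congr 1
  · rw [← prod_mul_distrib, ← prod_mul_distrib]
    refine prod_congr rfl fun s hs => ?_
    simp only [mem_erase, mem_univ, and_true] at hs
    rw [flip_same, flip_of_ne ρ hs]
    exact pair_weight_flip (h.r_ne k) (h.r_ne s) (h.curve k s (Ne.symm hs)) (h.curve s k hs) _ _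
  · refine prod_congr rfl fun j hj => prod_congr rfl fun l hl => ?_
    simp only [mem_erase, mem_univ, and_true] at hj hl
    rw [flip_of_ne ρ hj, flip_of_ne ρ hl.1]

theorem OnCurve.mul_w_add_one {p : ℂ × ℂ} (h : OnCurve p) (γ : ZMod 2) :
    p.2 * w p (γ + 1) = (1 - sgn γ * p.1) * w p γ := by
  apply mul_left_cancel₀ h.2
  have h1 := h.w_add_one γ
  linear_combination (1 - sgn γ * p.1) * h1 + w p (γ + 1) * h.1
    + w p (γ + 1) * p.1 ^ 2 * sgn_sq γ

/-! ### The recursion kernel -/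

/-- The part of the kernel which depends on `σ` and on the zero modes. -/
def kSign (P : Params) (R : Roots) (i : ℕ) (ρ' : Spins (i + 1)) (σ : ZMod 2)
    (ρ : Spins (i + 2)) : ℂ :=
  sgn (((∑ k, ρ k) - ∑ k, ρ' k) * (σ - ρ 0))
      / (w (pt0 P R (i + 2)) (ρ 0 - ρ' 0 - 1) * w (ptTilde P R (i + 2)) ((∑ k, ρ k) - σ - 1))

/-- The weights between neighbouring levels. -/
def kNext (R : Roots) (i : ℕ) (τ' : Fin i → ZMod 2) (τ : Fin (i + 1) → ZMod 2) : ℂ :=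
  ∏ l : Fin i, ∏ k : Fin (i + 1), w (pt2 R (i + 1) (l + 1) (i + 2) (k + 1)) (τ' l - τ k)

/-- The one-point weights. -/
def kOne (P : Params) (R : Roots) (i : ℕ) (τ' : Fin i → ZMod 2) : ℂ :=
  ∏ l : Fin i, w (pt1 P R (i + 1) (l + 1)) (-τ' l) / w (pt1Tilde P R (i + 1) (l + 1)) (τ' l)

/-- The three factors react to flips independently: the first carries `σ` and the zero modes, the
second the interaction within and between levels, the third the factors of `F`. -/
theorem kernelR_eq (P : Params) (R : Roots) (i : ℕ) (ρ' : Spins (i + 1)) (σ : ZMod 2)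
    (ρ : Spins (i + 2)) : kernelR P R i ρ' σ ρ = kSign P R i ρ' σ ρ
      * (kNext R i (Fin.tail ρ') (Fin.tail ρ) / offWeight R i (Fin.tail ρ'))
      * kOne P R i (Fin.tail ρ') := rfl

theorem add_one_add_one (x : ZMod 2) : x + 1 + 1 = x := by revert x; decide

/-- A shift of `σ` changes only the sign and the weight at p̃_{i+2}, so this is the difference
equation of that weight. It is the condition at λ = 0 for the eigenvalue of B. -/
theorem kSign_const (hadm : IsAdmissible P R n) (hgen : IsGeneric P R n) (hi : i + 2 ≤ n)
    (ρ' : Spins (i + 1)) (σ : ZMod 2) (ρ : Spins (i + 2)) :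
    R.rs (i + 2) * sgn σ * kSign P R i ρ' σ ρ + R.rt (i + 1) * sgn (∑ k, ρ' k)
        * (P.b (i + 2) * P.d (i + 2) / P.κ (i + 2)) * kSign P R i ρ' (σ + 1) ρ
      = R.rt (i + 2) * sgn (∑ k, ρ k) * kSign P R i ρ' σ ρ := by
  have hc := onCurve_ptTilde hadm hgen hi
  have h0 := (onCurve_pt0 hadm hgen hi).w_ne (ρ 0 - ρ' 0 - 1)
  have hr := hgen.rt_ne hi
  have hκ := hgen.κ_ne (i + 2) (by rw [mem_Icc]; omega)
  set g := (∑ k, ρ k) - σ with hg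
  have e1 : sgn (((∑ k, ρ k) - ∑ k, ρ' k) * (σ + 1 - ρ 0))
      = sgn (((∑ k, ρ k) - ∑ k, ρ' k) * (σ - ρ 0)) * (sgn (∑ k, ρ k) * sgn (∑ k, ρ' k)) := by
    rw [← sgn_sub (∑ k, ρ k), ← sgn_add]; congr 1; ring
  have e2 : (∑ k, ρ k) - (σ + 1) - 1 = g := by
    rw [CharTwo.sub_eq_add, CharTwo.sub_eq_add, ← add_assoc, add_one_add_one, hg,
      CharTwo.sub_eq_add]
  have e3 : g - 1 = g + 1 := CharTwo.sub_eq_add _ _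
  have w1 := hc.w_ne g
  have w2 := hc.w_ne (g + 1)
  have h := hc.mul_w_add_one g
  have e4 : sgn g = sgn (∑ k, ρ k) * sgn σ := sgn_sub _ _
  rw [e4] at h
  have s1 := sgn_sq (∑ k, ρ k)
  have s2 := sgn_sq (∑ k, ρ' k)
  simp only [kSign, e1, e2, ← hg, e3]
  generalize sgn (((∑ k, ρ k) - ∑ k, ρ' k) * (σ - ρ 0)) = X
  generalize sgn (∑ k, ρ k) = s at *
  generalize sgn (∑ k, ρ' k) = s' at *
  generalize w (ptTilde P R (i + 2)) g = W at *
  generalize w (ptTilde P R (i + 2)) (g + 1) = W' at *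
  generalize w (pt0 P R (i + 2)) _ = W₀ at *
  simp only [ptTilde, show i + 2 - 1 = i + 1 by omega] at h
  field_simp at h ⊢
  linear_combination X * P.b (i + 2) * P.d (i + 2) * R.rt (i + 1) * W' * s * s2
    + X * s * h - X * P.κ (i + 2) * sgn σ * R.rs (i + 2) * W * s1

/-- The counterpart of `kSign_const` at λ = ∞: the flip of the zero mode changes only the sign and
the weight at p_{i+2,0}. -/
theorem kSign_flip_zero (hadm : IsAdmissible P R n) (hgen : IsGeneric P R n) (hi : i + 2 ≤ n)
    (ρ' : Spins (i + 1)) (σ : ZMod 2) (ρ : Spins (i + 2)) :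
    R.rs (i + 2) * sgn σ * (∏ k ∈ Ico 1 (i + 2), P.κ k) * kSign P R i (flip ρ' 0) σ ρ
        + R.r (i + 1) 0 * sgn (ρ' 0) * (P.a (i + 2) * P.c (i + 2)) * kSign P R i ρ' σ ρ
      = R.r (i + 2) 0 * sgn (ρ 0) * kSign P R i ρ' σ ρ := by
  have hc := onCurve_pt0 hadm hgen hi
  have h0 := (onCurve_ptTilde hadm hgen hi).w_ne ((∑ k, ρ k) - σ - 1)
  have hr := hgen.r_ne (i + 2) (by rw [mem_Icc]; omega) 0 (by simp)
  set g := ρ 0 - ρ' 0 with hg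
  have e1 : sgn (((∑ k, ρ k) - ∑ k, flip ρ' 0 k) * (σ - ρ 0))
      = sgn (((∑ k, ρ k) - ∑ k, ρ' k) * (σ - ρ 0)) * (sgn σ * sgn (ρ 0)) := by
    rw [sum_flip, ← sgn_sub σ, ← sgn_sub]; congr 1; ring
  have e2 : ρ 0 - flip ρ' 0 0 - 1 = g := by
    rw [flip_same, CharTwo.sub_eq_add, CharTwo.sub_eq_add, ← add_assoc, add_one_add_one, hg,
      CharTwo.sub_eq_add]
  have e3 : g - 1 = g + 1 := CharTwo.sub_eq_add _ _
  have w1 := hc.w_ne g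
  have w2 := hc.w_ne (g + 1)
  have h := hc.mul_w_add_one g
  have e4 : sgn g = sgn (ρ 0) * sgn (ρ' 0) := sgn_sub _ _
  rw [e4] at h
  have s1 := sgn_sq (ρ 0)
  have s2 := sgn_sq σ
  simp only [kSign, e1, e2, ← hg, e3]
  generalize sgn (((∑ k, ρ k) - ∑ k, ρ' k) * (σ - ρ 0)) = X
  generalize sgn (ρ 0) = s at *
  generalize sgn σ = s' at *
  generalize w (pt0 P R (i + 2)) g = W at *
  generalize w (pt0 P R (i + 2)) (g + 1) = W' at *
  generalize w (ptTilde P R (i + 2)) _ = W₀ at *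
  simp only [pt0, show i + 2 - 1 = i + 1 by omega] at h
  field_simp at h ⊢
  linear_combination X * (∏ k ∈ Ico 1 (i + 2), P.κ k) * R.rs (i + 2) * W' * s * s2
    + X * s * h - X * P.a (i + 2) * P.c (i + 2) * sgn (ρ' 0) * R.r (i + 1) 0 * W * s1

theorem kSign_flip_succ (ρ' : Spins (i + 1)) (s : Fin i) (σ : ZMod 2) (ρ : Spins (i + 2)) :
    kSign P R i (flip ρ' s.succ) σ ρ = kSign P R i ρ' σ ρ * (sgn σ * sgn (ρ 0)) := by
  have e1 : sgn (((∑ k, ρ k) - ∑ k, flip ρ' s.succ k) * (σ - ρ 0))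
      = sgn (((∑ k, ρ k) - ∑ k, ρ' k) * (σ - ρ 0)) * (sgn σ * sgn (ρ 0)) := by
    rw [sum_flip, ← sgn_sub σ, ← sgn_sub]; congr 1; ring
  rw [kSign, kSign, e1, flip_of_ne ρ' (Fin.succ_ne_zero s).symm]
  ring

theorem kSign_flip_right (ρ' : Spins (i + 1)) (k : Fin (i + 1)) (σ : ZMod 2) (ρ : Spins (i + 2)) :
    kSign P R i ρ' (σ + 1) ρ = kSign P R i ρ' σ (flip ρ k.succ)
      * (sgn (∑ j, ρ' j) * sgn (∑ j, ρ j) * sgn σ * sgn (ρ 0)) := by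
  have e1 : sgn (((∑ j, ρ j) - ∑ k, ρ' k) * (σ + 1 - ρ 0))
      = sgn (((∑ j, ρ j) + 1 - ∑ k, ρ' k) * (σ - ρ 0))
        * (sgn (∑ j, ρ' j) * sgn (∑ j, ρ j) * sgn σ * sgn (ρ 0)) := by
    simp only [← sgn_add]; congr 1
    have : (2 : ZMod 2) = 0 := rfl
    linear_combination (-∑ j, ρ' j - σ) * this
  have e2 : (∑ j, ρ j) - (σ + 1) - 1 = (∑ j, ρ j) + 1 - σ - 1 := by
    have : (2 : ZMod 2) = 0 := rfl
    linear_combination - this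
  rw [kSign, kSign, sum_flip, e1, e2, flip_of_ne ρ (Fin.succ_ne_zero k).symm]
  ring

theorem kSign_flip_flip (ρ' : Spins (i + 1)) (σ : ZMod 2) (ρ : Spins (i + 2)) :
    kSign P R i (flip ρ' 0) (σ + 1) (flip ρ 0) = kSign P R i ρ' σ ρ := by
  simp only [kSign, sum_flip, flip_same, add_sub_add_right_eq_sub]

theorem kernelR_flip_flip (ρ' : Spins (i + 1)) (σ : ZMod 2) (ρ : Spins (i + 2)) :
    kernelR P R i (flip ρ' 0) (σ + 1) (flip ρ 0) = kernelR P R i ρ' σ ρ := by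
  rw [kernelR_eq, kernelR_eq, kSign_flip_flip, tail_flip_zero, tail_flip_zero]

theorem kernelR_const (hadm : IsAdmissible P R n) (hgen : IsGeneric P R n) (hi : i + 2 ≤ n)
    (ρ' : Spins (i + 1)) (σ : ZMod 2) (ρ : Spins (i + 2)) :
    R.rs (i + 2) * sgn σ * kernelR P R i ρ' σ ρ + R.rt (i + 1) * sgn (∑ k, ρ' k)
        * (P.b (i + 2) * P.d (i + 2) / P.κ (i + 2)) * kernelR P R i ρ' (σ + 1) ρ
      = R.rt (i + 2) * sgn (∑ k, ρ k) * kernelR P R i ρ' σ ρ := by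
  simp only [kernelR_eq]
  linear_combination (kNext R i (Fin.tail ρ') (Fin.tail ρ) / offWeight R i (Fin.tail ρ')
    * kOne P R i (Fin.tail ρ')) * kSign_const hadm hgen hi ρ' σ ρ

theorem kernelR_leading (hadm : IsAdmissible P R n) (hgen : IsGeneric P R n) (hi : i + 2 ≤ n)
    (ρ' : Spins (i + 1)) (σ : ZMod 2) (ρ : Spins (i + 2)) :
    R.rs (i + 2) * sgn σ * (∏ k ∈ Ico 1 (i + 2), P.κ k) * kernelR P R i (flip ρ' 0) σ ρ
        + R.r (i + 1) 0 * sgn (ρ' 0) * (P.a (i + 2) * P.c (i + 2)) * kernelR P R i ρ' σ ρ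
      = R.r (i + 2) 0 * sgn (ρ 0) * kernelR P R i ρ' σ ρ := by
  simp only [kernelR_eq, tail_flip_zero]
  linear_combination (kNext R i (Fin.tail ρ') (Fin.tail ρ) / offWeight R i (Fin.tail ρ')
    * kOne P R i (Fin.tail ρ')) * kSign_flip_zero hadm hgen hi ρ' σ ρ

/-- The points between two neighbouring levels are on the curve. -/
theorem onCurve_next (hadm : IsAdmissible P R n) (hgen : IsGeneric P R n) (hi : i + 2 ≤ n)
    (l : Fin i) (k : Fin (i + 1)) : OnCurve (pt2 R (i + 1) (l + 1) (i + 2) (k + 1)) :=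
  onCurve_pt2_next hadm hgen (by rw [mem_Ico]; omega) (by rw [mem_Ico]; omega)
    (by rw [mem_Ico]; omega)

/-- The flip shifts the argument of every weight attached to `s`. In the difference equation of each
one the factor 1 ∓ r'/r is, up to r, a difference of nodes of the two levels; `kNext_flip_right` is
the same computation for a label of the upper level. -/
theorem kNext_flip_left (hadm : IsAdmissible P R n) (hgen : IsGeneric P R n) (hi : i + 2 ≤ n)
    (τ' : Fin i → ZMod 2) (τ : Fin (i + 1) → ZMod 2) (s : Fin i) :
    kNext R i (flip τ' s) τ * ∏ k : Fin (i + 1),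
        (-sgn (τ' s) * R.y₂ (i + 1) (s + 1) (i + 2) (k + 1) * R.r (i + 1) (s + 1))
      = kNext R i τ' τ * ∏ k : Fin (i + 1), (node R i τ' s - node R (i + 1) τ k) := by
  simp only [kNext]
  rw [← mul_prod_erase univ _ (mem_univ s), ← mul_prod_erase univ (fun l : Fin i => ∏ k : Fin (i + 1),
    w (pt2 R (i + 1) (l + 1) (i + 2) (k + 1)) (τ' l - τ k)) (mem_univ s)]
  refine (mul_right_comm _ _ _).trans (Eq.trans ?_ (mul_right_comm _ _ _))
  congr 1
  · rw [← prod_mul_distrib, ← prod_mul_distrib]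
    refine prod_congr rfl fun k _ => ?_
    have h := (onCurve_next hadm hgen hi s k).mul_w_add_one (τ' s - τ k)
    have hr := (sameLevel hadm hgen (show i + 1 ≤ n by omega)).r_ne s
    have s1 := sgn_sq (τ' s)
    rw [flip_same, add_sub_right_comm]
    simp only [pt2, node, sgn_sub] at h ⊢
    field_simp at h
    linear_combination (-sgn (τ' s)) * h + (w (R.r (i + 2) (k + 1) / R.r (i + 1) (s + 1),
      R.y₂ (i + 1) (s + 1) (i + 2) (k + 1)) (τ' s - τ k) * sgn (τ k) * R.r (i + 2) (k + 1)) * s1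
  · refine prod_congr rfl fun l hl => ?_
    rw [flip_of_ne τ' (by simpa using hl)]

theorem kNext_flip_right (hadm : IsAdmissible P R n) (hgen : IsGeneric P R n) (hi : i + 2 ≤ n)
    (τ' : Fin i → ZMod 2) (τ : Fin (i + 1) → ZMod 2) (k : Fin (i + 1)) :
    kNext R i τ' (flip τ k) * ∏ l : Fin i,
        (sgn (τ' l) * R.y₂ (i + 1) (l + 1) (i + 2) (k + 1) * R.r (i + 1) (l + 1))
      = kNext R i τ' τ * ∏ l : Fin i, (node R (i + 1) τ k - node R i τ' l) := by
  simp only [kNext]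
  rw [← prod_mul_distrib, ← prod_mul_distrib]
  refine prod_congr rfl fun l _ => ?_
  rw [← mul_prod_erase univ _ (mem_univ k), ← mul_prod_erase univ (fun k : Fin (i + 1) =>
    w (pt2 R (i + 1) (l + 1) (i + 2) (k + 1)) (τ' l - τ k)) (mem_univ k)]
  refine (mul_right_comm _ _ _).trans (Eq.trans ?_ (mul_right_comm _ _ _))
  congr 1
  · have h := (onCurve_next hadm hgen hi l k).mul_w_add_one (τ' l - τ k)
    have hr := (sameLevel hadm hgen (show i + 1 ≤ n by omega)).r_ne l
    have s1 := sgn_sq (τ' l)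
    have e : τ' l - (τ k + 1) = τ' l - τ k + 1 := by
      have : (2 : ZMod 2) = 0 := rfl
      linear_combination - this
    rw [flip_same, e]
    simp only [pt2, node, sgn_sub] at h ⊢
    field_simp at h
    linear_combination (sgn (τ' l)) * h - (w (R.r (i + 2) (k + 1) / R.r (i + 1) (l + 1),
      R.y₂ (i + 1) (l + 1) (i + 2) (k + 1)) (τ' l - τ k) * sgn (τ k) * R.r (i + 2) (k + 1)) * s1
  · refine prod_congr rfl fun j hj => ?_
    rw [flip_of_ne τ (by simpa using hj)]

/-- The difference equations at p_{m,l} and at p̃_{m,l} supply the two linear factors of `F`. -/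
theorem kOne_flip (hadm : IsAdmissible P R n) (hgen : IsGeneric P R n) (hi : i + 2 ≤ n)
    (τ' : Fin i → ZMod 2) (s : Fin i) :
    kOne P R i (flip τ' s) * F P (i + 1) (node R i τ' s) = kOne P R i τ' *
      (-sgn (τ' s) * P.b (i + 1) * P.c (i + 1) * R.r (i + 1) (s + 1) * R.y₁ (i + 1) (s + 1)
        * R.yt (i + 1) (s + 1)) := by
  simp only [kOne]
  rw [← mul_prod_erase univ _ (mem_univ s), ← mul_prod_erase univ (fun l : Fin i =>
    w (pt1 P R (i + 1) (l + 1)) (-τ' l) / w (pt1Tilde P R (i + 1) (l + 1)) (τ' l)) (mem_univ s)]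
  refine (mul_right_comm _ _ _).trans (Eq.trans ?_ (mul_right_comm _ _ _))
  congr 1
  · have hm : i + 1 ∈ Ico 1 n := by rw [mem_Ico]; omega
    have hl : (s : ℕ) + 1 ∈ Ico 1 (i + 1) := by rw [mem_Ico]; omega
    have hI : i + 1 ∈ Icc 1 n := by rw [mem_Icc]; omega
    have c1 := onCurve_pt1 hadm hgen hm hl
    have c2 := onCurve_pt1Tilde hadm hgen hm hl
    have h1 := c1.w_add_one (τ' s)
    have h2 := c2.mul_w_add_one (τ' s)
    have n1 := c1.w_ne (τ' s)
    have n2 := c1.w_ne (τ' s + 1)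
    have n3 := c2.w_ne (τ' s)
    have n4 := c2.w_ne (τ' s + 1)
    have hr := (sameLevel hadm hgen (show i + 1 ≤ n by omega)).r_ne s
    have hb := hgen.b_ne _ hI
    have hc := hgen.c_ne _ hI
    have hκ := hgen.κ_ne _ hI
    have s1 := sgn_sq (τ' s)
    rw [flip_same, ZMod.neg_eq_self_mod_two, ZMod.neg_eq_self_mod_two]
    simp only [F, node]
    simp only [pt1, pt1Tilde] at *
    generalize w _ (τ' s) = W1 at *
    generalize w _ (τ' s + 1) = W2 at *
    generalize w _ (τ' s) = W3 at *
    generalize w _ (τ' s + 1) = W4 at *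
    have k1 : W4 * (P.b (i + 1) + P.a (i + 1) * P.κ (i + 1) * sgn (τ' s) * R.r (i + 1) (s + 1))
        = P.b (i + 1) * R.y₁ (i + 1) (s + 1) * W1 := by
      field_simp at h1
      linear_combination h1
    have k2 : (P.d (i + 1) / P.κ (i + 1) - sgn (τ' s) * R.r (i + 1) (s + 1) * P.c (i + 1)) * W3
        = -sgn (τ' s) * R.r (i + 1) (s + 1) * P.c (i + 1) * R.yt (i + 1) (s + 1) * W2 := by
      field_simp at h2 ⊢
      linear_combination (sgn (τ' s)) * h2 - P.d (i + 1) * W3 * s1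
    rw [div_mul_eq_mul_div, div_mul_eq_mul_div, div_eq_div_iff n4 n3]
    linear_combination (P.d (i + 1) / P.κ (i + 1) - sgn (τ' s) * R.r (i + 1) (s + 1) * P.c (i + 1))
      * W3 * k1 + P.b (i + 1) * R.y₁ (i + 1) (s + 1) * W1 * k2
  · refine prod_congr rfl fun l hl => ?_
    rw [flip_of_ne τ' (by simpa using hl)]

/-- The amplitude of the action of `A_{i+1}` at the zero `k` of the eigenvalue of `B_{i+1}`. -/
def phi (P : Params) (R : Roots) (i : ℕ) (τ : Fin i → ZMod 2) (k : Fin i) : ℂ :=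
  -(F P (i + 1) (-node R i τ k) / R.rs (i + 1)) * R.rt i
    * (∏ l ∈ Ico 1 i, R.y₂ i l (i + 1) (k + 1)) * ∏ s, sgn (τ s)

theorem rt_succ (R : Roots) (i : ℕ) :
    R.rt (i + 1) = R.r (i + 1) 0 * ∏ l : Fin i, R.r (i + 1) (l + 1) := by
  rw [Roots.rt, range_eq_Ico, prod_eq_prod_Ico_succ_bot (by omega), zero_add, prod_Ico_one]

theorem sgn_sum_succ (ρ : Spins (i + 1)) :
    sgn (∑ k, ρ k) = sgn (ρ 0) * ∏ s, sgn (Fin.tail ρ s) := by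
  rw [Fin.sum_univ_succ, sgn_add, sgn_sum]; rfl

theorem prod_sgn_sq (τ : Fin i → ZMod 2) : (∏ s, sgn (τ s)) ^ 2 = 1 := by
  rw [← sgn_sum, sgn_sq]

theorem phi_succ (P : Params) (R : Roots) (i : ℕ) (τ : Fin (i + 1) → ZMod 2) (k : Fin (i + 1)) :
    phi P R (i + 1) τ k = -(F P (i + 2) (-node R (i + 1) τ k) / R.rs (i + 2))
      * (R.r (i + 1) 0 * ∏ l : Fin i, R.r (i + 1) (l + 1))
      * (∏ l : Fin i, R.y₂ (i + 1) (l + 1) (i + 2) (k + 1)) * ∏ s, sgn (τ s) := by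
  rw [← rt_succ, ← prod_Ico_one i (fun l => R.y₂ (i + 1) l (i + 2) (k + 1))]; rfl

/-- The coefficient identity needed for A at a zero of the new level: the product of node
differences is the eigenvalue of B of the shorter chain, evaluated there. -/
theorem kernelR_node_right (hadm : IsAdmissible P R n) (hgen : IsGeneric P R n) (hi : i + 2 ≤ n)
    (ρ' : Spins (i + 1)) (σ : ZMod 2) (ρ : Spins (i + 2)) (k : Fin (i + 1)) :
    -(F P (i + 2) (-node R (i + 1) (Fin.tail ρ) k) / R.rs (i + 2)) * (R.r (i + 1) 0 * sgn (ρ' 0)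
        * ∏ s, (node R (i + 1) (Fin.tail ρ) k - node R i (Fin.tail ρ') s)) * sgn σ
        * kernelR P R i ρ' (σ + 1) ρ
      = phi P R (i + 1) (Fin.tail ρ) k * kernelR P R i ρ' σ (flip ρ k.succ) := by
  have h := kNext_flip_right hadm hgen hi (Fin.tail ρ') (Fin.tail ρ) k
  simp only [kernelR_eq, kSign_flip_right ρ' k σ ρ, tail_flip_succ, phi_succ, sgn_sum_succ]
  simp only [prod_mul_distrib] at h
  have s1 := sgn_sq (ρ' 0)
  have s2 := sgn_sq σ
  have s3 := sgn_sq (ρ 0)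
  have s4 := prod_sgn_sq (Fin.tail ρ')
  generalize (∏ s, sgn (Fin.tail ρ' s)) = E' at *
  generalize (∏ s, sgn (Fin.tail ρ s)) = E at *
  generalize sgn (ρ' 0) = a at *
  generalize sgn (ρ 0) = b at *
  generalize sgn σ = c at *
  generalize F P (i + 2) (-node R (i + 1) (Fin.tail ρ) k) / R.rs (i + 2) = f
  generalize kSign P R i ρ' σ (flip ρ k.succ) = K
  simp only [div_eq_mul_inv]
  generalize (offWeight R i (Fin.tail ρ'))⁻¹ = o
  generalize kOne P R i (Fin.tail ρ') = z
  generalize kNext R i (Fin.tail ρ') (Fin.tail ρ) = N1 at *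
  generalize kNext R i (Fin.tail ρ') (flip (Fin.tail ρ) k) = N2 at *
  generalize (∏ s, (node R (i + 1) (Fin.tail ρ) k - node R i (Fin.tail ρ') s)) = p at *
  generalize (∏ l : Fin i, R.y₂ (i + 1) (l + 1) (i + 2) (k + 1)) = y at *
  generalize (∏ l : Fin i, R.r (i + 1) (l + 1)) = r at *
  generalize R.r (i + 1) 0 = q
  have e : -f * (q * a * p) * c * (K * (a * E' * (b * E) * c * b) * (N1 * o) * z)
      = -f * q * K * o * z * E * E' * (a ^ 2 * c ^ 2 * b ^ 2) * (N1 * p) := by ring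
  rw [e, s1, s2, s3, ← h]
  linear_combination (-f * q * K * o * z * E * N2 * y * r) * s4

theorem branch_fin (hadm : IsAdmissible P R n) (hi : i + 2 ≤ n) (s : Fin i) :
    R.rt i * R.rs (i + 2) * P.b (i + 1) * P.c (i + 1) * R.y₁ (i + 1) (s + 1) * R.yt (i + 1) (s + 1)
        * (∏ l ∈ Ico 1 i, R.y₂ i l (i + 1) (s + 1))
        * ∏ j ∈ univ.erase s, R.y₂ (i + 1) (s + 1) (i + 1) (j + 1)
      = R.rs (i + 1) * R.r (i + 2) 0 * (∏ l : Fin i, R.r (i + 1) (l + 1))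
        * (∏ k : Fin (i + 1), R.y₂ (i + 1) (s + 1) (i + 2) (k + 1))
        * ∏ j ∈ univ.erase s, R.y₂ (i + 1) (j + 1) (i + 1) (s + 1) := by
  have h := hadm.branch (i + 1) (by rw [mem_Ico]; omega) (s + 1) (by rw [mem_Ico]; omega)
  rw [prod_Ico_one_erase (fun j => R.y₂ (i + 1) (s + 1) (i + 1) j),
    prod_Ico_one_erase (fun j => R.y₂ (i + 1) j (i + 1) (s + 1)),
    prod_Ico_one, prod_Ico_one] at h
  exact h

/-- Each of the `i - 1` factors is the square of a square root of -1, by the two Fermat equations of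
the pair. -/
theorem SameLevel.prod_sq_ratio (h : SameLevel R i) (s : Fin i) :
    ∏ j ∈ univ.erase s, (R.y₂ (i + 1) (j + 1) (i + 1) (s + 1) * R.r (i + 1) (j + 1)
      / (R.y₂ (i + 1) (s + 1) (i + 1) (j + 1) * R.r (i + 1) (s + 1))) ^ 2 = (-1) ^ (i - 1) := by
  have : ((-1 : ℂ)) ^ (i - 1) = ∏ j ∈ univ.erase s, (-1) := by simp
  rw [this]
  refine prod_congr rfl fun j hj => ?_
  simp only [mem_erase, mem_univ, and_true] at hj
  have c1 := h.curve s j (Ne.symm hj)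
  have c2 := h.curve j s hj
  have r1 := h.r_ne s
  have r2 := h.r_ne j
  have y1 := c1.2
  have e1 := c1.1
  have e2 := c2.1
  simp only [pt2] at y1 e1 e2
  field_simp at e1 e2 ⊢
  linear_combination e1 + e2

/-- This is `kernelR_node_left` with every product replaced by a letter. The ratio A Q / (B r^j)
enters once through the weights of the level (`h3`) and once through the branch relation (`h4`); its
square is the sign (-1)^j, which cancels the one coming from the weights between the levels (`h1`).
-/
theorem node_left_algebra (j : ℕ)
    {N₁ N₂ e Y r p Z₁ Z₂ f b c y₁ yt Q₁ O₁ O₂ E A Q B rt rs₁ rs₂ Yp r₀ σ b₀ K : ℂ}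
    (h1 : N₂ * ((-e) ^ (j + 2) * Y * r ^ (j + 2)) = N₁ * p)
    (h2 : Z₂ * f = Z₁ * (-e * b * c * r * y₁ * yt))
    (h3 : Q₁ * O₁ = O₂ * (e ^ j * E * (A * Q / (B * r ^ j))))
    (h4 : rt * rs₂ * b * c * y₁ * yt * Yp * B = rs₁ * r₀ * (r * Q) * Y * A)
    (h5 : (A * Q / (B * r ^ j)) ^ 2 = (-1) ^ j)
    (o1 : O₁ ≠ 0) (o2 : O₂ ≠ 0) (hrs : rs₁ ≠ 0) (hB : B ≠ 0) (hr : r ≠ 0)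
    (s1 : e ^ 2 = 1) (s2 : σ ^ 2 = 1) (hE : E ^ 2 = 1) :
    rs₂ * σ * (-Q₁) * (-(f / rs₁) * rt * Yp * -(e * E)) * (K * (σ * b₀) * (N₂ / O₂) * Z₂)
      = r₀ * b₀ * p * (K * (N₁ / O₁) * Z₁) := by
  have hC' : A * Q = A * Q / (B * r ^ j) * (B * r ^ j) :=
    (div_mul_cancel₀ _ (mul_ne_zero hB (pow_ne_zero _ hr))).symm
  generalize A * Q / (B * r ^ j) = C at *
  have h4' : rt * rs₂ * b * c * y₁ * yt * Yp = rs₁ * r₀ * r * Y * C * r ^ j := by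
    apply mul_right_cancel₀ hB
    linear_combination h4 + rs₁ * r₀ * r * Y * hC'
  have h3' : Q₁ / O₂ = e ^ j * E * C / O₁ := by
    rw [div_eq_div_iff o2 o1, h3]; ring
  have h1' : N₁ * p = N₂ * ((-1) ^ j * e ^ j * Y * r ^ (j + 2)) := by
    rw [← h1, pow_add (-e), neg_pow e j, neg_sq, s1]; ring
  calc _ = -(rs₂ * σ ^ 2 * rt * Yp * e * E * b₀ * K * N₂ / rs₁) * (Q₁ / O₂) * (Z₂ * f) := by ring
    _ = b₀ * K * N₂ * Z₁ * e ^ 2 * E ^ 2 * e ^ j * C * r / (rs₁ * O₁)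
        * (rt * rs₂ * b * c * y₁ * yt * Yp) := by
      rw [h3', h2, s2]; ring
    _ = b₀ * K * N₂ * Z₁ * e ^ j * C ^ 2 * r ^ (j + 2) * r₀ * Y / O₁ := by
      rw [h4', s1, hE, ← mul_div_mul_left _ O₁ hrs]; ring
    _ = r₀ * b₀ * K * Z₁ / O₁ * (N₁ * p) := by
      rw [h5, h1']; ring
    _ = _ := by ring

/-- The condition at a zero of the lower level. This is where the branch relation is indispensable:
without it the two sides would agree only up to a sign. -/
theorem kernelR_node_left (hadm : IsAdmissible P R n) (hgen : IsGeneric P R n) (hi : i + 2 ≤ n)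
    (ρ' : Spins (i + 1)) (σ : ZMod 2) (ρ : Spins (i + 2)) (s : Fin i) :
    R.rs (i + 2) * sgn σ * (-(∏ j ∈ univ.erase s,
          (node R i (Fin.tail ρ') s - node R i (Fin.tail ρ') j)
            / (-node R i (Fin.tail ρ') s - node R i (Fin.tail ρ') j)))
        * phi P R i (flip (Fin.tail ρ') s) s * kernelR P R i (flip ρ' s.succ) σ ρ
      = R.r (i + 2) 0 * sgn (ρ 0)
        * (∏ k, (node R i (Fin.tail ρ') s - node R (i + 1) (Fin.tail ρ) k))
        * kernelR P R i ρ' σ ρ := by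
  have hS := sameLevel hadm hgen (show i + 1 ≤ n by omega)
  have h1 := kNext_flip_left hadm hgen hi (Fin.tail ρ') (Fin.tail ρ) s
  have h2 := kOne_flip hadm hgen hi (Fin.tail ρ') s
  have h3 := hS.offWeight_flip (Fin.tail ρ') s
  have h4 := branch_fin hadm hi s
  have h5 := hS.prod_sq_ratio s
  have o1 := hS.offWeight_ne_zero (Fin.tail ρ')
  have o2 := hS.offWeight_ne_zero (flip (Fin.tail ρ') s)
  have hrs := hgen.rs_ne (i + 1) (by rw [mem_Icc]; omega)
  have hr := hS.r_ne s
  have hy : ∏ k : Fin (i + 1), R.y₂ (i + 1) (s + 1) (i + 2) (k + 1) ≠ 0 :=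
    prod_ne_zero_iff.2 fun k _ => (onCurve_next hadm hgen hi s k).2
  have hys : ∏ j ∈ univ.erase s, R.y₂ (i + 1) (s + 1) (i + 1) (j + 1) ≠ 0 :=
    prod_ne_zero_iff.2 fun j hj => (hS.curve s j (by
      simp only [mem_erase] at hj; exact Ne.symm hj.1)).2
  have s1 := sgn_sq (Fin.tail ρ' s)
  have s2 := sgn_sq σ
  have hE := mul_prod_erase univ (fun j => sgn (Fin.tail ρ' j)) (mem_univ s)
  have hE2 : (∏ j ∈ univ.erase s, sgn (Fin.tail ρ' j)) ^ 2 = 1 := by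
    rw [← sgn_sum, sgn_sq]
  have hR := mul_prod_erase univ (fun j : Fin i => R.r (i + 1) (j + 1)) (mem_univ s)
  have hO : ∏ j ∈ univ.erase s, (sgn (Fin.tail ρ' s) * sgn (Fin.tail ρ' j)
        * (R.y₂ (i + 1) (j + 1) (i + 1) (s + 1) * R.r (i + 1) (j + 1)
          / (R.y₂ (i + 1) (s + 1) (i + 1) (j + 1) * R.r (i + 1) (s + 1))))
      = sgn (Fin.tail ρ' s) ^ (i - 1) * (∏ j ∈ univ.erase s, sgn (Fin.tail ρ' j))
        * ((∏ j ∈ univ.erase s, R.y₂ (i + 1) (j + 1) (i + 1) (s + 1))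
          * (∏ j ∈ univ.erase s, R.r (i + 1) (j + 1))
          / ((∏ j ∈ univ.erase s, R.y₂ (i + 1) (s + 1) (i + 1) (j + 1))
            * R.r (i + 1) (s + 1) ^ (i - 1))) := by
    simp [prod_mul_distrib, prod_div_distrib]
  have hJ : i - 1 + 2 = i + 1 := by have := s.pos; omega
  have hM : ∏ k : Fin (i + 1),
        (-sgn (Fin.tail ρ' s) * R.y₂ (i + 1) (s + 1) (i + 2) (k + 1) * R.r (i + 1) (s + 1))
      = (-sgn (Fin.tail ρ' s)) ^ (i - 1 + 2)
        * (∏ k : Fin (i + 1), R.y₂ (i + 1) (s + 1) (i + 2) (k + 1))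
        * R.r (i + 1) (s + 1) ^ (i - 1 + 2) := by
    rw [prod_mul_distrib, prod_mul_distrib]; simp [hJ]
  have hQ : ∏ j ∈ univ.erase s, (R.y₂ (i + 1) (j + 1) (i + 1) (s + 1) * R.r (i + 1) (j + 1)
        / (R.y₂ (i + 1) (s + 1) (i + 1) (j + 1) * R.r (i + 1) (s + 1))) ^ 2
      = ((∏ j ∈ univ.erase s, R.y₂ (i + 1) (j + 1) (i + 1) (s + 1))
          * (∏ j ∈ univ.erase s, R.r (i + 1) (j + 1))
          / ((∏ j ∈ univ.erase s, R.y₂ (i + 1) (s + 1) (i + 1) (j + 1))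
            * R.r (i + 1) (s + 1) ^ (i - 1))) ^ 2 := by
    rw [prod_pow, prod_div_distrib, prod_mul_distrib, prod_mul_distrib]; simp
  rw [hM] at h1
  rw [hO] at h3
  rw [hQ] at h5
  rw [← hR] at h4
  simp only [kernelR_eq, kSign_flip_succ, tail_flip_succ, phi, node_flip_same, neg_neg,
    prod_sgn_flip]
  rw [← hE]
  exact node_left_algebra (i - 1) h1 h2 h3 h4 h5 o1 o2 hrs hys hr s1 s2 hE2

/-! ### One site -/

theorem onCurve_psiR (hadm : IsAdmissible P R n) (hgen : IsGeneric P R n) {k : ℕ}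
    (hk : k ∈ Icc 1 n) : OnCurve (R.rs k / P.a k, P.b k / P.a k) := by
  have ha := hgen.a_ne k hk
  have hb := hgen.b_ne k hk
  have h := hadm.rs_sq k hk
  refine ⟨?_, div_ne_zero hb ha⟩
  field_simp
  linear_combination h

theorem v1_mulVec (f : ZMod 2 → ℂ) : v1 *ᵥ f = fun γ => f (γ + 1) := by
  ext γ
  obtain rfl | rfl := zmod_two_cases γ <;>
    simp [v1, mulVec, dotProduct, sum_zmod_two, show (1 : ZMod 2) + 1 = 0 from rfl]

theorem v1_psiR (P : Params) (R : Roots) (k : ℕ) (σ : ZMod 2) :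
    v1 *ᵥ psiR P R k σ = psiR P R k (σ + 1) := by
  rw [v1_mulVec]
  ext γ
  have : (2 : ZMod 2) = 0 := rfl
  simp only [psiR]
  congr 1
  linear_combination this

/-- The one-site operator `u (a - b v)`. -/
def clock (P : Params) (k : ℕ) : Op1 := u1 * (P.a k • 1 - P.b k • v1)

theorem clock_psiR (hadm : IsAdmissible P R n) (hgen : IsGeneric P R n) {k : ℕ}
    (hk : k ∈ Icc 1 n) (σ : ZMod 2) :
    clock P k *ᵥ psiR P R k σ = (R.rs k * sgn σ) • psiR P R k σ := by
  have ha := hgen.a_ne k hk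
  have h := (onCurve_psiR hadm hgen hk).one_add_ne
  have h' : P.a k + R.rs k ≠ 0 := by
    intro h0; apply h; simp only []; field_simp; rw [h0, mul_zero]
  have hr := hadm.rs_sq k hk
  rw [clock, ← mulVec_mulVec, sub_mulVec, smul_mulVec, smul_mulVec, one_mulVec, v1_psiR, u1]
  ext γ
  rw [mulVec_diagonal]
  obtain rfl | rfl := zmod_two_cases γ <;> obtain rfl | rfl := zmod_two_cases σ <;>
    simp [psiR, w_zero, w_one, sgn_zero, sgn_one, show (1 : ZMod 2) + 1 = 0 from rfl,
      show (-1 : ZMod 2) = 1 from rfl] <;> field_simp <;>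
    first | ring1 | linear_combination hr | linear_combination -hr

theorem clock_mul_clock (hadm : IsAdmissible P R n) {k : ℕ} (hk : k ∈ Icc 1 n) :
    clock P k * clock P k = R.rs k ^ 2 • 1 := by
  rw [hadm.rs_sq k hk]
  ext x y
  obtain rfl | rfl := zmod_two_cases x <;> obtain rfl | rfl := zmod_two_cases y <;>
    simp [clock, mul_apply, sum_zmod_two, v1, u1, diagonal_apply, one_apply, sgn,
      show (1 : ZMod 2) + 1 = 0 from rfl] <;> ring

/-- The entry `ell P k lam 0 1` is `lam` times `clock P k`, whose square is a scalar, so it can be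
used as a pivot. What is left of the other entries is a determinant, hence the factor `F`. -/
theorem ell_elimination (hadm : IsAdmissible P R n) (hgen : IsGeneric P R n) {k : ℕ}
    (hk : k ∈ Icc 1 n) (lam : ℂ) :
    (lam * R.rs k ^ 2) • ell P k lam 1 0 - ell P k lam 0 0 * clock P k * ell P k lam 1 1
      = -F P k (-lam) • (clock P k * v1) := by
  have hκ := hgen.κ_ne k hk
  rw [hadm.rs_sq k hk]
  ext x y
  obtain rfl | rfl := zmod_two_cases x <;> obtain rfl | rfl := zmod_two_cases y <;>
    simp [ell, F, clock, mul_apply, sum_zmod_two, v1, u1, diagonal_apply, one_apply, sgn,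
      show (1 : ZMod 2) + 1 = 0 from rfl] <;> field_simp <;> ring

/-- The operator A of the shorter chain is eliminated between the last-site expansions of A and B.
On an eigenvector, at a zero of its eigenvalue, the first term on the right drops out. The second
contains only B of the shorter chain, which is diagonal by induction. -/
theorem monodromy_elimination (hadm : IsAdmissible P R n) (hgen : IsGeneric P R n)
    (hi : i + 1 ≤ n) (lam : ℂ) :
    (lam * R.rs (i + 1) ^ 2) • monodromy P (i + 1) lam 0 0
      = kr 1 (ell P (i + 1) lam 0 0 * clock P (i + 1)) * monodromy P (i + 1) lam 0 1
        - F P (i + 1) (-lam) • kr (monodromy P i lam 0 1) (clock P (i + 1) * v1) := by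
  have hk : i + 1 ∈ Icc 1 n := by rw [mem_Icc]; omega
  have e1 := ell_elimination hadm hgen hk lam
  have e2 := clock_mul_clock hadm hk
  have e3 : ell P (i + 1) lam 0 1 = lam • clock P (i + 1) := rfl
  have e4 : ell P (i + 1) lam 0 0 * clock P (i + 1) * ell P (i + 1) lam 0 1
      = (lam * R.rs (i + 1) ^ 2) • ell P (i + 1) lam 0 0 := by
    rw [e3, mul_smul_comm, mul_assoc, e2, mul_smul_comm, mul_one, smul_smul]
  rw [monodromy_succ, monodromy_succ, mul_add, kr_mul, kr_mul, e4, one_mul, one_mul, smul_add,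
    ← kr_smul_right, ← kr_smul_right, add_sub_assoc]
  congr 1
  rw [← kr_smul_right, ← kr_sub_right]
  congr 1
  rw [neg_smul] at e1
  rw [sub_eq_iff_eq_add.1 e1]
  abel

/-! ### The action of the monodromy matrix on the eigenvectors of `B` -/

/-- The eigenvalue of `B_{i+1}(λ)`. -/
def eigB (R : Roots) (i : ℕ) (ρ : Spins (i + 1)) (lam : ℂ) : ℂ :=
  lam * R.r (i + 1) 0 * sgn (ρ 0) * ∏ k, (lam - node R i (Fin.tail ρ) k)

/-- The action of the monodromy matrix on the vectors `PsiR`. -/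
structure IsSystem (P : Params) (R : Roots) (i : ℕ) : Prop where
  B_apply : ∀ ρ lam, monodromy P (i + 1) lam 0 1 *ᵥ PsiR P R i ρ = eigB R i ρ lam • PsiR P R i ρ
  V_apply : ∀ ρ, VOp (i + 1) *ᵥ PsiR P R i ρ = PsiR P R i (flip ρ 0)
  A_apply : ∀ ρ k, monodromy P (i + 1) (node R i (Fin.tail ρ) k) 0 0 *ᵥ PsiR P R i ρ
    = phi P R i (Fin.tail ρ) k • PsiR P R i (flip ρ k.succ)

theorem PsiR_zero (P : Params) (R : Roots) (ρ : Spins 1) :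
    PsiR P R 0 ρ = tens (fun _ => 1) (psiR P R 1 (ρ 0)) := by
  ext γ
  simp [PsiR, tens]

theorem PsiR_succ (P : Params) (R : Roots) (i : ℕ) (ρ : Spins (i + 2)) :
    PsiR P R (i + 1) ρ = ∑ ρ', ∑ σ, kernelR P R i ρ' σ ρ
      • tens (PsiR P R i ρ') (psiR P R (i + 2) σ) := by
  ext γ
  simp [PsiR, tens]

theorem tens_smul_left {n : ℕ} (c : ℂ) (f : Spins n → ℂ) (g : ZMod 2 → ℂ) :
    tens (c • f) g = c • tens f g := by
  ext γ; simp [tens, mul_assoc]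

theorem tens_smul_right {n : ℕ} (c : ℂ) (f : Spins n → ℂ) (g : ZMod 2 → ℂ) :
    tens f (c • g) = c • tens f g := by
  ext γ; simp [tens, mul_left_comm]

theorem tens_add_left {n : ℕ} (f f' : Spins n → ℂ) (g : ZMod 2 → ℂ) :
    tens (f + f') g = tens f g + tens f' g := by
  ext γ; simp [tens, add_mul]

theorem tens_add_right {n : ℕ} (f : Spins n → ℂ) (g g' : ZMod 2 → ℂ) :
    tens f (g + g') = tens f g + tens f g' := by
  ext γ; simp [tens, mul_add]

theorem tens_sum_left {n : ℕ} {ι : Type*} (s : Finset ι) (f : ι → Spins n → ℂ) (g : ZMod 2 → ℂ) :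
    tens (∑ k ∈ s, f k) g = ∑ k ∈ s, tens (f k) g := by
  ext γ; simp [tens, sum_mul]

theorem sum_add_one {M : Type*} [AddCommMonoid M] (f : ZMod 2 → M) :
    ∑ σ, f (σ + 1) = ∑ σ, f σ := Equiv.sum_comp (Equiv.addRight 1) f

theorem isSystem_zero (hadm : IsAdmissible P R n) (hgen : IsGeneric P R n) (hn : 1 ≤ n) :
    IsSystem P R 0 where
  B_apply ρ lam := by
    have hk : 1 ∈ Icc 1 n := by rw [mem_Icc]; omega
    have e3 : ell P (0 + 1) lam 0 1 = lam • clock P 1 := rfl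
    have e4 : (1 : Matrix (Fin 2) (Fin 2) (Op 0)) 0 1 = 0 := by simp
    have e5 : (1 : Matrix (Fin 2) (Fin 2) (Op 0)) 0 0 = 1 := by simp
    rw [monodromy_succ, monodromy_zero, e4, e5, kr_zero_left, add_zero, PsiR_zero, kr_mulVec,
      one_mulVec, e3, smul_mulVec, clock_psiR hadm hgen hk, smul_smul, tens_smul_right, eigB,
      hadm.r_one]
    simp [mul_assoc]
  V_apply ρ := by
    rw [VOp_succ, VOp_zero, PsiR_zero, kr_mulVec, one_mulVec, v1_psiR, PsiR_zero, flip_same]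
  A_apply ρ k := k.elim0

theorem isPoly_prod_sub {i : ℕ} (ν : Fin i → ℂ) :
    IsPoly i (fun lam => ∏ k, (lam - ν k)) (∏ k, (-ν k)) 1 := by
  induction i with
  | zero => exact ⟨fun _ => 1, by simp⟩
  | succ i ih =>
    have h := ih (fun k => ν k.succ)
    convert h.shift.add (h.map (LinearMap.lsmul ℂ ℂ (-ν 0))).raise using 1
    · ext lam
      rw [Fin.prod_univ_succ]
      simp only [smul_eq_mul, LinearMap.lsmul_apply]
      ring
    · rw [Fin.prod_univ_succ]; simp
    · simp

/-- The constant term of A is the identity and its leading term a multiple of V, so the values at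
the zeros are the only further input. -/
theorem IsSystem.A_interpolation (h : IsSystem P R i) (hS : SameLevel R i) (ρ : Spins (i + 1))
    (lam : ℂ) : monodromy P (i + 1) lam 0 0 *ᵥ PsiR P R i ρ
      = (∏ s, (1 - lam / node R i (Fin.tail ρ) s)) • PsiR P R i ρ
        + (lam * (∏ s, (lam - node R i (Fin.tail ρ) s)) * ∏ k ∈ Ico 1 (i + 2), P.κ k)
          • PsiR P R i (flip ρ 0)
        + ∑ k, (nodeFn (node R i (Fin.tail ρ)) k lam * phi P R i (Fin.tail ρ) k)
          • PsiR P R i (flip ρ k.succ) := by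
  have h1 := (isPoly_monodromy P (i + 1)).1.map
    ((mulVecBilin ℂ ℂ).flip (PsiR P R i ρ) : Op (i + 1) →ₗ[ℂ] (Spins (i + 1) → ℂ))
  have h2 := h1.interpolation (node R i (Fin.tail ρ)) (hS.node_injective _)
    (hS.node_ne_zero _) lam
  simp only [LinearMap.flip_apply, mulVecBilin_apply, one_mulVec, smul_mulVec, h.V_apply,
    h.A_apply, smul_smul] at h2
  exact h2

theorem IsSystem.V_succ (h : IsSystem P R i) (ρ : Spins (i + 2)) :
    VOp (i + 2) *ᵥ PsiR P R (i + 1) ρ = PsiR P R (i + 1) (flip ρ 0) := by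
  rw [PsiR_succ, PsiR_succ, mulVec_sum]
  rw [← sum_flip_equiv 0]
  refine sum_congr rfl fun ρ' _ => ?_
  rw [mulVec_sum, ← sum_add_one]
  refine sum_congr rfl fun σ _ => ?_
  rw [mulVec_smul, VOp_succ, kr_mulVec, h.V_apply, v1_psiR, flip_flip, add_one_add_one]
  have := kernelR_flip_flip (P := P) (R := R) ρ' σ (flip ρ 0)
  rw [flip_flip] at this
  rw [this]

theorem prod_sub_node (hS : SameLevel R i) (τ : Fin i → ZMod 2) (lam : ℂ) :
    ∏ s, (lam - node R i τ s) = (∏ s, (1 - lam / node R i τ s)) * ∏ s, (-node R i τ s) := by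
  rw [← prod_mul_distrib]
  refine prod_congr rfl fun s _ => ?_
  have := hS.node_ne_zero τ s
  field_simp
  ring

theorem prod_neg_node (R : Roots) (i : ℕ) (ρ : Spins (i + 1)) :
    R.r (i + 1) 0 * sgn (ρ 0) * ∏ s, (-node R i (Fin.tail ρ) s)
      = R.rt (i + 1) * sgn (∑ k, ρ k) := by
  simp only [node, neg_neg, prod_mul_distrib, rt_succ, sgn_sum_succ]
  ring

theorem ell_zero_one_psiR (hadm : IsAdmissible P R n) (hgen : IsGeneric P R n) {k : ℕ}
    (hk : k ∈ Icc 1 n) (lam : ℂ) (σ : ZMod 2) :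
    ell P k lam 0 1 *ᵥ psiR P R k σ = (lam * (R.rs k * sgn σ)) • psiR P R k σ := by
  have e : ell P k lam 0 1 = lam • clock P k := rfl
  rw [e, smul_mulVec, clock_psiR hadm hgen hk, smul_smul]

theorem ell_one_one_psiR (P : Params) (R : Roots) (k : ℕ) (lam : ℂ) (σ : ZMod 2) :
    ell P k lam 1 1 *ᵥ psiR P R k σ = (lam * P.a k * P.c k) • psiR P R k σ
      + (P.b k * P.d k / P.κ k) • psiR P R k (σ + 1) := by
  have e : ell P k lam 1 1 = (lam * P.a k * P.c k) • 1 + (P.b k * P.d k / P.κ k) • v1 := rfl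
  rw [e, add_mulVec, smul_mulVec, smul_mulVec, one_mulVec, v1_psiR]

/-- The coefficient of a single product vector in the eigenvalue equation for B. The product in the
new eigenvalue has degree `i + 1`; interpolating it at the `i` zeros of `ρ'` leaves one equation at
each zero, one at 0 and one at infinity, and these are the three kernel equations. -/
theorem kernelR_eigB (hadm : IsAdmissible P R n) (hgen : IsGeneric P R n) (hi : i + 2 ≤ n)
    (ρ' : Spins (i + 1)) (σ : ZMod 2) (ρ : Spins (i + 2)) (lam : ℂ) :
    lam * (R.rs (i + 2) * sgn σ) * ((∏ s, (1 - lam / node R i (Fin.tail ρ') s))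
          * kernelR P R i ρ' σ ρ
        + (lam * (∏ s, (lam - node R i (Fin.tail ρ') s)) * ∏ k ∈ Ico 1 (i + 2), P.κ k)
          * kernelR P R i (flip ρ' 0) σ ρ
        + ∑ k, (nodeFn (node R i (flip (Fin.tail ρ') k)) k lam * phi P R i (flip (Fin.tail ρ') k) k)
          * kernelR P R i (flip ρ' k.succ) σ ρ)
      + eigB R i ρ' lam * ((lam * P.a (i + 2) * P.c (i + 2)) * kernelR P R i ρ' σ ρ
        + (P.b (i + 2) * P.d (i + 2) / P.κ (i + 2)) * kernelR P R i ρ' (σ + 1) ρ)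
      = eigB R (i + 1) ρ lam * kernelR P R i ρ' σ ρ := by
  have hS := sameLevel hadm hgen (show i + 1 ≤ n by omega)
  have h0 := kernelR_const hadm hgen hi ρ' σ ρ
  have h1 := kernelR_leading hadm hgen hi ρ' σ ρ
  have h2 := (isPoly_prod_sub (node R (i + 1) (Fin.tail ρ))).interpolation
    (node R i (Fin.tail ρ')) (hS.node_injective _) (hS.node_ne_zero _) lam
  have h3 : R.rs (i + 2) * sgn σ * ∑ k, (nodeFn (node R i (flip (Fin.tail ρ') k)) k lam
          * phi P R i (flip (Fin.tail ρ') k) k) * kernelR P R i (flip ρ' k.succ) σ ρ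
      = R.r (i + 2) 0 * sgn (ρ 0) * kernelR P R i ρ' σ ρ * ∑ k, nodeFn (node R i (Fin.tail ρ')) k lam
        * ∏ j, (node R i (Fin.tail ρ') k - node R (i + 1) (Fin.tail ρ) j) := by
    rw [mul_sum, mul_sum]
    refine sum_congr rfl fun k _ => ?_
    have h := kernelR_node_left hadm hgen hi ρ' σ ρ k
    rw [nodeFn_flip R i _ k lam (hS.node_ne _ k)]
    linear_combination (nodeFn (node R i (Fin.tail ρ')) k lam) * h
  have h4 := prod_sub_node hS (Fin.tail ρ') lam
  have h5 := prod_neg_node R i ρ'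
  have h6 := prod_neg_node R (i + 1) ρ
  simp only [smul_eq_mul] at h2
  simp only [eigB]
  rw [h2]
  linear_combination lam * h3
    + lam * (∏ s, (1 - lam / node R i (Fin.tail ρ') s)) * h0
    + lam * (lam * ∏ s, (lam - node R i (Fin.tail ρ') s)) * h1
    - lam * (∏ s, (1 - lam / node R i (Fin.tail ρ') s)) * kernelR P R i ρ' σ ρ * h6
    + lam * R.r (i + 1) 0 * sgn (ρ' 0) * (P.b (i + 2) * P.d (i + 2) / P.κ (i + 2))
      * kernelR P R i ρ' (σ + 1) ρ * h4
    + lam * (∏ s, (1 - lam / node R i (Fin.tail ρ') s))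
      * (P.b (i + 2) * P.d (i + 2) / P.κ (i + 2)) * kernelR P R i ρ' (σ + 1) ρ * h5

theorem sum_kernel_flip {E : Type*} [AddCommGroup E] [Module ℂ E] (k : Fin (i + 1))
    (c : Spins (i + 1) → ℂ) (T : Spins (i + 1) → E) :
    ∑ ρ', c ρ' • T (flip ρ' k) = ∑ ρ', c (flip ρ' k) • T ρ' := by
  rw [← sum_flip_equiv k]
  simp only [flip_flip]

theorem IsSystem.B_succ (h : IsSystem P R i) (hadm : IsAdmissible P R n) (hgen : IsGeneric P R n)
    (hi : i + 2 ≤ n) (ρ : Spins (i + 2)) (lam : ℂ) :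
    monodromy P (i + 2) lam 0 1 *ᵥ PsiR P R (i + 1) ρ
      = eigB R (i + 1) ρ lam • PsiR P R (i + 1) ρ := by
  have hS := sameLevel hadm hgen (show i + 1 ≤ n by omega)
  have hk : i + 2 ∈ Icc 1 n := by rw [mem_Icc]; omega
  set T : ZMod 2 → Spins (i + 1) → Spins (i + 2) → ℂ :=
    fun σ ρ' => tens (PsiR P R i ρ') (psiR P R (i + 2) σ) with hT
  have e1 : ∀ ρ' σ, monodromy P (i + 2) lam 0 1 *ᵥ T σ ρ'
      = (lam * (R.rs (i + 2) * sgn σ)) • ((∏ s, (1 - lam / node R i (Fin.tail ρ') s)) • T σ ρ'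
        + (lam * (∏ s, (lam - node R i (Fin.tail ρ') s)) * ∏ k ∈ Ico 1 (i + 2), P.κ k)
          • T σ (flip ρ' 0)
        + ∑ k, (nodeFn (node R i (Fin.tail ρ')) k lam * phi P R i (Fin.tail ρ') k)
          • T σ (flip ρ' k.succ))
        + eigB R i ρ' lam • ((lam * P.a (i + 2) * P.c (i + 2)) • T σ ρ'
          + (P.b (i + 2) * P.d (i + 2) / P.κ (i + 2)) • T (σ + 1) ρ') := by
    intro ρ' σ
    rw [monodromy_succ, add_mulVec, hT]
    simp only [kr_mulVec]
    rw [h.A_interpolation hS, ell_zero_one_psiR hadm hgen hk, h.B_apply, ell_one_one_psiR]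
    simp only [tens_smul_right, tens_smul_left, tens_add_left, tens_add_right, tens_sum_left]
    rw [smul_add (eigB R i ρ' lam), smul_comm (eigB R i ρ' lam), smul_comm (eigB R i ρ' lam)]
  have e2 : ∀ ρ, PsiR P R (i + 1) ρ = ∑ σ, ∑ ρ', kernelR P R i ρ' σ ρ • T σ ρ' := fun ρ => by
    rw [PsiR_succ, sum_comm]
  rw [e2, mulVec_sum, smul_sum]
  simp only [mulVec_sum, mulVec_smul, e1, smul_sum, smul_add, smul_smul, sum_add_distrib]
  have f1 : ∀ σ, ∑ ρ', (kernelR P R i ρ' σ ρ * (lam * (R.rs (i + 2) * sgn σ)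
        * (lam * (∏ s, (lam - node R i (Fin.tail ρ') s)) * ∏ k ∈ Ico 1 (i + 2), P.κ k)))
          • T σ (flip ρ' 0)
      = ∑ ρ', (kernelR P R i (flip ρ' 0) σ ρ * (lam * (R.rs (i + 2) * sgn σ)
        * (lam * (∏ s, (lam - node R i (Fin.tail ρ') s)) * ∏ k ∈ Ico 1 (i + 2), P.κ k)))
          • T σ ρ' := fun σ => by
    rw [sum_kernel_flip]; simp only [tail_flip_zero]
  have f2 : ∀ σ, ∑ ρ', ∑ k : Fin i, (kernelR P R i ρ' σ ρ * (lam * (R.rs (i + 2) * sgn σ)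
        * (nodeFn (node R i (Fin.tail ρ')) k lam * phi P R i (Fin.tail ρ') k)))
          • T σ (flip ρ' k.succ)
      = ∑ ρ', ∑ k : Fin i, (kernelR P R i (flip ρ' k.succ) σ ρ * (lam * (R.rs (i + 2) * sgn σ)
        * (nodeFn (node R i (flip (Fin.tail ρ') k)) k lam * phi P R i (flip (Fin.tail ρ') k) k)))
          • T σ ρ' := fun σ => by
    rw [sum_comm, sum_comm (s := univ (α := Spins (i + 1)))]
    refine sum_congr rfl fun k _ => ?_
    rw [sum_kernel_flip]; simp only [tail_flip_succ]
  have f3 : ∑ σ, ∑ ρ', (kernelR P R i ρ' σ ρ * (eigB R i ρ' lam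
        * (P.b (i + 2) * P.d (i + 2) / P.κ (i + 2)))) • T (σ + 1) ρ'
      = ∑ σ, ∑ ρ', (kernelR P R i ρ' (σ + 1) ρ * (eigB R i ρ' lam
        * (P.b (i + 2) * P.d (i + 2) / P.κ (i + 2)))) • T σ ρ' := by
    rw [← sum_add_one]
    simp only [add_one_add_one]
  simp only [f1, f2, f3, ← sum_add_distrib, ← sum_smul, ← add_smul]
  refine sum_congr rfl fun σ _ => sum_congr rfl fun ρ' _ => ?_
  congr 1
  rw [← kernelR_eigB hadm hgen hi]
  simp only [mul_add, mul_sum]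
  -- The two sums are compared term by term; `f` and `f'` do not occur in them and receive the value
  -- 0.
  have : ∀ a b c d e f a' b' c' d' e' f' : ℂ, a = a' → b = b' → c = c' → d = d' → e = e' →
    a + b + c + (d + e) = a' + b' + c' + (d' + e') := by
    intros; subst_vars; rfl
  refine this _ _ _ _ _ 0 _ _ _ _ _ 0 (by ring) (by ring)
    (sum_congr rfl fun k _ => by ring) (by ring) (by ring)

theorem IsSystem.A_succ (h : IsSystem P R i) (hadm : IsAdmissible P R n) (hgen : IsGeneric P R n)
    (hi : i + 2 ≤ n) (ρ : Spins (i + 2)) (k : Fin (i + 1)) :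
    monodromy P (i + 2) (node R (i + 1) (Fin.tail ρ) k) 0 0 *ᵥ PsiR P R (i + 1) ρ
      = phi P R (i + 1) (Fin.tail ρ) k • PsiR P R (i + 1) (flip ρ k.succ) := by
  have hS := sameLevel hadm hgen (show i + 1 + 1 ≤ n by omega)
  have hk : i + 2 ∈ Icc 1 n := by rw [mem_Icc]; omega
  have hB := h.B_succ hadm hgen hi ρ (node R (i + 1) (Fin.tail ρ) k)
  have hE : eigB R (i + 1) ρ (node R (i + 1) (Fin.tail ρ) k) = 0 := by
    rw [eigB, prod_eq_zero (mem_univ k) (sub_self _), mul_zero]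
  have hm := congrArg (fun M => M *ᵥ PsiR P R (i + 1) ρ) (monodromy_elimination hadm hgen
    (show i + 1 + 1 ≤ n by omega) (node R (i + 1) (Fin.tail ρ) k))
  have hK := kernelR_node_right hadm hgen hi (ρ := ρ) (k := k)
  have hl := hS.node_ne_zero (Fin.tail ρ) k
  have hr := hgen.rs_ne _ hk
  simp only [sub_mulVec, ← mulVec_mulVec, smul_mulVec] at hm
  rw [hB, hE, zero_smul, mulVec_zero, zero_sub, PsiR_succ] at hm
  set lam := node R (i + 1) (Fin.tail ρ) k with hlam
  rw [PsiR_succ P R i (flip ρ k.succ)]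
  -- The elimination identity determines A only after multiplication by this non-zero scalar.
  have hne : lam * R.rs (i + 2) ^ 2 ≠ 0 := mul_ne_zero hl (pow_ne_zero _ hr)
  apply smul_right_injective _ hne
  simp only []
  rw [← PsiR_succ] at hm
  rw [hm, PsiR_succ]
  simp only [mulVec_sum, mulVec_smul, kr_mulVec, h.B_apply]
  have e : ∀ σ, (clock P (i + 1 + 1) * v1) *ᵥ psiR P R (i + 2) σ
      = (R.rs (i + 2) * sgn (σ + 1)) • psiR P R (i + 2) (σ + 1) := fun σ => by
    rw [← mulVec_mulVec, v1_psiR, clock_psiR hadm hgen hk]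
  simp only [e, tens_smul_left, tens_smul_right, smul_sum, smul_smul]
  rw [← sum_neg_distrib]
  refine sum_congr rfl fun ρ' _ => ?_
  rw [← sum_add_one, ← sum_neg_distrib]
  refine sum_congr rfl fun σ _ => ?_
  rw [add_one_add_one, ← neg_smul]
  congr 1
  have hK := hK ρ' σ
  rw [← hK, eigB]
  field_simp

theorem isSystem (hadm : IsAdmissible P R n) (hgen : IsGeneric P R n) (hi : i + 1 ≤ n) :
    IsSystem P R i := by
  induction i with
  | zero => exact isSystem_zero hadm hgen hi
  | succ i ih =>
    have h := ih (by omega)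
    exact ⟨h.B_succ hadm hgen hi, h.V_succ, h.A_succ hadm hgen hi⟩

/-! ### Biorthogonality -/

/-- Equal eigenvalues have equal zeros. As the squares of the zeros are distinct for distinct
indices, each zero determines its index and then its sign. The value at a point off the zeros
determines the zero mode. -/
theorem exists_eigB_ne (hadm : IsAdmissible P R n) (hgen : IsGeneric P R n) (hi : i + 1 ≤ n)
    {ρ ρ' : Spins (i + 1)} (h : ρ ≠ ρ') : ∃ lam, eigB R i ρ lam ≠ eigB R i ρ' lam := by
  by_contra! hall
  apply h
  have hS := sameLevel hadm hgen hi
  have hr := hgen.r_ne (i + 1) (by rw [mem_Icc]; omega) 0 (by simp)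
  have ht : Fin.tail ρ = Fin.tail ρ' := by
    funext k
    have h1 := hall (node R i (Fin.tail ρ) k)
    have h2 : eigB R i ρ (node R i (Fin.tail ρ) k) = 0 := by
      rw [eigB, prod_eq_zero (mem_univ k) (sub_self _), mul_zero]
    rw [h2, eigB] at h1
    have h3 := (mul_eq_zero.1 h1.symm).resolve_left (mul_ne_zero (mul_ne_zero
      (hS.node_ne_zero _ _) hr) (sgn_ne_zero _))
    obtain ⟨j, -, hj⟩ := prod_eq_zero_iff.1 h3
    have hj' := sub_eq_zero.1 hj
    have hkj : k = j := by
      by_contra hkj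
      exact hS.node_sq_ne (Fin.tail ρ) (Fin.tail ρ') hkj (by rw [hj'])
    subst hkj
    exact sgn_injective (mul_right_cancel₀ (hS.r_ne k) (neg_injective hj'))
  obtain ⟨lam, hlam⟩ := Infinite.exists_notMem_finset
    (insert 0 (univ.image (node R i (Fin.tail ρ))))
  simp only [mem_insert, mem_image, mem_univ, true_and, not_or, not_exists] at hlam
  have h1 := hall lam
  rw [eigB, eigB, ← ht] at h1
  have h2 : ∏ k, (lam - node R i (Fin.tail ρ) k) ≠ 0 :=
    prod_ne_zero_iff.2 fun k _ => sub_ne_zero.2 fun e => hlam.2 k e.symm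
  have h3 := mul_left_cancel₀ (mul_ne_zero hlam.1 hr) (mul_right_cancel₀ h2 h1)
  have h4 : ρ 0 = ρ' 0 := sgn_injective h3
  funext k
  exact Fin.cases h4 (fun k => congrFun ht k) k

/-- The finitely many differences of eigenvalue polynomials are non-zero, so their product is
non-zero at some λ. -/
theorem exists_eigB_injective (hadm : IsAdmissible P R n) (hgen : IsGeneric P R n)
    (hi : i + 1 ≤ n) : ∃ lam, Function.Injective fun ρ => eigB R i ρ lam := by
  classical
  open Polynomial in
  let p : Spins (i + 1) → Polynomial ℂ := fun ρ =>
    X * C (R.r (i + 1) 0) * C (sgn (ρ 0)) * ∏ k, (X - C (node R i (Fin.tail ρ) k))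
  have hp : ∀ ρ lam, (p ρ).eval lam = eigB R i ρ lam := fun ρ lam => by
    simp only [p, eigB, eval_mul, eval_X, eval_C, eval_prod, eval_sub]
  let D : Polynomial ℂ := ∏ x ∈ (univ : Finset (Spins (i + 1) × Spins (i + 1))).filter
    (fun x => x.1 ≠ x.2), (p x.1 - p x.2)
  have hD : D ≠ 0 := by
    refine prod_ne_zero_iff.2 fun x hx => ?_
    simp only [mem_filter, mem_univ, true_and] at hx
    obtain ⟨lam, hlam⟩ := exists_eigB_ne hadm hgen hi hx
    intro h0
    apply hlam
    rw [← hp, ← hp, sub_eq_zero.1 h0]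
  obtain ⟨lam, hlam⟩ : ∃ lam, D.eval lam ≠ 0 := by
    by_contra! h
    exact hD (Polynomial.funext fun x => by rw [h x, eval_zero])
  refine ⟨lam, fun ρ ρ' h => ?_⟩
  by_contra hne
  apply hlam
  rw [eval_prod]
  refine prod_eq_zero (i := (ρ, ρ')) (by simpa using hne) ?_
  rw [eval_sub, hp, hp]
  exact sub_eq_zero.2 h

theorem eigB_conj (R : Roots) (i : ℕ) : eigB R.conj i = eigB R i := rfl

theorem dotProduct_mulVec_conj (P : Params) (m : ℕ) (lam : ℂ) (x y : Fin 2)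
    (f g : Spins m → ℂ) :
    f ⬝ᵥ (monodromy P m lam x y *ᵥ g) = (monodromy P.conj m lam x y *ᵥ f) ⬝ᵥ g := by
  rw [dotProduct_mulVec, monodromy_conj, mulVec_transpose]

/-- The pairing of the eigenvectors of `B` with those of the transposed model. -/
def pairing (P : Params) (R : Roots) (i : ℕ) (ρ : Spins (i + 1)) : ℂ :=
  PsiR P.conj R.conj i ρ ⬝ᵥ PsiR P R i ρ

theorem dotProduct_PsiR_of_ne (hadm : IsAdmissible P R n) (hgen : IsGeneric P R n)
    (hi : i + 1 ≤ n) {ρ ρ' : Spins (i + 1)} (h : ρ ≠ ρ') :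
    PsiR P.conj R.conj i ρ ⬝ᵥ PsiR P R i ρ' = 0 := by
  obtain ⟨lam, hlam⟩ := exists_eigB_ne hadm hgen hi h
  have e := dotProduct_mulVec_conj P (i + 1) lam 0 1 (PsiR P.conj R.conj i ρ) (PsiR P R i ρ')
  rw [(isSystem hadm hgen hi).B_apply, (isSystem hadm.conj hgen.conj hi).B_apply,
    dotProduct_smul, smul_dotProduct, eigB_conj, smul_eq_mul, smul_eq_mul] at e
  by_contra h0
  exact hlam (mul_right_cancel₀ h0 e.symm)

theorem dotProduct_PsiR (hadm : IsAdmissible P R n) (hgen : IsGeneric P R n)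
    (hi : i + 1 ≤ n) (ρ ρ' : Spins (i + 1)) :
    PsiR P.conj R.conj i ρ ⬝ᵥ PsiR P R i ρ' = if ρ = ρ' then pairing P R i ρ else 0 := by
  split_ifs with h
  · rw [← h]; rfl
  · exact dotProduct_PsiR_of_ne hadm hgen hi h

/-- Non-zero eigenvectors for distinct eigenvalues are independent, and there are as many of them as
the dimension. If the pairing vanished, the left vector would be orthogonal to the whole basis. -/
theorem pairing_ne_zero_of_PsiR_ne_zero (hadm : IsAdmissible P R n) (hgen : IsGeneric P R n)
    (hi : i + 1 ≤ n) (hR : ∀ ρ, PsiR P R i ρ ≠ 0) (hL : ∀ ρ, PsiR P.conj R.conj i ρ ≠ 0)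
    (ρ : Spins (i + 1)) : pairing P R i ρ ≠ 0 := by
  obtain ⟨lam, hlam⟩ := exists_eigB_injective hadm hgen hi
  have hli : LinearIndependent ℂ (PsiR P R i) :=
    Module.End.eigenvectors_linearIndependent' (Matrix.mulVecLin (monodromy P (i + 1) lam 0 1))
      (fun ρ => eigB R i ρ lam) hlam _ fun ρ => by
        refine ⟨?_, hR ρ⟩
        rw [Module.End.mem_eigenspace_iff, mulVecLin_apply]
        exact (isSystem hadm hgen hi).B_apply ρ lam
  have hspan := hli.span_eq_top_of_card_eq_finrank' (by simp)
  intro h0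
  apply hL ρ
  have hz : ∀ v, PsiR P.conj R.conj i ρ ⬝ᵥ v = 0 := by
    intro v
    have hv : v ∈ Submodule.span ℂ (Set.range (PsiR P R i)) := by rw [hspan]; trivial
    induction hv using Submodule.span_induction with
    | mem x hx =>
      obtain ⟨ρ', rfl⟩ := hx
      rw [dotProduct_PsiR hadm hgen hi, h0, ite_self]
    | zero => simp
    | add x y _ _ hx hy => rw [dotProduct_add, hx, hy, add_zero]
    | smul a x _ hx => rw [dotProduct_smul, hx, smul_zero]
  exact dotProduct_eq_zero _ hz

theorem psiR_conj_dotProduct (hadm : IsAdmissible P R n) (hgen : IsGeneric P R n) {k : ℕ}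
    (hk : k ∈ Icc 1 n) (σ τ : ZMod 2) :
    psiR P.conj R.conj k σ ⬝ᵥ psiR P R k τ
      = if σ = τ then 2 * R.rs k / (P.a k + R.rs k) else 0 := by
  have ha := hgen.a_ne k hk
  have h := (onCurve_psiR hadm hgen hk).one_add_ne
  have h' : P.a k + R.rs k ≠ 0 := by
    intro h0; apply h; simp only []; field_simp; rw [h0, mul_zero]
  have hr := hadm.rs_sq k hk
  obtain rfl | rfl := zmod_two_cases σ <;> obtain rfl | rfl := zmod_two_cases τ <;>
    simp [psiR, dotProduct, sum_zmod_two, w_zero, w_one, Params.conj, Roots.conj,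
      show (-1 : ZMod 2) = 1 from rfl] <;> field_simp <;>
    first | ring1 | linear_combination hr | linear_combination -hr

theorem add_rs_ne_zero (hadm : IsAdmissible P R n) (hgen : IsGeneric P R n) {k : ℕ}
    (hk : k ∈ Icc 1 n) : P.a k + R.rs k ≠ 0 := by
  intro h0
  apply (onCurve_psiR hadm hgen hk).one_add_ne
  have ha := hgen.a_ne k hk
  simp only []
  field_simp
  rw [h0, mul_zero]

theorem kOne_ne_zero (hadm : IsAdmissible P R n) (hgen : IsGeneric P R n) (hi : i + 2 ≤ n)
    (τ : Fin i → ZMod 2) : kOne P R i τ ≠ 0 :=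
  prod_ne_zero_iff.2 fun l _ =>
    have hm : i + 1 ∈ Ico 1 n := by rw [mem_Ico]; omega
    have hl : (l : ℕ) + 1 ∈ Ico 1 (i + 1) := by rw [mem_Ico]; omega
    div_ne_zero ((onCurve_pt1 hadm hgen hm hl).w_ne _) ((onCurve_pt1Tilde hadm hgen hm hl).w_ne _)

theorem kernelR_ne_zero (hadm : IsAdmissible P R n) (hgen : IsGeneric P R n) (hi : i + 2 ≤ n)
    (ρ' : Spins (i + 1)) (σ : ZMod 2) (ρ : Spins (i + 2)) : kernelR P R i ρ' σ ρ ≠ 0 := by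
  rw [kernelR_eq]
  refine mul_ne_zero (mul_ne_zero ?_ (div_ne_zero ?_ ?_)) (kOne_ne_zero hadm hgen hi _)
  · exact div_ne_zero (sgn_ne_zero _) (mul_ne_zero ((onCurve_pt0 hadm hgen hi).w_ne _)
      ((onCurve_ptTilde hadm hgen hi).w_ne _))
  · exact prod_ne_zero_iff.2 fun l _ => prod_ne_zero_iff.2 fun k _ =>
      (onCurve_next hadm hgen hi l k).w_ne _
  · exact (sameLevel hadm hgen (show i + 1 ≤ n by omega)).offWeight_ne_zero _

theorem PsiR_ne_zero (hadm : IsAdmissible P R n) (hgen : IsGeneric P R n) (hi : i + 1 ≤ n)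
    (ρ : Spins (i + 1)) : PsiR P R i ρ ≠ 0 := by
  -- The induction hypothesis is also needed for the transposed model.
  induction i generalizing P R with
  | zero =>
    intro h
    have := congrFun h ρ
    simp [PsiR, psiR, w_zero] at this
  | succ i ih =>
    intro h
    have hk : i + 2 ∈ Icc 1 n := by rw [mem_Icc]; omega
    have hN := pairing_ne_zero_of_PsiR_ne_zero hadm hgen (show i + 1 ≤ n by omega)
      (ih hadm hgen (by omega)) (ih hadm.conj hgen.conj (by omega)) 0
    -- By biorthogonality on the shorter chain and on the last site, pairing with this product
    -- vector isolates a single kernel coefficient, which is non-zero.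
    have h1 : tens (PsiR P.conj R.conj i 0) (psiR P.conj R.conj (i + 2) 0)
        ⬝ᵥ PsiR P R (i + 1) ρ = 0 := by rw [h, dotProduct_zero]
    rw [PsiR_succ, dotProduct_sum] at h1
    simp only [dotProduct_sum, dotProduct_smul, tens_dotProduct,
      dotProduct_PsiR hadm hgen (show i + 1 ≤ n by omega), psiR_conj_dotProduct hadm hgen hk] at h1
    simp only [ite_mul, zero_mul, mul_ite, mul_zero, smul_eq_mul, sum_ite_eq, mem_univ,
      if_true] at h1
    have hr := hgen.rs_ne _ hk
    refine (mul_ne_zero (kernelR_ne_zero hadm hgen hi 0 0 ρ) (mul_ne_zero hN (div_ne_zero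
      (mul_ne_zero two_ne_zero hr) (add_rs_ne_zero hadm hgen hk)))) h1

theorem pairing_ne_zero (hadm : IsAdmissible P R n) (hgen : IsGeneric P R n) (hi : i + 1 ≤ n)
    (ρ : Spins (i + 1)) : pairing P R i ρ ≠ 0 :=
  pairing_ne_zero_of_PsiR_ne_zero hadm hgen hi (PsiR_ne_zero hadm hgen hi)
    (PsiR_ne_zero hadm.conj hgen.conj hi) ρ

/-! ### Behaviour of the pairings under flips -/

theorem pairing_flip_zero (hadm : IsAdmissible P R n) (hgen : IsGeneric P R n) (hi : i + 1 ≤ n)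
    (ρ : Spins (i + 1)) : pairing P R i (flip ρ 0) = pairing P R i ρ := by
  rw [pairing, ← (isSystem hadm hgen hi).V_apply, ← (isSystem hadm.conj hgen.conj hi).V_apply,
    dotProduct_mulVec, ← mulVec_transpose, VOp_transpose, mulVec_mulVec, VOp_mul_self, one_mulVec]
  rfl

theorem F_conj (P : Params) (m : ℕ) (lam : ℂ) : F P.conj m lam = F P m (-lam) := by
  simp only [F, Params.conj]
  ring

theorem F_ne_zero (hgen : IsGeneric P R n) (hi : i + 1 ≤ n)
    (τ : Fin i → ZMod 2) (k : Fin i) : F P (i + 1) (-node R i τ k) ≠ 0 := by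
  have hI : i + 1 ∈ Icc 1 n := by rw [mem_Icc]; omega
  have hl : (k : ℕ) + 1 ∈ Ico 1 (i + 1) := by rw [mem_Ico]; omega
  have h1 := hgen.one_ne _ hI _ hl
  have h2 := hgen.tilde_ne _ hI _ hl
  have hb := hgen.b_ne _ hI
  have hc := hgen.c_ne _ hI
  have hκ := hgen.κ_ne _ hI
  have hr := hgen.r_ne _ hI (k + 1) (by rw [mem_range]; omega)
  have s1 := sgn_sq (τ k)
  simp only [pt1, pt1Tilde] at h1 h2
  simp only [node, neg_neg, F]
  refine mul_ne_zero (fun h0 => h1 ?_) (fun h0 => h2 ?_)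
  · have : P.a (i + 1) * P.κ (i + 1) * R.r (i + 1) (k + 1) = P.b (i + 1) * sgn (τ k) := by
      linear_combination (-sgn (τ k)) * h0 - P.a (i + 1) * P.κ (i + 1) * R.r (i + 1) (k + 1) * s1
    rw [this, mul_div_cancel_left₀ _ hb, s1]
  · have : P.d (i + 1) = -sgn (τ k) * (P.κ (i + 1) * P.c (i + 1) * R.r (i + 1) (k + 1)) := by
      field_simp at h0
      linear_combination h0
    rw [this, mul_div_assoc, div_self (mul_ne_zero (mul_ne_zero hκ hc) hr), mul_one, neg_sq, s1]

theorem phi_ne_zero (hadm : IsAdmissible P R n) (hgen : IsGeneric P R n) (hi : i + 1 ≤ n)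
    (τ : Fin i → ZMod 2) (k : Fin i) : phi P R i τ k ≠ 0 := by
  refine mul_ne_zero (mul_ne_zero (mul_ne_zero (neg_ne_zero.2 (div_ne_zero
    (F_ne_zero hgen hi τ k) (hgen.rs_ne _ (by rw [mem_Icc]; omega)))) (hgen.rt_ne (by omega)))
    (prod_ne_zero_iff.2 fun l hl => ?_)) (prod_ne_zero_iff.2 fun s _ => sgn_ne_zero _)
  rw [mem_Ico] at hl
  exact (onCurve_pt2_next hadm hgen (m := i) (l := l) (k := k + 1) (by rw [mem_Ico]; omega)
    (by rw [mem_Ico]; omega) (by rw [mem_Ico]; omega)).2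

/-- Transposition replaces `F` at λ by `F` at -λ, which compensates the change of sign of the node.
Only the product of the signs of the spins changes. -/
theorem phi_conj_flip (P : Params) (R : Roots) (i : ℕ) (τ : Fin i → ZMod 2) (k : Fin i) :
    phi P.conj R.conj i (flip τ k) k = -phi P R i τ k := by
  have h : node R.conj i = node R i := rfl
  have h1 : R.conj.rt = R.rt := rfl
  have h2 : R.conj.y₂ = R.y₂ := rfl
  have h3 : R.conj.rs = R.rs := rfl
  simp only [phi, h, h1, h2, h3, node_flip_same, neg_neg, F_conj, prod_sgn_flip]
  ring

theorem nodeFn_self {i : ℕ} {ℓ : Fin i → ℂ} (hℓ : Function.Injective ℓ) (k : Fin i)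
    (h0 : ℓ k ≠ 0) : nodeFn ℓ k (ℓ k) = 1 := by
  rw [nodeFn, div_self h0, one_mul]
  refine prod_eq_one fun s hs => div_self (sub_ne_zero.2 fun e => ?_)
  simp only [mem_erase, mem_univ, and_true] at hs
  exact hs (hℓ e).symm

theorem flip_ne_self (ρ : Spins n) (k : Fin n) : flip ρ k ≠ ρ := by
  intro h
  have := congrFun h k
  rw [flip_same] at this
  simp at this

theorem flip_eq_flip_iff (ρ : Spins n) (k j : Fin n) : flip ρ k = flip ρ j ↔ k = j := by
  refine ⟨fun h => ?_, fun h => h ▸ rfl⟩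
  by_contra hne
  have := congrFun h k
  rw [flip_same, flip_of_ne ρ hne] at this
  simp at this

theorem dotProduct_monodromy_A (hadm : IsAdmissible P R n) (hgen : IsGeneric P R n)
    (hi : i + 1 ≤ n) (ρ : Spins (i + 1)) (k : Fin i) (lam : ℂ) :
    PsiR P.conj R.conj i (flip ρ k.succ) ⬝ᵥ (monodromy P (i + 1) lam 0 0 *ᵥ PsiR P R i ρ)
      = nodeFn (node R i (Fin.tail ρ)) k lam * phi P R i (Fin.tail ρ) k
        * pairing P R i (flip ρ k.succ) := by
  rw [(isSystem hadm hgen hi).A_interpolation (sameLevel hadm hgen hi), dotProduct_add,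
    dotProduct_add, dotProduct_smul, dotProduct_smul, dotProduct_sum]
  simp only [dotProduct_smul, dotProduct_PsiR hadm hgen hi, flip_ne_self, flip_eq_flip_iff,
    Fin.succ_ne_zero, if_false, smul_eq_mul, mul_zero, zero_add, Fin.succ_inj, mul_ite, sum_ite_eq, mem_univ,
    if_true]

/-- The matrix element of A between the labels `flip ρ k.succ` and `ρ` is computed twice, with A
acting to the right and, through the transposed model, to the left. The amplitudes `phi` agree up to
a sign, so the ratio of the pairings is the ratio of the interpolation coefficients. -/
theorem pairing_flip_succ (hadm : IsAdmissible P R n) (hgen : IsGeneric P R n) (hi : i + 1 ≤ n)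
    (ρ : Spins (i + 1)) (k : Fin i) :
    pairing P R i (flip ρ k.succ) = (∏ s ∈ univ.erase k,
      (node R i (Fin.tail ρ) k - node R i (Fin.tail ρ) s)
        / (-node R i (Fin.tail ρ) k - node R i (Fin.tail ρ) s)) * pairing P R i ρ := by
  have hS := sameLevel hadm hgen hi
  have h1 := dotProduct_monodromy_A hadm hgen hi ρ k (node R i (Fin.tail ρ) k)
  have h2 := dotProduct_monodromy_A hadm.conj hgen.conj hi (flip ρ k.succ) k
    (node R i (Fin.tail ρ) k)
  have hcc : P.conj.conj = P := by simp [Params.conj]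
  have hcc' : R.conj.conj = R := by simp [Roots.conj]
  have hn : node R.conj i = node R i := rfl
  rw [dotProduct_mulVec_conj, dotProduct_comm] at h2
  rw [hcc, hcc', flip_flip, h1, nodeFn_self (hS.node_injective _) k (hS.node_ne_zero _ k),
    tail_flip_succ, phi_conj_flip, hn, nodeFn_flip R i _ k _ (hS.node_ne _ k),
    nodeFn_self (hS.node_injective _) k (hS.node_ne_zero _ k)] at h2
  have h3 : pairing P.conj R.conj i ρ = pairing P R i ρ := by
    rw [pairing, pairing, hcc, hcc', dotProduct_comm]
  rw [h3] at h2
  apply mul_left_cancel₀ (phi_ne_zero hadm hgen hi (Fin.tail ρ) k)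
  linear_combination h2

/-! ### The action of the transfer matrix -/

theorem flip_cons_zero (z : ZMod 2) (τ : Fin i → ZMod 2) :
    flip (Fin.cons z τ : Spins (i + 1)) 0 = Fin.cons (z + 1) τ := by
  funext j
  refine Fin.cases ?_ (fun j => ?_) j
  · rw [flip_same]; rfl
  · rw [flip_of_ne _ (Fin.succ_ne_zero j)]; rfl

theorem flip_cons_succ (z : ZMod 2) (τ : Fin i → ZMod 2) (k : Fin i) :
    flip (Fin.cons z τ : Spins (i + 1)) k.succ = Fin.cons z (flip τ k) := by
  funext j
  refine Fin.cases ?_ (fun j => ?_) j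
  · rw [flip_of_ne _ (Fin.succ_ne_zero k).symm]; rfl
  · by_cases h : j = k
    · subst h; rw [flip_same]; simp [flip_same]
    · rw [flip_of_ne _ (by simpa using h)]; simp [flip_of_ne τ h]

theorem PsiTildeR_eq (P : Params) (R : Roots) (i : ℕ) (ρ : ZMod 2) (τ : Fin i → ZMod 2) :
    PsiTildeR P R i ρ τ = ∑ z, sgn (ρ * z) • PsiR P R i (Fin.cons z τ) := by
  simp only [PsiTildeR, sgn_neg]

theorem sum_sgn_add_one {E : Type*} [AddCommGroup E] [Module ℂ E] (ρ : ZMod 2) (f : ZMod 2 → E) :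
    ∑ z, sgn (ρ * z) • f (z + 1) = sgn ρ • ∑ z, sgn (ρ * z) • f z := by
  rw [← sum_add_one (fun z => sgn (ρ * z) • f z), smul_sum]
  refine sum_congr rfl fun z _ => ?_
  rw [smul_smul, mul_add, mul_one, sgn_add, mul_comm (sgn (ρ * z)), ← mul_assoc, sgn_mul_self,
    one_mul]

theorem VOp_PsiTildeR (hadm : IsAdmissible P R n) (hgen : IsGeneric P R n) (hi : i + 1 ≤ n)
    (ρ : ZMod 2) (τ : Fin i → ZMod 2) :
    VOp (i + 1) *ᵥ PsiTildeR P R i ρ τ = sgn ρ • PsiTildeR P R i ρ τ := by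
  rw [PsiTildeR_eq, mulVec_sum]
  simp only [mulVec_smul, (isSystem hadm hgen hi).V_apply, flip_cons_zero]
  exact sum_sgn_add_one ρ (fun z => PsiR P R i (Fin.cons z τ))

theorem monodromy_A_PsiTildeR (hadm : IsAdmissible P R n) (hgen : IsGeneric P R n)
    (hi : i + 1 ≤ n) (ρ : ZMod 2) (τ : Fin i → ZMod 2) (k : Fin i) :
    monodromy P (i + 1) (node R i τ k) 0 0 *ᵥ PsiTildeR P R i ρ τ
      = phi P R i τ k • PsiTildeR P R i ρ (flip τ k) := by
  rw [PsiTildeR_eq, PsiTildeR_eq, mulVec_sum, smul_sum]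
  refine sum_congr rfl fun z _ => ?_
  have h := (isSystem hadm hgen hi).A_apply (Fin.cons z τ) k
  rw [Fin.tail_cons, flip_cons_succ] at h
  rw [mulVec_smul, h, smul_comm]

/-- The quantum determinant is applied to the vector with the flipped label: -λ is a zero of its
B-eigenvalue, so the term with C drops out, and A(-λ) leads back to the label `ρ`. -/
theorem monodromy_D_PsiR (hadm : IsAdmissible P R n) (hgen : IsGeneric P R n)
    (hi : i + 1 ≤ n) (ρ : Spins (i + 1)) (k : Fin i) :
    monodromy P (i + 1) (node R i (Fin.tail ρ) k) 1 1 *ᵥ PsiR P R i ρ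
      = ((∏ m ∈ Ico 1 (i + 2), F P m (node R i (Fin.tail ρ) k))
        / phi P R i (flip (Fin.tail ρ) k) k) • PsiR P R i (flip (flip ρ k.succ) 0) := by
  have hS := isSystem hadm hgen hi
  have hq := congrArg (fun M => M *ᵥ PsiR P R i (flip ρ k.succ)) (quantum_determinant P (i + 1)
    (fun k hk => hgen.κ_ne k (by simp only [mem_Icc] at hk ⊢; omega)) (node R i (Fin.tail ρ) k))
  have hA := hS.A_apply (flip ρ k.succ) k
  have hB := hS.B_apply (flip ρ k.succ) (-node R i (Fin.tail ρ) k)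
  have hE : eigB R i (flip ρ k.succ) (-node R i (Fin.tail ρ) k) = 0 := by
    rw [eigB, tail_flip_succ, prod_eq_zero (mem_univ k) (by rw [node_flip_same, sub_self]),
      mul_zero]
  rw [tail_flip_succ, node_flip_same, flip_flip] at hA
  rw [hE, zero_smul] at hB
  simp only [add_mulVec, ← mulVec_mulVec, hA, hB, mulVec_zero, add_zero, mulVec_smul, smul_mulVec,
    hS.V_apply] at hq
  have hp := phi_ne_zero hadm hgen hi (flip (Fin.tail ρ) k) k
  rw [div_eq_inv_mul, ← smul_smul, ← hq, smul_smul, inv_mul_cancel₀ hp, one_smul]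

theorem monodromy_D_PsiTildeR (hadm : IsAdmissible P R n) (hgen : IsGeneric P R n)
    (hi : i + 1 ≤ n) (ρ : ZMod 2) (τ : Fin i → ZMod 2) (k : Fin i) :
    monodromy P (i + 1) (node R i τ k) 1 1 *ᵥ PsiTildeR P R i ρ τ
      = ((∏ m ∈ Ico 1 (i + 2), F P m (node R i τ k)) / phi P R i (flip τ k) k * sgn ρ)
        • PsiTildeR P R i ρ (flip τ k) := by
  have h := sum_sgn_add_one ρ (fun z => PsiR P R i (Fin.cons z (flip τ k)))
  rw [PsiTildeR_eq, PsiTildeR_eq, mulVec_sum, ← smul_smul, ← h, smul_sum]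
  refine sum_congr rfl fun z _ => ?_
  have h := monodromy_D_PsiR hadm hgen hi (Fin.cons z τ) k
  rw [Fin.tail_cons, flip_cons_succ, flip_cons_zero] at h
  rw [mulVec_smul, h, smul_comm]

/-- The amplitude of the action of the transfer matrix at the zeros of the eigenvalues of `B`. -/
def tau (P : Params) (R : Roots) (i : ℕ) (ρ : ZMod 2) (τ : Fin i → ZMod 2) (k : Fin i) : ℂ :=
  phi P R i τ k + (∏ m ∈ Ico 1 (i + 2), F P m (node R i τ k)) / phi P R i (flip τ k) k * sgn ρ

/-- The constant term of the eigenvalues of the transfer matrix. -/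
def transferZero (P : Params) (i : ℕ) (ρ : ZMod 2) : ℂ :=
  1 + (∏ k ∈ Ico 1 (i + 2), (P.b k * P.d k / P.κ k)) * sgn ρ

/-- The leading coefficient of the eigenvalues of the transfer matrix. -/
def transferLeading (P : Params) (i : ℕ) (ρ : ZMod 2) : ℂ :=
  (∏ k ∈ Ico 1 (i + 2), P.κ k) * sgn ρ + ∏ k ∈ Ico 1 (i + 2), (P.a k * P.c k)

theorem isPoly_transfer_mulVec (P : Params) (i : ℕ) (ρ : ZMod 2) (v : Spins (i + 1) → ℂ)
    (hv : VOp (i + 1) *ᵥ v = sgn ρ • v) :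
    IsPoly (i + 1) (fun lam => transfer P (i + 1) lam *ᵥ v) (transferZero P i ρ • v)
      (transferLeading P i ρ • v) := by
  obtain ⟨hA, -, -, hD⟩ := isPoly_monodromy P (i + 1)
  have h := (hA.add hD).map
    ((mulVecBilin ℂ ℂ).flip v : Op (i + 1) →ₗ[ℂ] (Spins (i + 1) → ℂ))
  simp only [LinearMap.flip_apply, mulVecBilin_apply, add_mulVec, one_mulVec, smul_mulVec, hv,
    smul_smul] at h
  simpa only [transfer, trace_fin_two, transferZero, transferLeading, add_smul, one_smul,
    add_mulVec] using h

/-- The Fourier transform over the zero mode makes V a scalar. Hence the end coefficients of the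
transfer matrix are scalars too, and D flips the same label as A. -/
theorem transfer_PsiTildeR (hadm : IsAdmissible P R n) (hgen : IsGeneric P R n) (hi : i + 1 ≤ n)
    (ρ : ZMod 2) (τ : Fin i → ZMod 2) (lam : ℂ) :
    transfer P (i + 1) lam *ᵥ PsiTildeR P R i ρ τ
      = ((∏ s, (1 - lam / node R i τ s)) * transferZero P i ρ
          + (lam * ∏ s, (lam - node R i τ s)) * transferLeading P i ρ) • PsiTildeR P R i ρ τ
        + ∑ k, (nodeFn (node R i τ) k lam * tau P R i ρ τ k) • PsiTildeR P R i ρ (flip τ k) := by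
  have hS := sameLevel hadm hgen hi
  have h := (isPoly_transfer_mulVec P i ρ _ (VOp_PsiTildeR hadm hgen hi ρ τ)).interpolation
    (node R i τ) (hS.node_injective _) (hS.node_ne_zero _) lam
  rw [h, smul_smul, smul_smul, ← add_smul]
  congr 1
  refine sum_congr rfl fun k _ => ?_
  rw [transfer, trace_fin_two, add_mulVec, monodromy_A_PsiTildeR hadm hgen hi,
    monodromy_D_PsiTildeR hadm hgen hi, ← add_smul, smul_smul]
  rfl

theorem IsPoly.unique {n : ℕ} {f : ℂ → ℂ} {c₀ cₙ d₀ dₙ : ℂ} (h : IsPoly n f c₀ cₙ)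
    (h' : IsPoly n f d₀ dₙ) : c₀ = d₀ ∧ cₙ = dₙ := by
  open Polynomial in
  obtain ⟨c, rfl, rfl, hc⟩ := h
  obtain ⟨d, rfl, rfl, hd⟩ := h'
  have e : ∑ j ∈ range (n + 1), C (c j) * X ^ j = ∑ j ∈ range (n + 1), C (d j) * X ^ j := by
    apply Polynomial.funext
    intro x
    have := (hc x).symm.trans (hd x)
    simp only [smul_eq_mul] at this
    simp only [eval_finsetSum, eval_mul, eval_C, eval_pow, eval_X]
    exact (sum_congr rfl fun _ _ => mul_comm _ _).trans
      (this.trans (sum_congr rfl fun _ _ => mul_comm _ _))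
  have key : ∀ (c : ℕ → ℂ) (j : ℕ), j ≤ n →
      (∑ j ∈ range (n + 1), C (c j) * X ^ j).coeff j = c j := by
    intro c j hj
    simp only [finsetSum_coeff, coeff_C_mul_X_pow]
    simp [Nat.lt_succ_of_le hj]
  exact ⟨by rw [← key c 0 (by omega), e, key d 0 (by omega)],
    by rw [← key c n le_rfl, e, key d n le_rfl]⟩

/-- The conditions on the coefficients of an eigenvalue in the sector `ρ`. -/
def IsEigenvaluePoly (P : Params) (i : ℕ) (ρ : ZMod 2) (t : ℂ → ℂ) : Prop :=
  IsPoly (i + 1) t (transferZero P i ρ) (transferLeading P i ρ)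

/-- The end coefficients of t are forced by the sector of a true eigenvector. The Baxter equations
constrain t only at the points ±r_{n,k} and could not supply them. -/
theorem isEigenvaluePoly {ρ : ZMod 2} {t : ℂ → ℂ} {c₀ cₙ : ℂ} (ht : IsPoly (i + 1) t c₀ cₙ)
    {v : Spins (i + 1) → ℂ} (hv : IsRightEigenvector P (i + 1) ρ t v) :
    IsEigenvaluePoly P i ρ t := by
  obtain ⟨hne, hV, hT⟩ := hv
  obtain ⟨s, hs⟩ := Function.ne_iff.1 hne
  have h1 := (isPoly_transfer_mulVec P i ρ v hV).map (LinearMap.proj s : _ →ₗ[ℂ] ℂ)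
  have h2 := ht.map (LinearMap.lsmul ℂ ℂ (v s))
  simp only [hT] at h1
  simp only [LinearMap.proj_apply, Pi.smul_apply, smul_eq_mul, LinearMap.lsmul_apply,
    mul_comm (v s)] at h1 h2
  obtain ⟨e1, e2⟩ := h1.unique h2
  have e1 := mul_right_cancel₀ hs e1
  have e2 := mul_right_cancel₀ hs e2
  rw [IsEigenvaluePoly, e1, e2]
  exact ht

/-! ### Separation of variables -/

theorem sovKernel_eq (R : Roots) (i : ℕ) (q : Fin i → ZMod 2 → ℂ) (τ : Fin i → ZMod 2) :
    sovKernel R i q τ = (∏ k, q k (τ k)) / offWeight R i τ := rfl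

/-- The equation for the kernel that makes `PhiR` an eigenvector. -/
def IsSeparated (P : Params) (R : Roots) (i : ℕ) (ρ : ZMod 2) (t : ℂ → ℂ)
    (K : (Fin i → ZMod 2) → ℂ) : Prop :=
  ∀ τ k, t (node R i τ k) * K τ = -(∏ s ∈ univ.erase k, (node R i τ k - node R i τ s)
    / (-node R i τ k - node R i τ s)) * tau P R i ρ (flip τ k) k * K (flip τ k)

/-- After reindexing by flips, the coefficient of each basis vector is compared with the
interpolation of t at the nodes of that vector. The end terms agree for every kernel, and the values
at the nodes agree by separation. -/
theorem transfer_sum (hadm : IsAdmissible P R n) (hgen : IsGeneric P R n) (hi : i + 1 ≤ n)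
    {ρ : ZMod 2} {t : ℂ → ℂ} (ht : IsEigenvaluePoly P i ρ t) {K : (Fin i → ZMod 2) → ℂ}
    (hK : IsSeparated P R i ρ t K) (lam : ℂ) :
    transfer P (i + 1) lam *ᵥ (∑ τ, K τ • PsiTildeR P R i ρ τ)
      = t lam • ∑ τ, K τ • PsiTildeR P R i ρ τ := by
  have hS := sameLevel hadm hgen hi
  rw [mulVec_sum, smul_sum]
  simp only [mulVec_smul, transfer_PsiTildeR hadm hgen hi, smul_add, smul_sum, smul_smul,
    sum_add_distrib]
  have f : ∑ τ, ∑ k, (K τ * (nodeFn (node R i τ) k lam * tau P R i ρ τ k))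
        • PsiTildeR P R i ρ (flip τ k)
      = ∑ τ, ∑ k, (K (flip τ k) * (nodeFn (node R i (flip τ k)) k lam
        * tau P R i ρ (flip τ k) k)) • PsiTildeR P R i ρ τ := by
    rw [sum_comm, sum_comm (s := univ (α := Fin i → ZMod 2))]
    refine sum_congr rfl fun k _ => ?_
    rw [← sum_flip_equiv k]
    simp only [flip_flip]
  rw [f, ← sum_add_distrib]
  refine sum_congr rfl fun τ _ => ?_
  rw [← sum_smul, ← add_smul]
  congr 1
  have h1 := ht.interpolation (node R i τ) (hS.node_injective _) (hS.node_ne_zero _) lam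
  simp only [smul_eq_mul] at h1
  rw [h1, add_mul, mul_comm (K τ), sum_mul]
  congr 1
  refine sum_congr rfl fun k _ => ?_
  rw [nodeFn_flip R i _ k lam (hS.node_ne _ k)]
  linear_combination -(nodeFn (node R i τ) k lam) * hK τ k

/-! ### The Baxter equations -/

/-- The factor of `chi` that depends on the roots of the current level only. -/
def levelRatio (R : Roots) (i : ℕ) (k : Fin i) : ℂ :=
  ∏ s ∈ univ.erase k, R.y₂ (i + 1) (s + 1) (i + 1) (k + 1) * R.r (i + 1) (s + 1)
    / (R.y₂ (i + 1) (k + 1) (i + 1) (s + 1) * R.r (i + 1) (k + 1))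

/-- The factor of `phi` that does not depend on the spins. -/
def phiConst (R : Roots) (i : ℕ) (k : Fin i) : ℂ :=
  R.rt i / R.rs (i + 1) * ∏ l ∈ Ico 1 i, R.y₂ i l (i + 1) (k + 1)

theorem phi_eq (P : Params) (R : Roots) (i : ℕ) (τ : Fin i → ZMod 2) (k : Fin i) :
    phi P R i τ k = -(F P (i + 1) (-node R i τ k) * phiConst R i k * ∏ s, sgn (τ s)) := by
  rw [phi, phiConst]; ring

theorem phiConst_ne_zero (hadm : IsAdmissible P R n) (hgen : IsGeneric P R n) (hi : i + 1 ≤ n)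
    (k : Fin i) : phiConst R i k ≠ 0 := by
  intro h
  apply phi_ne_zero hadm hgen hi 0 k
  rw [phi_eq, h, mul_zero, zero_mul, neg_zero]

theorem levelRatio_sq (h : SameLevel R i) (k : Fin i) :
    levelRatio R i k ^ 2 = (-1) ^ (i - 1) := by
  rw [levelRatio, ← prod_pow, h.prod_sq_ratio]

theorem levelRatio_ne_zero (h : SameLevel R i) (k : Fin i) : levelRatio R i k ≠ 0 := by
  intro h0
  have := levelRatio_sq h k
  rw [h0] at this
  exact pow_ne_zero (i - 1) (neg_ne_zero.2 (one_ne_zero (α := ℂ))) (by rw [← this]; simp)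

/-- `chi` is the amplitude of A cleared of its spin dependence, divided by the constants which a
flip extracts from the weights of the level. -/
theorem chi_eq (h : SameLevel R i) (h0 : R.r (i + 1) 0 ≠ 0) (k : Fin i) :
    chi R (i + 1) (k + 1) * R.r (i + 1) (k + 1) ^ i * levelRatio R i k = phiConst R i k := by
  have e : R.r (i + 1) (k + 1) ^ i
      = R.r (i + 1) (k + 1) * ∏ s ∈ univ.erase k, R.r (i + 1) (k + 1) := by
    rw [prod_const, card_erase_of_mem (mem_univ k), card_univ, Fintype.card_fin, ← pow_succ',
      Nat.sub_add_cancel (by have := k.2; omega)]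
  have e2 : (∏ s ∈ univ.erase k, R.y₂ (i + 1) (k + 1) (i + 1) (s + 1)
        / R.y₂ (i + 1) (s + 1) (i + 1) (k + 1)) * (∏ s ∈ univ.erase k, R.r (i + 1) (k + 1))
        * levelRatio R i k = ∏ s ∈ univ.erase k, R.r (i + 1) (s + 1) := by
    rw [levelRatio, ← prod_mul_distrib, ← prod_mul_distrib]
    refine prod_congr rfl fun s hs => ?_
    have hne : s ≠ k := (mem_erase.1 hs).1
    have h1 : R.y₂ (i + 1) (k + 1) (i + 1) (s + 1) ≠ 0 := (h.curve k s hne.symm).2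
    have h2 : R.y₂ (i + 1) (s + 1) (i + 1) (k + 1) ≠ 0 := (h.curve s k hne).2
    have h3 := h.r_ne k
    field_simp
  have e3 : R.rt (i + 1) = R.r (i + 1) 0 * (R.r (i + 1) (k + 1)
      * ∏ s ∈ univ.erase k, R.r (i + 1) (s + 1)) := by
    rw [rt_succ, mul_prod_erase univ (fun s : Fin i => R.r (i + 1) (s + 1)) (mem_univ k)]
  have h1 := h.r_ne k
  have h2 : ∏ s ∈ univ.erase k, R.r (i + 1) ((s : ℕ) + 1) ≠ 0 :=
    prod_ne_zero_iff.2 fun s _ => h.r_ne s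
  rw [chi, Nat.add_sub_cancel, prod_Ico_one_erase (fun s => R.y₂ (i + 1) (k + 1) (i + 1) s
        / R.y₂ (i + 1) s (i + 1) (k + 1)), e, phiConst, e3]
  calc _ = R.r (i + 1) 0 * R.rt i / (R.rs (i + 1) * (R.r (i + 1) 0 * (R.r (i + 1) (k + 1)
      * ∏ s ∈ univ.erase k, R.r (i + 1) (s + 1)))) * R.r (i + 1) (k + 1)
      * ((∏ s ∈ univ.erase k, R.y₂ (i + 1) (k + 1) (i + 1) (s + 1)
        / R.y₂ (i + 1) (s + 1) (i + 1) (k + 1)) * (∏ s ∈ univ.erase k, R.r (i + 1) (k + 1))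
        * levelRatio R i k) * ∏ l ∈ Ico 1 i, R.y₂ i l (i + 1) (k + 1) := by ring
    _ = _ := by
      rw [e2]
      field_simp

theorem lamZero_eq (R : Roots) (i : ℕ) (τ : Fin i → ZMod 2) (k : Fin i) :
    lamZero R (i + 1) (k + 1) (τ k) = node R i τ k := by
  rw [lamZero, node, sgn_neg, mul_comm]

theorem tau_flip (hadm : IsAdmissible P R n) (hgen : IsGeneric P R n) (hi : i + 1 ≤ n)
    (ρ : ZMod 2) (τ : Fin i → ZMod 2) (k : Fin i) :
    tau P R i ρ (flip τ k) k = (∏ s, sgn (τ s)) * (F P (i + 1) (node R i τ k) * phiConst R i k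
      - sgn ρ * (∏ m ∈ Ico 1 (i + 1), F P m (-node R i τ k)) / phiConst R i k) := by
  have hG := phiConst_ne_zero hadm hgen hi k
  have hF := F_ne_zero hgen hi τ k
  have hS : (∏ s, sgn (τ s)) ≠ 0 := prod_ne_zero_iff.2 fun s _ => sgn_ne_zero _
  have hS2 := prod_sgn_sq τ
  rw [tau, flip_flip, phi_eq, phi_eq, node_flip_same, prod_sgn_flip, neg_neg,
    prod_Ico_succ_top (by omega)]
  set S := ∏ s, sgn (τ s)
  field_simp
  linear_combination (sgn ρ * ∏ m ∈ Ico 1 (i + 1), F P m (-node R i τ k)) * hS2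

theorem chi_mul_pow (h : SameLevel R i) (h0 : R.r (i + 1) 0 ≠ 0) (τ : Fin i → ZMod 2)
    (k : Fin i) : chi R (i + 1) (k + 1) * node R i τ k ^ i
      = -(sgn (τ k) ^ i * levelRatio R i k * phiConst R i k) := by
  have h2 := levelRatio_sq h k
  have hpow : (-1 : ℂ) ^ (i - 1) * (-1) ^ i = -1 := by
    rw [← pow_add]
    exact Odd.neg_one_pow ⟨i - 1, by have := k.2; omega⟩
  have hsq : (-1 : ℂ) ^ i * (-1) ^ i = 1 := by rw [← mul_pow]; simp
  -- The sign produced by the node is absorbed by the square of `levelRatio`, which is (-1)^(i-1).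
  have he : (-1 : ℂ) ^ i = -levelRatio R i k ^ 2 := by
    rw [h2]; linear_combination (-1 : ℂ) ^ i * hpow - (-1 : ℂ) ^ (i - 1) * hsq
  have h3 := chi_eq h h0 k
  rw [node, neg_pow, mul_pow, he]
  linear_combination -(sgn (τ k) ^ i * levelRatio R i k) * h3

theorem chi_ne_zero (hadm : IsAdmissible P R n) (hgen : IsGeneric P R n) (hi : i + 1 ≤ n)
    (k : Fin i) : chi R (i + 1) (k + 1) ≠ 0 := by
  intro h0
  have h := chi_eq (sameLevel hadm hgen hi) (hgen.r_ne (i + 1) (by rw [mem_Icc]; omega) 0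
    (by simp)) k
  rw [h0, zero_mul, zero_mul] at h
  exact phiConst_ne_zero hadm hgen hi k h.symm

/-- The Baxter equation in terms of the amplitude `tau`. -/
theorem baxter_eq (hadm : IsAdmissible P R n) (hgen : IsGeneric P R n) (hi : i + 1 ≤ n)
    {ρ : ZMod 2} {t : ℂ → ℂ} {q : Fin i → ZMod 2 → ℂ} (hq : BaxterR P R i ρ t q)
    (τ : Fin i → ZMod 2) (k : Fin i) :
    t (node R i τ k) * q k (τ k) = -(sgn (τ k) ^ i * levelRatio R i k
      * (F P (i + 1) (node R i τ k) * phiConst R i k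
        - sgn ρ * (∏ m ∈ Ico 1 (i + 1), F P m (-node R i τ k)) / phiConst R i k))
          * q k (τ k + 1) := by
  have hS := sameLevel hadm hgen hi
  have h0 := hgen.r_ne (i + 1) (by rw [mem_Icc]; omega) 0 (by simp)
  have h := hq k (τ k)
  have hχ := chi_ne_zero hadm hgen hi k
  have hs := pow_ne_zero i (sgn_ne_zero (τ k))
  have hH := levelRatio_ne_zero hS k
  have hG := phiConst_ne_zero hadm hgen hi k
  have h1 := chi_mul_pow hS h0 τ k
  have h2 := chi_eq hS h0 k
  have hss : sgn (τ k) ^ i * sgn (τ k) ^ i = 1 := by rw [← mul_pow, sgn_mul_self, one_pow]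
  -- On ℤ/2 the two neighbours coincide, so the right side of the Baxter equation is a single
  -- coefficient times the value of `q k` at the flipped spin.
  have e : τ k - 1 = τ k + 1 := by rw [sub_eq_add_neg, ZMod.neg_eq_self_mod_two]
  have ez : (node R i τ k / -1) ^ (1 - ((i + 1 : ℕ) : ℤ)) = ((-node R i τ k) ^ i)⁻¹ := by
    rw [show (1 - ((i + 1 : ℕ) : ℤ)) = -(i : ℤ) by push_cast; ring, _root_.zpow_neg, zpow_natCast,
      div_neg, div_one]
  have ec : (chi R (i + 1) (k + 1) * (-node R i τ k) ^ i)⁻¹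
      = sgn (τ k) ^ i * levelRatio R i k / phiConst R i k := by
    rw [node, neg_neg, mul_pow, eq_div_iff hG, ← h2]
    have := pow_ne_zero i (hS.r_ne k)
    field_simp
    linear_combination -hss
  rw [lamZero_eq, e, deltaP, deltaM, ez, Nat.add_sub_cancel] at h
  rw [h, show -1 * node R i τ k / -1 = node R i τ k by ring, h1, div_neg, div_one]
  rw [show sgn ρ / chi R (i + 1) (k + 1) * ((-node R i τ k) ^ i)⁻¹
    = sgn ρ * (chi R (i + 1) (k + 1) * (-node R i τ k) ^ i)⁻¹ by rw [mul_inv]; ring, ec]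
  ring

theorem SameLevel.offWeight_flip_eq (hS : SameLevel R i) (τ : Fin i → ZMod 2) (k : Fin i) :
    (∏ s ∈ univ.erase k, (node R i τ k - node R i τ s) / (-node R i τ k - node R i τ s))
        * offWeight R i τ
      = offWeight R i (flip τ k) * (sgn (τ k) ^ i * (∏ s, sgn (τ s)) * levelRatio R i k) := by
  rw [hS.offWeight_flip τ k, prod_mul_distrib, prod_mul_distrib, prod_const,
    card_erase_of_mem (mem_univ k), card_univ, Fintype.card_fin,
    ← mul_prod_erase univ (fun s => sgn (τ s)) (mem_univ k)]
  change _ * (_ * levelRatio R i k) = _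
  have : sgn (τ k) ^ i = sgn (τ k) ^ (i - 1) * sgn (τ k) := by
    rw [← pow_succ, Nat.sub_add_cancel (by have := k.2; omega)]
  rw [this]
  linear_combination (-(sgn (τ k) ^ (i - 1)) * (∏ s ∈ univ.erase k, sgn (τ s))
    * levelRatio R i k * offWeight R i (flip τ k)) * sgn_mul_self (τ k)

/-- A flip changes one factor of the product of the `q`, and the Baxter equation governs it. The
weights absorb the ratio of node differences, and the product of all spin signs left over in `tau`
meets an equal one and squares to 1. -/
theorem isSeparated_sovKernel (hadm : IsAdmissible P R n) (hgen : IsGeneric P R n)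
    (hi : i + 1 ≤ n) {ρ : ZMod 2} {t : ℂ → ℂ} {q : Fin i → ZMod 2 → ℂ}
    (hq : BaxterR P R i ρ t q) : IsSeparated P R i ρ t (sovKernel R i q) := by
  intro τ k
  have hS := sameLevel hadm hgen hi
  have h := baxter_eq hadm hgen hi hq τ k
  have hO := hS.offWeight_flip_eq τ k
  have h1 := hS.offWeight_ne_zero τ
  have h2 := hS.offWeight_ne_zero (flip τ k)
  have hP : ∏ j, q j (τ j) = q k (τ k) * ∏ j ∈ univ.erase k, q j (τ j) :=
    (mul_prod_erase univ (fun j => q j (τ j)) (mem_univ k)).symm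
  have hP' : ∏ j, q j (flip τ k j) = q k (τ k + 1) * ∏ j ∈ univ.erase k, q j (τ j) := by
    rw [← mul_prod_erase univ (fun j => q j (flip τ k j)) (mem_univ k), flip_same]
    congr 1
    refine prod_congr rfl fun j hj => ?_
    rw [flip_of_ne τ (mem_erase.1 hj).1]
  have hS2 := prod_sgn_sq τ
  rw [sovKernel_eq, sovKernel_eq, hP, hP', tau_flip hadm hgen hi]
  set PP := ∏ s ∈ univ.erase k, (node R i τ k - node R i τ s) / (-node R i τ k - node R i τ s)
  set T := F P (i + 1) (node R i τ k) * phiConst R i k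
        - sgn ρ * (∏ m ∈ Ico 1 (i + 1), F P m (-node R i τ k)) / phiConst R i k
  set S := ∏ s, sgn (τ s)
  rw [← mul_div_assoc, ← mul_div_assoc, div_eq_div_iff h1 h2]
  linear_combination (offWeight R i (flip τ k) * ∏ j ∈ univ.erase k, q j (τ j)) * h
    + (S * T * q k (τ k + 1) * ∏ j ∈ univ.erase k, q j (τ j)) * hO
    + (offWeight R i (flip τ k) * (sgn (τ k) ^ i * levelRatio R i k * T * q k (τ k + 1))
      * ∏ j ∈ univ.erase k, q j (τ j)) * hS2

/-! ### Orthogonality of the Fourier transformed vectors -/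

theorem dotProduct_PsiTildeR_cons (hadm : IsAdmissible P R n) (hgen : IsGeneric P R n)
    (hi : i + 1 ≤ n) (ρ z : ZMod 2) (τ τ' : Fin i → ZMod 2) :
    PsiR P.conj R.conj i (Fin.cons z τ) ⬝ᵥ PsiTildeR P R i ρ τ'
      = if τ = τ' then sgn (ρ * z) * pairing P R i (Fin.cons z τ) else 0 := by
  rw [PsiTildeR_eq, dotProduct_sum]
  simp only [dotProduct_smul, dotProduct_PsiR hadm hgen hi, smul_eq_mul]
  have e : ∀ x : ZMod 2, ((Fin.cons z τ : Spins (i + 1)) = Fin.cons x τ') = (z = x ∧ τ = τ') :=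
    fun x => by rw [Fin.cons_inj]
  simp only [e]
  split_ifs with h
  · simp [h]
  · simp [h]

theorem pairing_cons (hadm : IsAdmissible P R n) (hgen : IsGeneric P R n) (hi : i + 1 ≤ n)
    (z : ZMod 2) (τ : Fin i → ZMod 2) :
    pairing P R i (Fin.cons z τ) = pairing P R i (Fin.cons 0 τ) := by
  obtain rfl | rfl := zmod_two_cases z
  · rfl
  · have h := pairing_flip_zero hadm hgen hi (Fin.cons 0 τ)
    rwa [flip_cons_zero, zero_add] at h

theorem dotProduct_PsiTildeR (hadm : IsAdmissible P R n) (hgen : IsGeneric P R n)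
    (hi : i + 1 ≤ n) (ρ : ZMod 2) (τ τ' : Fin i → ZMod 2) :
    PsiTildeR P.conj R.conj i ρ τ ⬝ᵥ PsiTildeR P R i ρ τ'
      = if τ = τ' then 2 * pairing P R i (Fin.cons 0 τ) else 0 := by
  rw [PsiTildeR_eq P.conj, sum_dotProduct]
  simp only [smul_dotProduct, dotProduct_PsiTildeR_cons hadm hgen hi, smul_eq_mul]
  split_ifs with h
  · simp only [← mul_assoc, sgn_mul_self, one_mul, pairing_cons hadm hgen hi]
    rw [sum_zmod_two, two_mul]
  · simp

theorem isRightEigenvector_PhiR (hadm : IsAdmissible P R n) (hgen : IsGeneric P R n)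
    (hi : i + 1 ≤ n) {ρ : ZMod 2} {t : ℂ → ℂ} (ht : IsEigenvaluePoly P i ρ t)
    {q : Fin i → ZMod 2 → ℂ} (hq : BaxterR P R i ρ t q) (hq0 : ∀ k, q k 0 = 1) :
    IsRightEigenvector P (i + 1) ρ t (PhiR P R i ρ q) := by
  refine ⟨fun h => ?_, ?_, transfer_sum hadm hgen hi ht (isSeparated_sovKernel hadm hgen hi hq)⟩
  · have h1 : PsiR P.conj R.conj i (Fin.cons 0 0) ⬝ᵥ PhiR P R i ρ q = 0 := by
      rw [h, dotProduct_zero]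
    rw [PhiR, dotProduct_sum] at h1
    simp only [dotProduct_smul, dotProduct_PsiTildeR_cons hadm hgen hi, smul_eq_mul, mul_ite,
      mul_zero, sgn_zero, one_mul, sum_ite_eq, mem_univ, if_true] at h1
    refine mul_ne_zero ?_ (pairing_ne_zero hadm hgen hi (Fin.cons 0 0)) h1
    rw [sovKernel_eq]
    refine div_ne_zero ?_ ((sameLevel hadm hgen hi).offWeight_ne_zero 0)
    simp [hq0]
  · rw [PhiR, mulVec_sum, smul_sum]
    refine sum_congr rfl fun τ _ => ?_
    rw [mulVec_smul, VOp_PsiTildeR hadm hgen hi, smul_comm]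

/-! ### Left vectors -/

/-- On ℤ/2 a shift of the argument inverts a weight up to a constant. This turns the shifted weights
of the left vectors into those of the right vectors of the transposed model. -/
theorem OnCurve.w_sub_one {p : ℂ × ℂ} (h : OnCurve p) (γ : ZMod 2) :
    w p (γ - 1) = w p 1 / w p γ := by
  have e : γ - 1 = γ + 1 := by rw [sub_eq_add_neg, ZMod.neg_eq_self_mod_two]
  rw [eq_div_iff (h.w_ne γ), e, mul_comm, w_mul_w_add_one]

theorem psiL_eq (hadm : IsAdmissible P R n) (hgen : IsGeneric P R n) {k : ℕ}
    (hk : k ∈ Icc 1 n) (σ : ZMod 2) :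
    psiL P R k σ = (w (R.rs k / P.a k, -P.b k / P.a k) 1)⁻¹ • psiR P.conj R.conj k σ := by
  have h : OnCurve (R.rs k / P.a k, -P.b k / P.a k) := onCurve_psiR hadm.conj hgen.conj hk
  ext γ
  have e : P.b k / (-1 * P.a k) = -P.b k / P.a k := by rw [neg_one_mul, div_neg, neg_div]
  rw [psiL, e, h.w_sub_one, inv_div, Pi.smul_apply, smul_eq_mul, div_eq_inv_mul]
  rfl

theorem kernelL_eq (hadm : IsAdmissible P R n) (hgen : IsGeneric P R n) (hi : i + 2 ≤ n) :
    ∃ C : ℂ, C ≠ 0 ∧ ∀ ρ' σ ρ, kernelL P R i ρ' σ ρ = C * kernelR P.conj R.conj i ρ' σ ρ := by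
  have hm : i + 1 ∈ Ico 1 n := by rw [mem_Ico]; omega
  have hm' : i + 1 ∈ Icc 1 n := by rw [mem_Icc]; omega
  have hl (l : Fin i) : (l : ℕ) + 1 ∈ Ico 1 (i + 1) := by rw [mem_Ico]; omega
  have hk (k : Fin (i + 1)) : (k : ℕ) + 1 ∈ Ico 1 (i + 1 + 1) := by rw [mem_Ico]; omega
  have c0 := onCurve_pt0 hadm hgen hi
  have cT := onCurve_ptTilde hadm hgen hi
  have c1 (l : Fin i) := onCurve_pt1 hadm hgen hm (hl l)
  have c1T (l : Fin i) := onCurve_pt1Tilde hadm hgen hm (hl l)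
  have cn (l : Fin i) (k : Fin (i + 1)) := onCurve_pt2_next hadm hgen hm (hl l) (hk k)
  have hS := sameLevel hadm hgen (show i + 1 ≤ n by omega)
  have e0 : pt0 P.conj R.conj (i + 2) = pt0 P R (i + 2) := rfl
  have eT : ptTilde P.conj R.conj (i + 2) = ptTilde P R (i + 2) := by
    have h1 : R.conj.rt = R.rt := rfl
    have h2 : R.conj.rs = R.rs := rfl
    simp only [ptTilde, Params.conj, h1, h2, neg_mul_neg]
  have e1 (l : Fin i) (γ : ZMod 2) : w (pt1 P.conj R.conj (i + 1) (l + 1)) γ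
      = sgn γ / w (pt1 P R (i + 1) (l + 1)) γ := by
    rw [eq_div_iff ((c1 l).w_ne γ), ← (c1 l).w_neg_neg]
    simp only [pt1, Params.conj, Roots.conj, div_neg]
  have e1T (l : Fin i) (γ : ZMod 2) : w (pt1Tilde P.conj R.conj (i + 1) (l + 1)) γ
      = 1 / w (pt1Tilde P R (i + 1) (l + 1)) γ := by
    rw [eq_div_iff ((c1T l).w_ne γ), ← (c1T l).w_neg_left γ]
    simp only [pt1Tilde, Params.conj, Roots.conj, neg_div]
  have e2 : pt2 R.conj = pt2 R := rfl
  -- The constant collects one value `w p 1` for each weight that has to be inverted.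
  refine ⟨w (pt0 P R (i + 2)) 1 * w (ptTilde P R (i + 2)) 1
    * (∏ j : Fin i, ∏ l ∈ univ.erase j, w (pt2 R (i + 1) (j + 1) (i + 1) (l + 1)) 1)
    / ∏ l : Fin i, ∏ k : Fin (i + 1), w (pt2 R (i + 1) (l + 1) (i + 2) (k + 1)) 1, ?_, ?_⟩
  · refine div_ne_zero (mul_ne_zero (mul_ne_zero (c0.w_ne _) (cT.w_ne _)) ?_) ?_
    · exact prod_ne_zero_iff.2 fun j _ => prod_ne_zero_iff.2 fun l hl =>
        (hS.curve j l (mem_erase.1 hl).1.symm).w_ne _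
    · exact prod_ne_zero_iff.2 fun l _ => prod_ne_zero_iff.2 fun k _ => (cn l k).w_ne _
  · intro ρ' σ ρ
    -- The additional sign in `kernelL` is the one that `OnCurve.w_neg_neg` produces for the points
    -- p_{m,l}.
    have hs : sgn ((∑ k, ρ' k) - ρ' 0) = ∏ l : Fin i, sgn (ρ' l.succ) := by
      rw [Fin.sum_univ_succ, add_sub_cancel_left, sgn_sum]
    have a1 : ∏ j : Fin i, ∏ l ∈ univ.erase j,
          w (pt2 R (i + 1) (j + 1) (i + 1) (l + 1)) (ρ' j.succ - ρ' l.succ - 1)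
        = (∏ j : Fin i, ∏ l ∈ univ.erase j, w (pt2 R (i + 1) (j + 1) (i + 1) (l + 1)) 1)
          / ∏ j : Fin i, ∏ l ∈ univ.erase j,
            w (pt2 R (i + 1) (j + 1) (i + 1) (l + 1)) (ρ' j.succ - ρ' l.succ) := by
      rw [← prod_div_distrib]
      refine prod_congr rfl fun j _ => ?_
      rw [← prod_div_distrib]
      exact prod_congr rfl fun l hl => (hS.curve j l (mem_erase.1 hl).1.symm).w_sub_one _
    have a2 : ∏ l : Fin i, ∏ k : Fin (i + 1),
          w (pt2 R (i + 1) (l + 1) (i + 2) (k + 1)) (ρ' l.succ - ρ k.succ - 1)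
        = (∏ l : Fin i, ∏ k : Fin (i + 1), w (pt2 R (i + 1) (l + 1) (i + 2) (k + 1)) 1)
          / ∏ l : Fin i, ∏ k : Fin (i + 1),
            w (pt2 R (i + 1) (l + 1) (i + 2) (k + 1)) (ρ' l.succ - ρ k.succ) := by
      rw [← prod_div_distrib]
      refine prod_congr rfl fun l _ => ?_
      rw [← prod_div_distrib]
      exact prod_congr rfl fun k _ => (cn l k).w_sub_one _
    have a3 : ∏ l : Fin i, w (pt1 P.conj R.conj (i + 1) (l + 1)) (-ρ' l.succ)
          / w (pt1Tilde P.conj R.conj (i + 1) (l + 1)) (ρ' l.succ)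
        = (∏ l : Fin i, sgn (ρ' l.succ)) * ∏ l : Fin i,
          w (pt1Tilde P R (i + 1) (l + 1)) (ρ' l.succ) / w (pt1 P R (i + 1) (l + 1)) (-ρ' l.succ)
        := by
      rw [← prod_mul_distrib]
      refine prod_congr rfl fun l _ => ?_
      rw [e1, e1T, sgn_neg, one_div, div_inv_eq_mul, div_mul_eq_mul_div, mul_div_assoc]
    have b1 := c0.w_ne (ρ 0 - ρ' 0)
    have b2 := cT.w_ne ((∑ k, ρ k) - σ)
    have b3 := c0.w_ne 1
    have b4 := cT.w_ne 1
    rw [kernelL, kernelR, a1, a2, a3, e0, eT, e2, add_sub_assoc, sgn_add, sgn_neg, hs,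
      c0.w_sub_one, cT.w_sub_one]
    generalize (∏ l : Fin i, ∏ k : Fin (i + 1),
      w (pt2 R (i + 1) (l + 1) (i + 2) (k + 1)) (ρ' l.succ - ρ k.succ)) = X1
    generalize (∏ j : Fin i, ∏ l ∈ univ.erase j,
      w (pt2 R (i + 1) (j + 1) (i + 1) (l + 1)) (ρ' j.succ - ρ' l.succ)) = X2
    field_simp

theorem PsiL_eq (hadm : IsAdmissible P R n) (hgen : IsGeneric P R n) (hi : i + 1 ≤ n) :
    ∃ C : ℂ, C ≠ 0 ∧ ∀ ρ, PsiL P R i ρ = C • PsiR P.conj R.conj i ρ := by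
  have hc {k : ℕ} (hk : k ∈ Icc 1 n) : (w (R.rs k / P.a k, -P.b k / P.a k) 1)⁻¹ ≠ 0 :=
    inv_ne_zero (OnCurve.w_ne (onCurve_psiR hadm.conj hgen.conj hk) 1)
  induction i with
  | zero =>
    have hk : 1 ∈ Icc 1 n := by rw [mem_Icc]; omega
    refine ⟨_, hc hk, fun ρ => ?_⟩
    ext γ
    exact congrFun (psiL_eq hadm hgen hk (ρ 0)) (γ 0)
  | succ i ih =>
    obtain ⟨C, hC, h⟩ := ih (by omega)
    obtain ⟨D, hD, h'⟩ := kernelL_eq hadm hgen hi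
    have hk : i + 2 ∈ Icc 1 n := by rw [mem_Icc]; omega
    refine ⟨_, mul_ne_zero (mul_ne_zero hC hD) (hc hk), fun ρ => ?_⟩
    ext γ
    simp only [PsiL, PsiR, Pi.smul_apply, smul_eq_mul, mul_sum]
    refine sum_congr rfl fun ρ' _ => sum_congr rfl fun σ _ => ?_
    rw [h, h', psiL_eq hadm hgen hk, Pi.smul_apply, Pi.smul_apply, smul_eq_mul, smul_eq_mul]
    ring

theorem PsiTildeL_eq (hadm : IsAdmissible P R n) (hgen : IsGeneric P R n) (hi : i + 1 ≤ n) :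
    ∃ C : ℂ, C ≠ 0 ∧ ∀ ρ τ, PsiTildeL P R i ρ τ = C • PsiTildeR P.conj R.conj i ρ τ := by
  obtain ⟨C, hC, h⟩ := PsiL_eq hadm hgen hi
  refine ⟨C, hC, fun ρ τ => ?_⟩
  rw [PsiTildeL, PsiTildeR_eq, smul_sum]
  refine sum_congr rfl fun z _ => ?_
  rw [h, smul_comm]

theorem IsEigenvaluePoly.conj {ρ : ZMod 2} {t : ℂ → ℂ} (h : IsEigenvaluePoly P i ρ t) :
    IsEigenvaluePoly P.conj i ρ t := by
  have h1 : transferZero P.conj i ρ = transferZero P i ρ := by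
    simp only [transferZero, Params.conj, neg_mul_neg]
  have h2 : transferLeading P.conj i ρ = transferLeading P i ρ := rfl
  rwa [IsEigenvaluePoly, h1, h2]

/-- Transposition reflects the argument of `F`, so `deltaM` and `deltaP` of the transposed model are
the original ones at the opposite argument, up to (-1)^i. As γ + 1 = γ - 1, the two terms may also
be exchanged. -/
theorem BaxterL.conj {ρ : ZMod 2} {t : ℂ → ℂ} {q : Fin i → ZMod 2 → ℂ}
    (h : BaxterL P R i ρ t q) : BaxterR P.conj R.conj i ρ t q := by
  intro k γ
  have e : γ - 1 = γ + 1 := by rw [sub_eq_add_neg, ZMod.neg_eq_self_mod_two]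
  have h1 := h k γ
  have h2 : lamZero R.conj (i + 1) (k + 1) γ = lamZero R (i + 1) (k + 1) γ := rfl
  have h3 : chi R.conj (i + 1) (k + 1) = chi R (i + 1) (k + 1) := rfl
  have ez : ∀ x : ℂ, x ^ (1 - ((i + 1 : ℕ) : ℤ)) = (x ^ i)⁻¹ := fun x => by
    rw [show (1 - ((i + 1 : ℕ) : ℤ)) = -(i : ℤ) by push_cast; ring, _root_.zpow_neg, zpow_natCast]
  have hpow := neg_pow (lamZero R (i + 1) (k + 1) γ) i
  have hsq : (-1 : ℂ) ^ i * (-1) ^ i = 1 := by rw [← mul_pow]; simp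
  have hinv : ((-1 : ℂ) ^ i)⁻¹ = (-1) ^ i := inv_eq_of_mul_eq_one_left hsq
  rw [h2, h1, e]
  simp only [deltaP, deltaM, h3, F_conj, ez, Nat.add_sub_cancel, _root_.zpow_neg, zpow_natCast,
    div_neg, div_one, neg_mul, one_mul, neg_neg, hpow, mul_inv, hinv]
  linear_combination (chi R (i + 1) (k + 1) * lamZero R (i + 1) (k + 1) γ ^ i
    * F P (i + 1) (-lamZero R (i + 1) (k + 1) γ) * q k (γ + 1)) * hsq

theorem isLeftEigenvector_PhiL (hadm : IsAdmissible P R n) (hgen : IsGeneric P R n)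
    (hi : i + 1 ≤ n) {ρ : ZMod 2} {t : ℂ → ℂ} (ht : IsEigenvaluePoly P i ρ t)
    {q : Fin i → ZMod 2 → ℂ} (hq : BaxterL P R i ρ t q) (hq0 : ∀ k, q k 0 = 1) :
    IsLeftEigenvector P (i + 1) ρ t (PhiL P R i ρ q) := by
  obtain ⟨C, hC, h⟩ := PsiTildeL_eq hadm hgen hi
  have e : PhiL P R i ρ q = C • PhiR P.conj R.conj i ρ q := by
    rw [PhiL, PhiR, smul_sum]
    refine sum_congr rfl fun τ _ => ?_
    rw [h, smul_comm]
    rfl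
  obtain ⟨h0, hV, hT⟩ := isRightEigenvector_PhiR hadm.conj hgen.conj hi ht.conj hq.conj hq0
  rw [e]
  refine ⟨smul_ne_zero hC h0, ?_, fun lam => ?_⟩
  · rw [← mulVec_transpose, VOp_transpose, mulVec_smul, hV, smul_comm]
  · rw [← mulVec_transpose, ← transfer_conj, mulVec_smul, hT, smul_comm]

/-! ### A summation formula -/

/-- The product of `x k + x l` over the pairs `k < l`. -/
def pairProd {m : ℕ} (x : Fin m → ℂ) : ℂ := ∏ k, ∏ l ∈ Ioi k, (x l + x k)

/-- The summands are symmetric, so any index can be split off, not only the first. -/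
theorem pairProd_succAbove {m : ℕ} (x : Fin (m + 1) → ℂ) (k : Fin (m + 1)) :
    pairProd x = (∏ l : Fin m, (x (k.succAbove l) + x k))
      * pairProd (fun l => x (k.succAbove l)) := by
  have e : ∀ {m : ℕ} (x : Fin m → ℂ),
      pairProd x = ∏ k, ∏ l, if k < l then x l + x k else 1 := fun x => by
    refine prod_congr rfl fun k _ => ?_
    rw [← prod_filter, filter_lt_eq_Ioi]
  rw [e, e, Fin.prod_univ_succAbove _ k]
  simp only [Fin.prod_univ_succAbove _ k, lt_self_iff_false, if_false, one_mul,
    Fin.succAbove_lt_succAbove_iff, prod_mul_distrib]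
  rw [← mul_assoc, ← prod_mul_distrib]
  congr 1
  refine prod_congr rfl fun l _ => ?_
  obtain h | h := lt_or_gt_of_ne (Fin.succAbove_ne k l)
  · rw [if_neg h.not_gt, if_pos h, one_mul, add_comm]
  · rw [if_pos h, if_neg h.not_gt, mul_one]

theorem pairProd_ne_zero {m : ℕ} {x : Fin m → ℂ} (h : ∀ k l, k ≠ l → x k ^ 2 ≠ x l ^ 2) :
    pairProd x ≠ 0 := by
  refine prod_ne_zero_iff.2 fun k _ => prod_ne_zero_iff.2 fun l hl h0 => ?_
  rw [mem_Ioi] at hl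
  exact h k l hl.ne (by linear_combination (x k - x l) * h0)

/-- The sum over all signs of the zeros `r`. -/
def signSum {m : ℕ} (r : Fin m → ℂ) (μ : Fin (m + 1) → ℂ) : ℂ :=
  ∑ τ : Fin m → ZMod 2, (∏ k, sgn (τ k) * ∏ j, (sgn (τ k) * r k + μ j))
    / pairProd (fun k => sgn (τ k) * r k)

/-- Placing one μ at ±r_k annihilates all terms with the opposite sign of r_k. In the surviving ones
the factors that this μ contributes at the other roots cancel the pairs with r_k in the denominator,
leaving the same sum for one root fewer. -/
theorem signSum_cons_root {m : ℕ} {r : Fin (m + 1) → ℂ}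
    (h : ∀ k l, k ≠ l → r k ^ 2 ≠ r l ^ 2) (μ : Fin (m + 1) → ℂ) (k : Fin (m + 1)) (ε : ZMod 2) :
    signSum r (Fin.cons (sgn ε * r k) μ)
      = 2 * r k * (∏ j, (sgn ε * r k + μ j)) * signSum (fun l => r (k.succAbove l)) μ := by
  rw [signSum, ← (Fin.insertNthEquiv (fun _ => ZMod 2) k).sum_comp, Fintype.sum_prod_type,
    signSum, mul_sum]
  simp only [Fin.insertNthEquiv_apply, Fin.prod_univ_succAbove _ k, Fin.insertNth_apply_same,
    Fin.insertNth_apply_succAbove, pairProd_succAbove _ k]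
  simp only [Fin.prod_univ_succ (n := m + 1), Fin.cons_zero, Fin.cons_succ]
  rw [sum_eq_single ε]
  · refine sum_congr rfl fun τ _ => ?_
    have hne : ∏ l, (sgn (τ l) * r (k.succAbove l) + sgn ε * r k) ≠ 0 :=
      prod_ne_zero_iff.2 fun l _ h0 => h _ _ (Fin.succAbove_ne k l) (by
        linear_combination (sgn (τ l) * r (k.succAbove l) - sgn ε * r k) * h0
          - r (k.succAbove l) ^ 2 * sgn_sq (τ l) + r k ^ 2 * sgn_sq ε)
    rw [← mul_div_assoc]
    simp only [mul_left_comm (sgn (τ _)), prod_mul_distrib]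
    rw [mul_left_comm _ (∏ l, (sgn (τ l) * r (k.succAbove l) + sgn ε * r k)),
      mul_div_mul_left _ _ hne]
    congr 1
    have e : ∀ y, ∏ j, (y + μ j) = (y + μ k) * ∏ j : Fin m, (y + μ (k.succAbove j)) :=
      fun y => Fin.prod_univ_succAbove _ k
    simp only [e, prod_mul_distrib]
    linear_combination (2 * r k * ((sgn ε * r k + μ k) * ∏ j, (sgn ε * r k + μ (k.succAbove j)))
      * (∏ l, sgn (τ l)) * ((∏ l, (sgn (τ l) * r (k.succAbove l) + μ k))
      * ∏ l, ∏ j, (sgn (τ l) * r (k.succAbove l) + μ (k.succAbove j)))) * sgn_sq ε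
  · intro x _ hx
    have e : x = ε + 1 := by revert x ε; decide
    refine sum_eq_zero fun τ _ => ?_
    rw [e, sgn_add_one]
    simp
  · simp

theorem pairProd_cons {m : ℕ} (z : ℂ) (μ : Fin m → ℂ) :
    pairProd (Fin.cons z μ : Fin (m + 1) → ℂ) = (∏ l, (μ l + z)) * pairProd μ := by
  rw [pairProd_succAbove _ 0]
  simp

/-- Both sides are polynomials in the first μ, of degree at most the number of roots. They agree at
the points ±r_k, which are twice as many, by `signSum_cons_root` and induction. -/
theorem signSum_eq {m : ℕ} {r : Fin m → ℂ} (hr : ∀ k, r k ≠ 0)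
    (h : ∀ k l, k ≠ l → r k ^ 2 ≠ r l ^ 2) (μ : Fin (m + 1) → ℂ) :
    signSum r μ = 2 ^ m * (∏ k, r k) * pairProd μ := by
  induction m with
  | zero => simp [signSum, pairProd]
  | succ m ih =>
    open Polynomial in
    let ν : Fin (m + 1) → ℂ := Fin.tail μ
    let x : (Fin (m + 1) → ZMod 2) → Fin (m + 1) → ℂ := fun τ k => sgn (τ k) * r k
    let p : ℂ[X] := ∑ τ, C ((∏ k, sgn (τ k) * ∏ j, (x τ k + ν j)) / pairProd (x τ))
        * ∏ k, (X + C (x τ k))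
      - C (2 ^ (m + 1) * (∏ k, r k) * pairProd ν) * ∏ k, (X + C (ν k))
    have hp : ∀ z, p.eval z = signSum r (Fin.cons z ν)
        - 2 ^ (m + 1) * (∏ k, r k) * pairProd (Fin.cons z ν) := by
      intro z
      simp only [p, eval_sub, eval_finsetSum, eval_mul, eval_C, eval_prod, eval_add, eval_X,
        pairProd_cons, signSum, Fin.prod_univ_succ (n := m + 1), Fin.cons_zero, Fin.cons_succ]
      congr 1
      · refine sum_congr rfl fun τ _ => ?_
        rw [div_mul_eq_mul_div]
        congr 1
        simp only [← prod_mul_distrib]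
        refine prod_congr rfl fun k _ => ?_
        ring
      · simp only [add_comm z]
        ring
    have hdeg : ∀ y : Fin (m + 1) → ℂ, (∏ k, (X + C (y k))).natDegree ≤ m + 1 := fun y => by
      refine (natDegree_prod_le _ _).trans ?_
      simp
    have hdeg : p.natDegree ≤ m + 1 := by
      refine (natDegree_sub_le _ _).trans (max_le ?_ ?_)
      · exact natDegree_sum_le_of_forall_le _ _ fun τ _ => (natDegree_C_mul_le _ _).trans (hdeg _)
      · exact (natDegree_C_mul_le _ _).trans (hdeg _)
    have hroot : ∀ y : Fin (m + 1) × ZMod 2, p.eval (sgn y.2 * r y.1) = 0 := by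
      rintro ⟨k, ε⟩
      rw [hp, signSum_cons_root h, ih (fun l => hr _)
        (fun l l' hl => h _ _ (k.succAbove_right_injective.ne hl)), pairProd_cons,
        Fin.prod_univ_succAbove r k]
      simp only [add_comm (ν _)]
      ring
    have hinj : Function.Injective fun y : Fin (m + 1) × ZMod 2 => sgn y.2 * r y.1 := by
      rintro ⟨k, ε⟩ ⟨k', ε'⟩ e
      simp only at e
      obtain rfl : k = k' := by
        by_contra hne
        have e2 := congrArg (· ^ 2) e
        simp only [mul_pow, sgn_sq, one_mul] at e2
        exact h k k' hne e2
      rw [sgn_injective (mul_right_cancel₀ (hr k) e)]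
    have hz : p = 0 := eq_zero_of_natDegree_lt_card_of_eval_eq_zero p hinj hroot (by
      rw [Fintype.card_prod, Fintype.card_fin, ZMod.card]; omega)
    have h0 := hp (μ 0)
    rw [hz, eval_zero, Fin.cons_self_tail] at h0
    exact (sub_eq_zero.1 h0.symm)

/-! ### The norm -/

/-- Single flips connect every configuration with 0. -/
theorem eq_of_flip_invariant {α : Type*} (f : (Fin i → ZMod 2) → α)
    (h : ∀ τ k, f (flip τ k) = f τ) (τ : Fin i → ZMod 2) : f τ = f 0 := by
  classical
  have key : ∀ s : Finset (Fin i), f (fun j => if j ∈ s then τ j else 0) = f 0 := by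
    intro s
    induction s using Finset.induction_on with
    | empty => congr 1
    | insert a s ha ih =>
      rw [← ih]
      obtain h0 | h1 := zmod_two_cases (τ a)
      · congr 1
        funext j
        by_cases hj : j = a
        · simp [hj, ha, h0]
        · simp [hj]
      · rw [← h (fun j => if j ∈ s then τ j else 0) a]
        congr 1
        funext j
        by_cases hj : j = a
        · subst hj; simp [flip_same, ha, h1]
        · simp [flip_of_ne _ hj, hj]
  simpa using key univ

theorem prod_erase_eq_succAbove {m : ℕ} (f : Fin (m + 1) → ℂ) (k : Fin (m + 1)) :
    ∏ s ∈ univ.erase k, f s = ∏ l : Fin m, f (k.succAbove l) := by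
  have : (univ.erase k : Finset (Fin (m + 1))) = univ.map k.succAboveEmb := by
    rw [Fin.univ_succAbove _ k, erase_cons]
  rw [this, prod_map]
  rfl

theorem pairProd_node_flip (hS : SameLevel R i) (τ : Fin i → ZMod 2) (k : Fin i) :
    pairProd (fun l => -node R i (flip τ k) l)
      = (∏ s ∈ univ.erase k, (node R i τ k - node R i τ s) / (-node R i τ k - node R i τ s))
        * pairProd (fun l => -node R i τ l) := by
  obtain _ | m := i
  · exact k.elim0
  rw [pairProd_succAbove _ k, pairProd_succAbove _ k, prod_erase_eq_succAbove, ← mul_assoc,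
    ← prod_mul_distrib]
  have hne (l : Fin m) := Fin.succAbove_ne k l
  congr 1
  · refine prod_congr rfl fun l _ => ?_
    rw [node_flip_same, node_flip_of_ne R _ τ (hne l), div_mul_eq_mul_div, eq_div_iff]
    · ring
    · intro h0
      refine hS.node_sq_ne τ τ (hne l) ?_
      linear_combination (node R (m + 1) τ k - node R (m + 1) τ (k.succAbove l)) * h0
  · congr 1
    funext l
    rw [node_flip_of_ne R _ τ (hne l)]

/-- The norm of the vector `PsiTildeR`, relative to the weights, up to the pair product. -/
def reducedNorm (P : Params) (R : Roots) (i : ℕ) (τ : Fin i → ZMod 2) : ℂ :=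
  pairing P R i (Fin.cons 0 τ) * pairProd (fun l => -node R i τ l) / offWeight R i τ ^ 2

/-- The pairing and the pair product each acquire the same ratio of node differences. The square of
the weights removes both, leaving the square of `levelRatio`. -/
theorem reducedNorm_flip (hadm : IsAdmissible P R n) (hgen : IsGeneric P R n)
    (hi : i + 1 ≤ n) (τ : Fin i → ZMod 2) (k : Fin i) :
    reducedNorm P R i (flip τ k) = (-1) ^ (i - 1) * reducedNorm P R i τ := by
  have hS := sameLevel hadm hgen hi
  have h1 := pairing_flip_succ hadm hgen hi (Fin.cons 0 τ) k
  have h2 := pairProd_node_flip hS τ k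
  have h3 := hS.offWeight_flip_eq τ k
  have h4 := hS.offWeight_ne_zero τ
  have h5 := hS.offWeight_ne_zero (flip τ k)
  have h6 := levelRatio_sq hS k
  have h8 := prod_sgn_sq τ
  have h9 : (sgn (τ k) ^ i) ^ 2 = 1 := by rw [← pow_mul, mul_comm, pow_mul, sgn_sq, one_pow]
  rw [Fin.tail_cons, flip_cons_succ] at h1
  rw [reducedNorm, reducedNorm, h1, h2]
  generalize (∏ s ∈ univ.erase k, (node R i τ k - node R i τ s)
    / (-node R i τ k - node R i τ s)) = p at *
  have h10 : p ^ 2 * offWeight R i τ ^ 2 = offWeight R i (flip τ k) ^ 2 * (-1) ^ (i - 1) := by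
    rw [← mul_pow, h3, ← h6, mul_pow, mul_pow, mul_pow, h8, h9]; ring
  rw [← mul_div_assoc, div_eq_div_iff (pow_ne_zero 2 h5) (pow_ne_zero 2 h4)]
  linear_combination (pairing P R i (Fin.cons 0 τ) * pairProd (fun l => -node R i τ l)) * h10

theorem reducedNorm_eq (hadm : IsAdmissible P R n) (hgen : IsGeneric P R n)
    (hi : i + 1 ≤ n) (τ : Fin i → ZMod 2) :
    reducedNorm P R i τ
      = (∏ k, if τ k = 0 then 1 else (-1) ^ (i - 1)) * reducedNorm P R i 0 := by
  have hcc : (-1 : ℂ) ^ (i - 1) * (-1) ^ (i - 1) = 1 := by rw [← mul_pow]; simp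
  -- Each flipped spin contributes (-1)^(i-1); multiplying by the product of these signs gives a
  -- flip-invariant function.
  have h := eq_of_flip_invariant (fun τ : Fin i → ZMod 2 =>
    (∏ k, if τ k = 0 then (1 : ℂ) else (-1) ^ (i - 1)) * reducedNorm P R i τ) (fun τ k => by
      rw [reducedNorm_flip hadm hgen hi, ← mul_prod_erase univ _ (mem_univ k),
        ← mul_prod_erase univ (fun k => if τ k = 0 then (1 : ℂ) else (-1) ^ (i - 1)) (mem_univ k)]
      have e : ∏ j ∈ univ.erase k, (if flip τ k j = 0 then (1 : ℂ) else (-1) ^ (i - 1))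
          = ∏ j ∈ univ.erase k, if τ j = 0 then (1 : ℂ) else (-1) ^ (i - 1) :=
        prod_congr rfl fun j hj => by rw [flip_of_ne τ (mem_erase.1 hj).1]
      rw [e, flip_same]
      obtain h0 | h0 := zmod_two_cases (τ k) <;> rw [h0]
      · rw [zero_add, if_neg one_ne_zero, if_pos rfl]
        linear_combination (reducedNorm P R i τ * ∏ j ∈ univ.erase k,
          if τ j = 0 then (1 : ℂ) else (-1) ^ (i - 1)) * hcc
      · rw [if_pos (show (1 : ZMod 2) + 1 = 0 from rfl), if_neg one_ne_zero]
        ring) τ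
  have hsq : (∏ k, if τ k = 0 then (1 : ℂ) else (-1) ^ (i - 1))
      * (∏ k, if τ k = 0 then (1 : ℂ) else (-1) ^ (i - 1)) = 1 := by
    rw [← prod_mul_distrib]
    refine prod_eq_one fun k _ => ?_
    split_ifs
    · rw [one_mul]
    · exact hcc
  simp only [Pi.zero_apply, if_true, prod_const_one, one_mul] at h
  rw [← h, ← mul_assoc, hsq, one_mul]

theorem offWeight_zero (R : Roots) (i : ℕ) : offWeight R i 0 = 1 := by
  refine prod_eq_one fun s _ => prod_eq_one fun s' _ => ?_
  rw [Pi.zero_apply, Pi.zero_apply, sub_zero, w_zero]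

/-- The right equation at λ = -r and the left one at λ = r contain the same two coefficients, up to
(-1)^i. Eliminating them leaves only values of t. -/
theorem baxter_mul {ρ : ZMod 2} {t : ℂ → ℂ} {qR qL : Fin i → ZMod 2 → ℂ}
    (hR : BaxterR P R i ρ t qR) (hL : BaxterL P R i ρ t qL) (hR0 : ∀ k, qR k 0 = 1)
    (hL0 : ∀ k, qL k 0 = 1) (k : Fin i) :
    t (R.r (i + 1) (k + 1)) * (qL k 1 * qR k 1) = (-1) ^ i * t (-R.r (i + 1) (k + 1)) := by
  have a := hR k 0
  have b := hL k 1
  have l0 : lamZero R (i + 1) (k + 1) 0 = -R.r (i + 1) (k + 1) := by simp [lamZero, sgn]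
  have l1 : lamZero R (i + 1) (k + 1) 1 = R.r (i + 1) (k + 1) := by
    rw [lamZero, sgn_neg, sgn_one]; ring
  have hsq : (-1 : ℂ) ^ i * (-1) ^ i = 1 := by rw [← mul_pow]; simp
  have hz : (-1 : ℂ) ^ (-(i : ℤ)) = (-1) ^ i := by
    rw [_root_.zpow_neg, zpow_natCast]; exact inv_eq_of_mul_eq_one_left hsq
  have e : (0 : ZMod 2) - 1 = 1 := rfl
  rw [l0, e, zero_add, hR0, neg_one_mul, neg_neg] at a
  rw [l1, hz, show (1 : ZMod 2) + 1 = 0 from rfl, sub_self, hL0, neg_one_mul] at b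
  linear_combination qR k 1 * b - (-1) ^ i * a

/-- The flip signs of `reducedNorm` and those of `baxter_mul` combine to -1 per flipped spin, which
is the factor `sgn (τ k)`. Each summand of the norm thus becomes explicit in r and t. -/
theorem sovKernel_mul_pairing (hadm : IsAdmissible P R n) (hgen : IsGeneric P R n)
    (hi : i + 1 ≤ n) {ρ : ZMod 2} {t : ℂ → ℂ} {qR qL : Fin i → ZMod 2 → ℂ}
    (hR : BaxterR P R i ρ t qR) (hL : BaxterL P R i ρ t qL) (hR0 : ∀ k, qR k 0 = 1)
    (hL0 : ∀ k, qL k 0 = 1) (htr : ∀ k : Fin i, t (R.r (i + 1) (k + 1)) ≠ 0)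
    (τ : Fin i → ZMod 2) :
    sovKernel R i qL τ * sovKernel R i qR τ * pairing P R i (Fin.cons 0 τ)
      = (∏ k, sgn (τ k) * (t (-node R i τ k) / t (R.r (i + 1) (k + 1))))
        * pairProd (fun l : Fin i => R.r (i + 1) (l + 1)) / pairProd (fun l => -node R i τ l)
        * pairing P R i (Fin.cons 0 0) := by
  have hS := sameLevel hadm hgen hi
  have hD : pairProd (fun l => -node R i τ l) ≠ 0 := pairProd_ne_zero fun k l hkl => by
    rw [neg_sq, neg_sq]; exact hS.node_sq_ne τ τ hkl
  have hO := hS.offWeight_ne_zero τ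
  have h := reducedNorm_eq hadm hgen hi τ
  have hq : (∏ k, qL k (τ k)) * (∏ k, qR k (τ k))
        * (∏ k, if τ k = 0 then (1 : ℂ) else (-1) ^ (i - 1))
      = ∏ k, sgn (τ k) * (t (-node R i τ k) / t (R.r (i + 1) (k + 1))) := by
    rw [← prod_mul_distrib, ← prod_mul_distrib]
    refine prod_congr rfl fun k _ => ?_
    have hb := baxter_mul hR hL hR0 hL0 k
    have hpow : (-1 : ℂ) ^ (i - 1) * (-1) ^ i = -1 := by
      rw [← pow_add]
      exact Odd.neg_one_pow ⟨i - 1, by have := k.2; omega⟩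
    rw [node, neg_neg]
    obtain h0 | h0 := zmod_two_cases (τ k) <;> rw [h0]
    · rw [hL0, hR0, if_pos rfl, sgn_zero, one_mul, one_mul, one_mul, one_mul, div_self (htr k)]
    · rw [if_neg one_ne_zero, sgn_one, neg_one_mul, neg_one_mul, ← neg_div, eq_div_iff (htr k)]
      linear_combination (-1) ^ (i - 1) * hb + t (-R.r (i + 1) (k + 1)) * hpow
  have hz : (fun l => -node R i (0 : Fin i → ZMod 2) l)
      = fun l : Fin i => R.r (i + 1) (l + 1) := by
    funext l
    rw [node, neg_neg, Pi.zero_apply, sgn_zero, one_mul]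
  rw [reducedNorm, reducedNorm, offWeight_zero, hz, one_pow, div_one,
    div_eq_iff (pow_ne_zero 2 hO)] at h
  rw [sovKernel_eq, sovKernel_eq, ← hq]
  field_simp
  linear_combination ((∏ k, qL k (τ k)) * (∏ k, qR k (τ k))) * h

/-- The factor relating the left vectors to the transposed model does not depend on the labels, so
it is common to both pairings and cancels in their ratio. -/
theorem PhiL_dotProduct_PhiR (hadm : IsAdmissible P R n) (hgen : IsGeneric P R n)
    (hi : i + 1 ≤ n) (ρ : ZMod 2) (qR qL : Fin i → ZMod 2 → ℂ) :
    ∃ C : ℂ, C ≠ 0 ∧ PhiL P R i ρ qL ⬝ᵥ PhiR P R i ρ qR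
      = C * ∑ τ, sovKernel R i qL τ * sovKernel R i qR τ * pairing P R i (Fin.cons 0 τ)
      ∧ PsiTildeL P R i 0 0 ⬝ᵥ PsiTildeR P R i 0 0 = C * pairing P R i (Fin.cons 0 0) := by
  obtain ⟨C, hC, h⟩ := PsiTildeL_eq hadm hgen hi
  refine ⟨C * 2, mul_ne_zero hC two_ne_zero, ?_, ?_⟩
  · rw [PhiL, PhiR, sum_dotProduct, mul_sum]
    refine sum_congr rfl fun τ _ => ?_
    rw [dotProduct_sum]
    simp only [h, smul_dotProduct, dotProduct_smul, dotProduct_PsiTildeR hadm hgen hi, smul_eq_mul,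
      mul_ite, mul_zero, sum_ite_eq, mem_univ, if_true]
    ring
  · rw [h, smul_dotProduct, dotProduct_PsiTildeR hadm hgen hi, if_pos rfl, smul_eq_mul, mul_assoc]

end BBS

end

/-! ### The theorem: eigenvectors and norm -/

theorem mainTheorem4 (P : BBS.Params) (R : BBS.Roots) (m : ℕ)
    (hadm : BBS.IsAdmissible P R (m + 1)) (hgen : BBS.IsGeneric P R (m + 1))
    (ρ : ZMod 2) (t : ℂ → ℂ) (Λ : ℂ) (μ : Fin (m + 1) → ℂ)
    (ht : ∀ lam : ℂ, t lam = Λ * ∏ k, (lam + μ k))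
    (heig : ∃ v, BBS.IsRightEigenvector P (m + 1) ρ t v)
    (htr : ∀ l : Fin m, t (R.r (m + 1) (l + 1)) ≠ 0)
    (qR qL : Fin m → ZMod 2 → ℂ)
    (hqR : BBS.BaxterR P R m ρ t qR) (hqL : BBS.BaxterL P R m ρ t qL)
    (hqR0 : ∀ k, qR k 0 = 1) (hqL0 : ∀ k, qL k 0 = 1) :
    BBS.IsRightEigenvector P (m + 1) ρ t (BBS.PhiR P R m ρ qR) ∧
    BBS.IsLeftEigenvector P (m + 1) ρ t (BBS.PhiL P R m ρ qL) ∧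
    BBS.PsiTildeL P R m 0 0 ⬝ᵥ BBS.PsiTildeR P R m 0 0 ≠ 0 ∧
    (BBS.PhiL P R m ρ qL ⬝ᵥ BBS.PhiR P R m ρ qR)
        / (BBS.PsiTildeL P R m 0 0 ⬝ᵥ BBS.PsiTildeR P R m 0 0)
      = 2 ^ m * (∏ l : Fin m, R.r (m + 1) (l + 1))
        * ((∏ l : Fin m, ∏ l' ∈ Finset.Ioi l,
              (R.r (m + 1) (l' + 1) + R.r (m + 1) (l + 1)))
          / ∏ k : Fin (m + 1), ∏ l : Fin m, (R.r (m + 1) (l + 1) + μ k))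
        * ∏ i : Fin (m + 1), ∏ j ∈ Finset.Ioi i, (μ i + μ j) := by
  have hi : m + 1 ≤ m + 1 := le_rfl
  have hpoly : BBS.IsEigenvaluePoly P m ρ t := by
    obtain ⟨v, hv⟩ := heig
    refine BBS.isEigenvaluePoly (c₀ := Λ * ∏ k, μ k) (cₙ := Λ) ?_ hv
    have h := (BBS.isPoly_prod_sub fun k => -μ k).map (LinearMap.lsmul ℂ ℂ Λ)
    simp only [sub_neg_eq_add, neg_neg, LinearMap.lsmul_apply, smul_eq_mul, mul_one] at h
    rwa [funext ht]
  obtain ⟨C, hC, h1, h2⟩ := BBS.PhiL_dotProduct_PhiR hadm hgen hi ρ qR qL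
  have hN := BBS.pairing_ne_zero hadm hgen hi (Fin.cons 0 0)
  have hne : BBS.PsiTildeL P R m 0 0 ⬝ᵥ BBS.PsiTildeR P R m 0 0 ≠ 0 := by
    rw [h2]; exact mul_ne_zero hC hN
  refine ⟨BBS.isRightEigenvector_PhiR hadm hgen hi hpoly hqR hqR0,
    BBS.isLeftEigenvector_PhiL hadm hgen hi hpoly hqL hqL0, hne, ?_⟩
  have hS := BBS.sameLevel hadm hgen hi
  have hsum := BBS.signSum_eq hS.r_ne hS.sq_ne μ
  have hμ : BBS.pairProd μ = ∏ i : Fin (m + 1), ∏ j ∈ Finset.Ioi i, (μ i + μ j) := by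
    simp only [BBS.pairProd, add_comm]
  rw [div_eq_iff hne, h1, h2]
  have key : ∀ τ : Fin m → ZMod 2,
      BBS.sovKernel R m qL τ * BBS.sovKernel R m qR τ * BBS.pairing P R m (Fin.cons 0 τ)
      = ((∏ k, BBS.sgn (τ k) * ∏ j, (BBS.sgn (τ k) * R.r (m + 1) (k + 1) + μ j))
          / BBS.pairProd (fun k : Fin m => BBS.sgn (τ k) * R.r (m + 1) (k + 1)))
        * (BBS.pairProd (fun l : Fin m => R.r (m + 1) (l + 1))
          / (∏ k : Fin (m + 1), ∏ l : Fin m, (R.r (m + 1) (l + 1) + μ k))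
          * BBS.pairing P R m (Fin.cons 0 0)) := by
    intro τ
    rw [BBS.sovKernel_mul_pairing hadm hgen hi hqR hqL hqR0 hqL0 htr]
    simp only [BBS.node, neg_neg]
    have e : ∏ k : Fin m, BBS.sgn (τ k) * (t (BBS.sgn (τ k) * R.r (m + 1) (k + 1))
          / t (R.r (m + 1) (k + 1)))
        = (∏ k, BBS.sgn (τ k) * ∏ j, (BBS.sgn (τ k) * R.r (m + 1) (k + 1) + μ j))
          / ∏ k : Fin (m + 1), ∏ l : Fin m, (R.r (m + 1) (l + 1) + μ k) := by
      -- Grouping the denominator by roots matches it with the values of t at the r_{n,k}. The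
      -- common factor `Λ` then cancels, being non-zero because t does not vanish there.
      rw [Finset.prod_comm, ← Finset.prod_div_distrib]
      refine Finset.prod_congr rfl fun k _ => ?_
      have hk := htr k
      rw [ht] at hk
      rw [ht, ht, mul_div_mul_left _ _ (left_ne_zero_of_mul hk), mul_div_assoc]
    rw [e]
    ring
  rw [Finset.sum_congr rfl fun τ _ => key τ, ← Finset.sum_mul]
  rw [BBS.signSum] at hsum
  rw [hsum, hμ, BBS.pairProd]
  ring
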